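/- Let there be $n \ge 1$ agents and $m \ge 0$ items, and for every agent $i \in [n]$ a valuation $v_i : 2^{[m]} \to \mathbb{R}_{\ge 0}$ that is monotone ($v_i(S) \le v_i(T)$ for $S \subseteq T$) and subadditive ($v_i(S \cup T) \le v_i(S) + v_i(T)$ for all $S, T \subseteq [m]$). An allocation is a vector $X = (X_1, \dots, X_n)$ of pairwise disjoint subsets of $[m]$; it is complete if $\bigcup_i X_i = [m]$. Its Nash welfare is $\mathrm{NW}(X) = \prod_{i \in [n]} v_i(X_i)^{1/n}$. An allocation $Z$ is $\beta$-MNW if $\mathrm{NW}(Z) \ge \beta \cdot \mathrm{NW}(Y)$ for every allocation $Y$, complete or not. An allocation $X$ is $\alpha$-EFX if $v_i(X_i) \ge \alpha \cdot v_i(X_j \setminus \{g\})$ for all agents $i, j$ and all $g \in X_j$. **Theorem.** There is a polynomial-time algorithm with the following property. Given $n$, $m$, a real number $\alpha \in [0, 1/2]$, value-oracle access to monotone subadditive valuations $v_1, \dots, v_n$, and an allocation $X$ that is $\beta$-MNW for some $\beta \in [0,1]$ (the number $\beta$ is not given to the algorithm), it outputs a complete allocation that is $\alpha$-EFX and $\frac{\beta}{\alpha+1}$-MNW.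 Here an algorithm is one fixed program, the same for all inputs, of a random access machine with a memory for natural numbers (with addition and truncated subtraction) and a memory for subsets of $[m]$ (with the empty set, singletons, union, difference and membership). It reaches $\alpha$ and the valuations only by comparing real terms of the program that are built by addition and multiplication from natural constants, $\alpha$ and answers to value queries $v_i(S)$. Each elementary operation, including a value query, costs one step, and each operation that reads, makes or stores a subset of $[m]$ costs $m$ additional steps. Polynomial time means that there is one polynomial $p$ with natural coefficients such that the program always halts after at most $p(n+m)$ steps; $p$ does not depend on the valuations, $X$, $\alpha$ or $\beta$. -/

import Mathlib

namespace FairDivision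

/-! ### Allocation of indivisible items -/

/-- A valuation of bundles of `m` items: nonnegative, monotone and subadditive. -/
structure IsSubadditiveValuation {m : ℕ} (u : Finset (Fin m) → ℝ) : Prop where
  nonneg : ∀ S, 0 ≤ u S
  mono : ∀ S T, S ⊆ T → u S ≤ u T
  subadditive : ∀ S T, u (S ∪ T) ≤ u S + u T

/-- The bundles of distinct agents are disjoint; items may be left unallocated. -/
def IsAllocation {n m : ℕ} (X : Fin n → Finset (Fin m)) : Prop :=
  ∀ i j, i ≠ j → Disjoint (X i) (X j)

/-- Every item is allocated. -/
def IsComplete {n m : ℕ} (X : Fin n → Finset (Fin m)) : Prop :=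
  ∀ g, ∃ i, g ∈ X i

/-- The geometric mean of the agents' values. -/
noncomputable def nashWelfare {n m : ℕ} (v : Fin n → Finset (Fin m) → ℝ)
    (X : Fin n → Finset (Fin m)) : ℝ :=
  ∏ i, v i (X i) ^ (1 / (n : ℝ))

/-- The Nash welfare of `Z` is at least `β` times the Nash welfare of every (complete or partial)
allocation, that is, at least `β` times the maximum Nash welfare. -/
def IsApproxMNW {n m : ℕ} (v : Fin n → Finset (Fin m) → ℝ) (β : ℝ)
    (Z : Fin n → Finset (Fin m)) : Prop :=
  ∀ Y : Fin n → Finset (Fin m), IsAllocation Y → β * nashWelfare v Y ≤ nashWelfare v Z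

/-- Approximate envy-freeness up to any item. -/
def IsApproxEFX {n m : ℕ} (v : Fin n → Finset (Fin m) → ℝ) (α : ℝ)
    (X : Fin n → Finset (Fin m)) : Prop :=
  ∀ i j, ∀ g ∈ X j, α * v i (X j \ {g}) ≤ v i (X i)

/-! ### A machine model with a value oracle

A random access machine that runs a structured program. It has two memories, one with natural
numbers and one with bundles of items, both with indirect addressing. It can read the numbers `n`
of agents and `m` of items, and it reaches the parameter `α` and the valuations only through
comparisons of real terms that are built from `α`, answers to value queries, and natural constants.

Running time: every node of an expression that is evaluated and every instruction that is executed
costs one step, and every operation that reads or makes a bundle costs `m` further steps (a bundle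
is a bit vector of length `m`). A value query costs one step on top of the evaluation of its
arguments. Natural numbers have addition and truncated subtraction but no multiplication, so that
in `t` steps they only reach `O(t + log (n + m))` bits. Real numbers cannot be stored: the real terms in a
program have a size that is fixed by the program. -/

/-- Expressions for natural numbers. -/
inductive NatExp : Type
  | const (k : ℕ)
  | agents
  | items
  | load (addr : NatExp)
  | add (a b : NatExp)
  | sub (a b : NatExp)

/-- Expressions for bundles. -/
inductive BundleExp : Type
  | empty
  | single (item : NatExp)
  | load (addr : NatExp)
  | union (A B : BundleExp)
  | diff (A B : BundleExp)

/-- Expressions for real numbers; `value i S` is a query to the value oracle. -/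
inductive RealExp : Type
  | const (k : ℕ)
  | alpha
  | value (agent : NatExp) (S : BundleExp)
  | add (a b : RealExp)
  | mul (a b : RealExp)

/-- Tests. -/
inductive Test : Type
  | natLE (a b : NatExp)
  | mem (item : NatExp) (S : BundleExp)
  | realLE (a b : RealExp)
  | not (c : Test)
  | and (c d : Test)

/-- Programs: assignment to a cell of the memory for numbers, assignment to a cell of the memory
for bundles, sequential composition, conditional, and while loop. -/
inductive Program : Type
  | setNat (addr e : NatExp)
  | setBundle (addr : NatExp) (S : BundleExp)
  | seq (P Q : Program)
  | branch (c : Test) (P Q : Program)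
  | loop (c : Test) (P : Program)

/-- A memory state. -/
structure State (m : ℕ) : Type where
  num : ℕ → ℕ
  bundle : ℕ → Finset (Fin m)

/-- The value of an expression for numbers, for `n` agents and `m` items. -/
def NatExp.eval (n : ℕ) {m : ℕ} (σ : State m) : NatExp → ℕ
  | .const k => k
  | .agents => n
  | .items => m
  | .load a => σ.num (a.eval n σ)
  | .add a b => a.eval n σ + b.eval n σ
  | .sub a b => a.eval n σ - b.eval n σ

/-- The number of steps to evaluate an expression for numbers. -/
def NatExp.cost : NatExp → ℕ
  | .const _ => 1
  | .agents => 1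
  | .items => 1
  | .load a => a.cost + 1
  | .add a b => a.cost + b.cost + 1
  | .sub a b => a.cost + b.cost + 1

/-- The value of an expression for bundles. A number `k ≥ m` is not an item, and then `single`
gives the empty bundle. -/
def BundleExp.eval (n : ℕ) {m : ℕ} (σ : State m) : BundleExp → Finset (Fin m)
  | .empty => ∅
  | .single e => Finset.univ.filter fun g => (g : ℕ) = e.eval n σ
  | .load a => σ.bundle (a.eval n σ)
  | .union A B => A.eval n σ ∪ B.eval n σ
  | .diff A B => A.eval n σ \ B.eval n σ

/-- The number of steps to evaluate an expression for bundles of `m` items. -/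
def BundleExp.cost (m : ℕ) : BundleExp → ℕ
  | .empty => m + 1
  | .single e => e.cost + m + 1
  | .load a => a.cost + m + 1
  | .union A B => A.cost m + B.cost m + m + 1
  | .diff A B => A.cost m + B.cost m + m + 1

/-- The value of an expression for reals. A number `k ≥ n` is not an agent, and then the oracle
answers `0`. -/
noncomputable def RealExp.eval {n m : ℕ} (α : ℝ) (v : Fin n → Finset (Fin m) → ℝ)
    (σ : State m) : RealExp → ℝ
  | .const k => k
  | .alpha => α
  | .value e S => if h : e.eval n σ < n then v ⟨e.eval n σ, h⟩ (S.eval n σ) else 0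
  | .add a b => a.eval α v σ + b.eval α v σ
  | .mul a b => a.eval α v σ * b.eval α v σ

/-- The number of steps to evaluate an expression for reals. -/
def RealExp.cost (m : ℕ) : RealExp → ℕ
  | .const _ => 1
  | .alpha => 1
  | .value e S => e.cost + S.cost m + 1
  | .add a b => a.cost m + b.cost m + 1
  | .mul a b => a.cost m + b.cost m + 1

/-- The outcome of a test. -/
def Test.Holds {n m : ℕ} (α : ℝ) (v : Fin n → Finset (Fin m) → ℝ) (σ : State m) : Test → Prop
  | .natLE a b => a.eval n σ ≤ b.eval n σ
  | .mem e S => ∃ g ∈ S.eval n σ, (g : ℕ) = e.eval n σ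
  | .realLE a b => a.eval α v σ ≤ b.eval α v σ
  | .not c => ¬ c.Holds α v σ
  | .and c d => c.Holds α v σ ∧ d.Holds α v σ

/-- The number of steps to carry out a test. -/
def Test.cost (m : ℕ) : Test → ℕ
  | .natLE a b => a.cost + b.cost + 1
  | .mem e S => e.cost + S.cost m + 1
  | .realLE a b => a.cost m + b.cost m + 1
  | .not c => c.cost m + 1
  | .and c d => c.cost m + d.cost m + 1

/-- `Exec α v P σ t τ`: with parameter `α` and value oracle `v`, the program `P`, started in the
state `σ`, halts after exactly `t` steps in the state `τ`. -/
inductive Exec {n m : ℕ} (α : ℝ) (v : Fin n → Finset (Fin m) → ℝ) :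
    Program → State m → ℕ → State m → Prop
  | setNat (a e : NatExp) (σ : State m) :
      Exec α v (.setNat a e) σ (a.cost + e.cost + 1)
        ⟨Function.update σ.num (a.eval n σ) (e.eval n σ), σ.bundle⟩
  | setBundle (a : NatExp) (S : BundleExp) (σ : State m) :
      Exec α v (.setBundle a S) σ (a.cost + S.cost m + m + 1)
        ⟨σ.num, Function.update σ.bundle (a.eval n σ) (S.eval n σ)⟩
  | seq {P Q : Program} {σ τ ρ : State m} {s t : ℕ} :
      Exec α v P σ s τ → Exec α v Q τ t ρ → Exec α v (.seq P Q) σ (s + t + 1) ρ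
  | branch_true {c : Test} {P Q : Program} {σ τ : State m} {t : ℕ} :
      c.Holds α v σ → Exec α v P σ t τ → Exec α v (.branch c P Q) σ (c.cost m + t + 1) τ
  | branch_false {c : Test} {P Q : Program} {σ τ : State m} {t : ℕ} :
      ¬ c.Holds α v σ → Exec α v Q σ t τ → Exec α v (.branch c P Q) σ (c.cost m + t + 1) τ
  | loop_true {c : Test} {P : Program} {σ τ ρ : State m} {s t : ℕ} :
      c.Holds α v σ → Exec α v P σ s τ → Exec α v (.loop c P) τ t ρ →
        Exec α v (.loop c P) σ (c.cost m + s + t + 1) ρ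
  | loop_false {c : Test} {P : Program} {σ : State m} :
      ¬ c.Holds α v σ → Exec α v (.loop c P) σ (c.cost m + 1) σ

/-- Programs are deterministic: a halting run has exactly one running time and one final state. -/
theorem Exec.deterministic {n m : ℕ} {α : ℝ} {v : Fin n → Finset (Fin m) → ℝ} {P : Program}
    {σ τ τ' : State m} {t t' : ℕ} (h : Exec α v P σ t τ) (h' : Exec α v P σ t' τ') :
    t = t' ∧ τ = τ' := by
  induction h generalizing t' τ' with
  | setNat a e σ => cases h'; exact ⟨rfl, rfl⟩
  | setBundle a S σ => cases h'; exact ⟨rfl, rfl⟩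
  | seq _ _ ih1 ih2 =>
    cases h' with
    | seq k1 k2 =>
      obtain ⟨rfl, rfl⟩ := ih1 k1
      obtain ⟨rfl, rfl⟩ := ih2 k2
      exact ⟨rfl, rfl⟩
  | branch_true hc _ ih =>
    cases h' with
    | branch_true _ k => obtain ⟨rfl, rfl⟩ := ih k; exact ⟨rfl, rfl⟩
    | branch_false kc _ => exact absurd hc kc
  | branch_false hc _ ih =>
    cases h' with
    | branch_true kc _ => exact absurd kc hc
    | branch_false _ k => obtain ⟨rfl, rfl⟩ := ih k; exact ⟨rfl, rfl⟩
  | loop_true hc _ _ ih1 ih2 =>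
    cases h' with
    | loop_true _ k1 k2 =>
      obtain ⟨rfl, rfl⟩ := ih1 k1
      obtain ⟨rfl, rfl⟩ := ih2 k2
      exact ⟨rfl, rfl⟩
    | loop_false kc => exact absurd hc kc
  | loop_false hc =>
    cases h' with
    | loop_true kc _ _ => exact absurd kc hc
    | loop_false _ => exact ⟨rfl, rfl⟩

/-- The initial state: the bundle of agent `i` is in cell `i` of the memory for bundles, and
everything else is `0` or empty. -/
def inputState {n m : ℕ} (X : Fin n → Finset (Fin m)) : State m where
  num := fun _ => 0
  bundle := fun k => if h : k < n then X ⟨k, h⟩ else ∅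

/-- The output: the bundle of agent `i` is read from cell `i` of the memory for bundles. -/
def outputOf (n : ℕ) {m : ℕ} (τ : State m) : Fin n → Finset (Fin m) :=
  fun i => τ.bundle i

end FairDivision

/-! It suffices to reach a complete α-EFX allocation Z with ∏ v_i(X_i) ≤ (1+α)^n ∏ v_i(Z_i). The
n-th root turns this into NW(X) ≤ (1+α) NW(Z), and X is β-MNW.

Shrinking. Suppose k strongly envies l, and let S be the bundle of l without the item in question,
so that k's own bundle is worth less than α·v_k(S) to k. If l holds a chunk received earlier, S
passes to k and l falls back on an older slot. If l holds a base bundle and S is still good enough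
for l, the base is trimmed to S. Otherwise S is cut off as a chunk for k, and l keeps the rest of a
reference bundle. Since S is worth little to l, subadditivity makes that rest worth a lot. The
thresholds for l's base are 1/(1+α) of v_l(X_l) before the first cut, α/(1+α) of it after one cut,
and α times the value of the reference bundle from then on. The second cut starts afresh from X_l,
so the older chunks of X_l are discarded. It leaves a reference bundle worth 1/(1+α) of v_l(X_l),
and every later cut costs at most a factor α because 1 - α ≥ α.

Accounting. Agent l loses at most a factor 1+α and one factor 1/α per live chunk cut from X_l
(`Config.Inv.pow_mul_le`), while each live chunk that k owns raises k's value by a factor of at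
least 1/α (`Config.Inv.val_base_le`). Every live chunk has one origin and one owner, so in the
product over all agents the powers of α cancel (`Config.Inv.prod_le`).

Completion. As long as an item g is unallocated, there are three cases. An agent who prefers g alone
to the current bundle swaps that bundle for g. If there is no such agent, an agent whom nobody
envies receives g; the enlarged bundle is worth at most twice anybody's own value, which is harmless
for α ≤ 1/2 (`Problem.Sound.update_union`). If everybody is envied, bundles move along an envy
cycle. No value ever drops, so the product bound survives.

Both phases terminate by lexicographic measures of polynomial size. `Spec` packages correctness with
a polynomial time bound, and `Spec.loop` turns a bounded decreasing measure into such a bound. -/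

namespace FairDivision

/-! ### Specifications of programs with polynomial running time -/

/-- An input of the algorithm: a valuation profile, the parameter `α` and an allocation. -/
structure Problem : Type where
  n : ℕ
  m : ℕ
  n_pos : 1 ≤ n
  v : Fin n → Finset (Fin m) → ℝ
  valuation : ∀ i, IsSubadditiveValuation (v i)
  α : ℝ
  α_nonneg : 0 ≤ α
  α_le : α ≤ 1 / 2
  X : Fin n → Finset (Fin m)
  isAllocation : IsAllocation X

/-- From every state that satisfies `pre`, the program halts within polynomially many steps, and
the initial and the final state are related by `post`. -/
def Spec (P : Program) (pre : ∀ I : Problem, State I.m → Prop)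
    (post : ∀ I : Problem, State I.m → State I.m → Prop) : Prop :=
  ∃ q : Polynomial ℕ, ∀ (I : Problem) (σ : State I.m), pre I σ →
    ∃ t τ, Exec I.α I.v P σ t τ ∧ t ≤ q.eval (I.n + I.m) ∧ post I σ τ

/-- Natural coefficients make polynomials monotone, so cost bounds in `m` carry over to `n + m`. -/
theorem eval_mono (q : Polynomial ℕ) {a b : ℕ} (h : a ≤ b) : q.eval a ≤ q.eval b := by
  rw [Polynomial.eval_eq_sum, Polynomial.eval_eq_sum]
  exact Finset.sum_le_sum fun i _ => Nat.mul_le_mul_left _ (Nat.pow_le_pow_left h i)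

theorem BundleExp.exists_cost_le (S : BundleExp) :
    ∃ q : Polynomial ℕ, ∀ m, S.cost m ≤ q.eval m := by
  induction S with
  | empty => exact ⟨.X + 1, fun m => by simp [BundleExp.cost]⟩
  | single e => exact ⟨.C e.cost + .X + 1, fun m => by simp [BundleExp.cost]⟩
  | load e => exact ⟨.C e.cost + .X + 1, fun m => by simp [BundleExp.cost]⟩
  | union A B hA hB =>
    obtain ⟨a, ha⟩ := hA
    obtain ⟨b, hb⟩ := hB
    refine ⟨a + b + .X + 1, fun m => ?_⟩
    have := ha m
    have := hb m
    simp only [BundleExp.cost, Polynomial.eval_add, Polynomial.eval_X, Polynomial.eval_one]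
    omega
  | diff A B hA hB =>
    obtain ⟨a, ha⟩ := hA
    obtain ⟨b, hb⟩ := hB
    refine ⟨a + b + .X + 1, fun m => ?_⟩
    have := ha m
    have := hb m
    simp only [BundleExp.cost, Polynomial.eval_add, Polynomial.eval_X, Polynomial.eval_one]
    omega

theorem RealExp.exists_cost_le (r : RealExp) :
    ∃ q : Polynomial ℕ, ∀ m, r.cost m ≤ q.eval m := by
  induction r with
  | const k => exact ⟨1, fun m => by simp [RealExp.cost]⟩
  | alpha => exact ⟨1, fun m => by simp [RealExp.cost]⟩
  | value e S =>
    obtain ⟨a, ha⟩ := S.exists_cost_le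
    exact ⟨.C e.cost + a + 1, fun m => by simpa [RealExp.cost] using ha m⟩
  | add A B hA hB =>
    obtain ⟨a, ha⟩ := hA
    obtain ⟨b, hb⟩ := hB
    refine ⟨a + b + 1, fun m => ?_⟩
    simpa [RealExp.cost] using add_le_add (ha m) (hb m)
  | mul A B hA hB =>
    obtain ⟨a, ha⟩ := hA
    obtain ⟨b, hb⟩ := hB
    refine ⟨a + b + 1, fun m => ?_⟩
    simpa [RealExp.cost] using add_le_add (ha m) (hb m)

theorem Test.exists_cost_le (c : Test) :
    ∃ q : Polynomial ℕ, ∀ m, c.cost m ≤ q.eval m := by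
  induction c with
  | natLE a b => exact ⟨.C (a.cost + b.cost + 1), fun m => by simp [Test.cost]⟩
  | mem e S =>
    obtain ⟨a, ha⟩ := S.exists_cost_le
    exact ⟨.C e.cost + a + 1, fun m => by simpa [Test.cost] using ha m⟩
  | realLE A B =>
    obtain ⟨a, ha⟩ := A.exists_cost_le
    obtain ⟨b, hb⟩ := B.exists_cost_le
    exact ⟨a + b + 1, fun m => by simpa [Test.cost] using add_le_add (ha m) (hb m)⟩
  | not c hc =>
    obtain ⟨a, ha⟩ := hc
    exact ⟨a + 1, fun m => by simpa [Test.cost] using ha m⟩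
  | and A B hA hB =>
    obtain ⟨a, ha⟩ := hA
    obtain ⟨b, hb⟩ := hB
    exact ⟨a + b + 1, fun m => by simpa [Test.cost] using add_le_add (ha m) (hb m)⟩

theorem Spec.mono {P : Program} {pre pre' : ∀ I : Problem, State I.m → Prop}
    {post post' : ∀ I : Problem, State I.m → State I.m → Prop} (h : Spec P pre post)
    (hpre : ∀ I σ, pre' I σ → pre I σ)
    (hpost : ∀ I σ τ, pre' I σ → post I σ τ → post' I σ τ) : Spec P pre' post' := by
  obtain ⟨q, hq⟩ := h
  refine ⟨q, fun I σ hσ => ?_⟩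
  obtain ⟨t, τ, he, ht, hp⟩ := hq I σ (hpre I σ hσ)
  exact ⟨t, τ, he, ht, hpost I σ τ hσ hp⟩

theorem Spec.seq {P Q : Program} {pre pre₂ : ∀ I : Problem, State I.m → Prop}
    {post₁ post₂ post : ∀ I : Problem, State I.m → State I.m → Prop}
    (hP : Spec P pre post₁) (hQ : Spec Q pre₂ post₂)
    (hmid : ∀ I σ τ, pre I σ → post₁ I σ τ → pre₂ I τ)
    (hpost : ∀ I σ τ ρ, pre I σ → post₁ I σ τ → post₂ I τ ρ → post I σ ρ) :
    Spec (.seq P Q) pre post := by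
  obtain ⟨p, hp⟩ := hP
  obtain ⟨q, hq⟩ := hQ
  refine ⟨p + q + 1, fun I σ hσ => ?_⟩
  obtain ⟨s, τ, he, hs, h₁⟩ := hp I σ hσ
  obtain ⟨t, ρ, he', ht, h₂⟩ := hq I τ (hmid I σ τ hσ h₁)
  refine ⟨_, ρ, .seq he he', ?_, hpost I σ τ ρ hσ h₁ h₂⟩
  simpa using add_le_add hs ht

theorem Spec.branch {c : Test} {P Q : Program} {pre : ∀ I : Problem, State I.m → Prop}
    {post : ∀ I : Problem, State I.m → State I.m → Prop}
    (hP : Spec P (fun I σ => pre I σ ∧ c.Holds I.α I.v σ) post)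
    (hQ : Spec Q (fun I σ => pre I σ ∧ ¬ c.Holds I.α I.v σ) post) :
    Spec (.branch c P Q) pre post := by
  obtain ⟨p, hp⟩ := hP
  obtain ⟨q, hq⟩ := hQ
  obtain ⟨r, hr⟩ := c.exists_cost_le
  refine ⟨r + (p + q) + 1, fun I σ hσ => ?_⟩
  have hc : c.cost I.m ≤ r.eval (I.n + I.m) := (hr _).trans (eval_mono r (Nat.le_add_left _ _))
  simp only [Polynomial.eval_add, Polynomial.eval_one]
  by_cases h : c.Holds I.α I.v σ
  · obtain ⟨t, τ, he, ht, h'⟩ := hp I σ ⟨hσ, h⟩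
    exact ⟨_, τ, .branch_true h he, by omega, h'⟩
  · obtain ⟨t, τ, he, ht, h'⟩ := hq I σ ⟨hσ, h⟩
    exact ⟨_, τ, .branch_false h he, by omega, h'⟩

/-- Every iteration costs at most one test and one run of the body and lowers `μ`, which is at most
`b` at the start. The invariant refers to the state before the loop, which the body does not see;
hence the body has to preserve it for all such states at once. -/
theorem Spec.loop {c : Test} {P : Program} {inv : ∀ I : Problem, State I.m → State I.m → Prop}
    {pre : ∀ I : Problem, State I.m → Prop} (μ : ∀ I : Problem, State I.m → ℕ)
    (b : Polynomial ℕ) (hinit : ∀ I σ, pre I σ → inv I σ σ)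
    (hb : ∀ I σ τ, inv I σ τ → μ I τ ≤ b.eval (I.n + I.m))
    (hP : Spec P (fun I τ => (∃ σ, inv I σ τ) ∧ c.Holds I.α I.v τ)
      (fun I τ ρ => (∀ σ, inv I σ τ → inv I σ ρ) ∧ μ I ρ < μ I τ)) :
    Spec (.loop c P) pre (fun I σ τ => inv I σ τ ∧ ¬ c.Holds I.α I.v τ) := by
  obtain ⟨p, hp⟩ := hP
  obtain ⟨r, hr⟩ := c.exists_cost_le
  refine ⟨(b + 1) * (r + p + 1), fun I σ hσ => ?_⟩
  have hc : c.cost I.m ≤ r.eval (I.n + I.m) := (hr _).trans (eval_mono r (Nat.le_add_left _ _))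
  have key : ∀ (k : ℕ) (τ : State I.m), inv I σ τ → μ I τ ≤ k →
      ∃ t ρ, Exec I.α I.v (.loop c P) τ t ρ ∧
        t ≤ (k + 1) * (r.eval (I.n + I.m) + p.eval (I.n + I.m) + 1) ∧
        inv I σ ρ ∧ ¬ c.Holds I.α I.v ρ := by
    intro k
    induction k with
    | zero =>
      intro τ hτ hk
      by_cases h : c.Holds I.α I.v τ
      · obtain ⟨t, ρ, -, -, -, h'⟩ := hp I τ ⟨⟨σ, hτ⟩, h⟩
        omega
      · exact ⟨_, τ, .loop_false h, by omega, hτ, h⟩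
    | succ k ih =>
      intro τ hτ hk
      by_cases h : c.Holds I.α I.v τ
      · obtain ⟨t, ρ, he, ht, h₁, h₂⟩ := hp I τ ⟨⟨σ, hτ⟩, h⟩
        obtain ⟨t', ρ', he', ht', h₃⟩ := ih ρ (h₁ σ hτ) (by omega)
        refine ⟨_, ρ', .loop_true h he he', ?_, h₃⟩
        rw [add_mul (k + 1)]
        omega
      · refine ⟨_, τ, .loop_false h, ?_, hτ, h⟩
        rw [add_mul (k + 1)]
        omega
  obtain ⟨t, τ, he, ht, h⟩ := key (b.eval (I.n + I.m)) σ (hinit I σ hσ) (hb I σ σ (hinit I σ hσ))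
  exact ⟨t, τ, he, by simpa using ht, h⟩

/-- Programs without loops. -/
def Program.LoopFree : Program → Prop
  | .setNat _ _ => True
  | .setBundle _ _ => True
  | .seq P Q => P.LoopFree ∧ Q.LoopFree
  | .branch _ P Q => P.LoopFree ∧ Q.LoopFree
  | .loop _ _ => False

open Classical in
/-- The final state of a run of a program without loops. -/
noncomputable def Program.denote {n m : ℕ} (α : ℝ) (v : Fin n → Finset (Fin m) → ℝ) :
    Program → State m → State m
  | .setNat a e, σ => ⟨Function.update σ.num (a.eval n σ) (e.eval n σ), σ.bundle⟩
  | .setBundle a S, σ => ⟨σ.num, Function.update σ.bundle (a.eval n σ) (S.eval n σ)⟩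
  | .seq P Q, σ => Q.denote α v (P.denote α v σ)
  | .branch c P Q, σ => if c.Holds α v σ then P.denote α v σ else Q.denote α v σ
  -- A default value, excluded by `LoopFree`.
  | .loop _ _, σ => σ

theorem Spec.of_loopFree {P : Program} (hP : P.LoopFree) :
    Spec P (fun _ _ => True) (fun I σ τ => τ = P.denote I.α I.v σ) := by
  induction P with
  | setNat a e =>
    exact ⟨.C (a.cost + e.cost + 1), fun I σ _ => ⟨_, _, .setNat a e σ, by simp, rfl⟩⟩
  | setBundle a S =>
    obtain ⟨q, hq⟩ := S.exists_cost_le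
    refine ⟨.C a.cost + q + .X + 1, fun I σ _ => ⟨_, _, .setBundle a S σ, ?_, rfl⟩⟩
    have : S.cost I.m ≤ q.eval (I.n + I.m) := (hq _).trans (eval_mono q (Nat.le_add_left _ _))
    simp only [Polynomial.eval_add, Polynomial.eval_X, Polynomial.eval_one, Polynomial.eval_C]
    omega
  | seq P Q hP' hQ' =>
    refine (hP' hP.1).seq (hQ' hP.2) (fun _ _ _ _ _ => trivial) ?_
    rintro I σ τ ρ - rfl rfl
    rfl
  | branch c P Q hP' hQ' =>
    refine Spec.branch ((hP' hP.1).mono (fun _ _ _ => trivial) ?_)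
      ((hQ' hP.2).mono (fun _ _ _ => trivial) ?_)
    · rintro I σ τ ⟨-, h⟩ rfl
      simp [Program.denote, h]
    · rintro I σ τ ⟨-, h⟩ rfl
      simp [Program.denote, h]
  | loop c P => exact hP.elim

/-- Without loops, the time bound is automatic and correctness becomes a computation with `denote`,
so invariants are needed only for loops. -/
theorem Spec.loopFree {P : Program} (hP : P.LoopFree) {pre : ∀ I : Problem, State I.m → Prop}
    {post : ∀ I : Problem, State I.m → State I.m → Prop}
    (h : ∀ I σ, pre I σ → post I σ (P.denote I.α I.v σ)) : Spec P pre post :=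
  (Spec.of_loopFree hP).mono (fun _ _ _ => trivial) (by rintro I σ τ hσ rfl; exact h I σ hσ)

theorem Spec.loop_loopFree {c : Test} {P : Program} (hP : P.LoopFree)
    {inv : ∀ I : Problem, State I.m → State I.m → Prop}
    {pre : ∀ I : Problem, State I.m → Prop} (μ : ∀ I : Problem, State I.m → ℕ)
    (b : Polynomial ℕ) (hinit : ∀ I σ, pre I σ → inv I σ σ)
    (hb : ∀ I σ τ, inv I σ τ → μ I τ ≤ b.eval (I.n + I.m))
    (hstep : ∀ I σ τ, inv I σ τ → c.Holds I.α I.v τ →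
      inv I σ (P.denote I.α I.v τ) ∧ μ I (P.denote I.α I.v τ) < μ I τ) :
    Spec (.loop c P) pre (fun I σ τ => inv I σ τ ∧ ¬ c.Holds I.α I.v τ) := by
  refine Spec.loop μ b hinit hb (Spec.loopFree hP ?_)
  rintro I τ ⟨⟨σ, hσ⟩, hc⟩
  exact ⟨fun σ' hσ' => (hstep I σ' τ hσ' hc).1, (hstep I σ τ hσ hc).2⟩


/-! ### Shrinking bundles until nobody strongly envies -/

namespace Problem

variable (I : Problem)

/-- The value of a bundle for an agent that is given as a number. -/
noncomputable def val (k : ℕ) (S : Finset (Fin I.m)) : ℝ :=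
  if h : k < I.n then I.v ⟨k, h⟩ S else 0

/-- The initial bundle of an agent that is given as a number. -/
def endowment (k : ℕ) : Finset (Fin I.m) :=
  if h : k < I.n then I.X ⟨k, h⟩ else ∅

theorem val_fin (i : Fin I.n) (S : Finset (Fin I.m)) : I.val i S = I.v i S := by
  simp [val]

theorem endowment_fin (i : Fin I.n) : I.endowment i = I.X i := by
  simp [endowment]

theorem disjoint_endowment {k l : ℕ} (h : k ≠ l) :
    Disjoint (I.endowment k) (I.endowment l) := by
  unfold endowment
  split_ifs
  · exact I.isAllocation _ _ (by simpa using h)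
  all_goals simp

theorem val_nonneg (k : ℕ) (S : Finset (Fin I.m)) : 0 ≤ I.val k S := by
  unfold val
  split_ifs
  exacts [(I.valuation _).nonneg S, le_rfl]

theorem val_mono (k : ℕ) {S T : Finset (Fin I.m)} (h : S ⊆ T) : I.val k S ≤ I.val k T := by
  unfold val
  split_ifs
  exacts [(I.valuation _).mono S T h, le_rfl]

theorem val_union_le (k : ℕ) (S T : Finset (Fin I.m)) :
    I.val k (S ∪ T) ≤ I.val k S + I.val k T := by
  unfold val
  split_ifs
  exacts [(I.valuation _).subadditive S T, by simp]

/-- The form in which subadditivity enters the shrinking phase: if the part cut off is cheap, the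
rest is valuable. -/
theorem val_le_add_sdiff (k : ℕ) (S T : Finset (Fin I.m)) :
    I.val k T ≤ I.val k S + I.val k (T \ S) :=
  (I.val_mono k (by rw [Finset.union_sdiff_self_eq_union]; exact Finset.subset_union_right)).trans
    (I.val_union_le k S (T \ S))

theorem α_mul_val_le (k : ℕ) (S : Finset (Fin I.m)) : I.α * I.val k S ≤ I.val k S := by
  have := I.α_le
  have := I.val_nonneg k S
  nlinarith

end Problem

/-- The slots `c < cnt` hold bundles; slot `c` belongs to agent `own c`, and it is discarded if
`own c` is not an agent. Slot `l` is the base bundle of agent `l`, who took it from `ref l`; the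
other slots hold chunks, and a chunk `c` was cut from the initial bundle of agent `orig c`. The
number `stage l` counts how often agent `l` had to replace the base bundle. -/
structure Config (m : ℕ) : Type where
  cnt : ℕ
  own : ℕ → ℕ
  orig : ℕ → ℕ
  stage : ℕ → ℕ
  slot : ℕ → Finset (Fin m)
  ref : ℕ → Finset (Fin m)

namespace Config

/-- Slot `s` is the last slot of agent `k`, so that `k` currently uses its bundle. -/
structure IsTop {m : ℕ} (C : Config m) (k s : ℕ) : Prop where
  lt : s < C.cnt
  own_eq : C.own s = k
  le : ∀ c < C.cnt, C.own c = k → c ≤ s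

/-- The slots that belong to one of `n` agents. -/
def alive {m : ℕ} (C : Config m) (n : ℕ) : Finset ℕ :=
  (Finset.range C.cnt).filter fun c => C.own c < n

/-- The chunks that belong to one of `n` agents. -/
def chunks {m : ℕ} (C : Config m) (n : ℕ) : Finset ℕ :=
  (C.alive n).filter fun c => n ≤ c

/-- The number of chunks that were cut from the initial bundle of agent `l`. -/
def cutCount {m : ℕ} (C : Config m) (n l : ℕ) : ℕ :=
  ((C.chunks n).filter fun c => C.orig c = l).card

theorem mem_alive {m : ℕ} {C : Config m} {n c : ℕ} :
    c ∈ C.alive n ↔ c < C.cnt ∧ C.own c < n := by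
  simp [alive]

theorem mem_chunks {m : ℕ} {C : Config m} {n c : ℕ} :
    c ∈ C.chunks n ↔ (c < C.cnt ∧ C.own c < n) ∧ n ≤ c := by
  simp [chunks, alive]

/-- The invariant of the shrinking phase. -/
structure Inv (I : Problem) (C : Config I.m) : Prop where
  le_cnt : I.n ≤ C.cnt
  own_base : ∀ l < I.n, C.own l = l
  own_le : ∀ c < C.cnt, C.own c ≤ I.n
  orig_lt : ∀ c, I.n ≤ c → c < C.cnt → C.orig c < I.n
  disjoint : ∀ c d, c ≠ d → c ∈ C.alive I.n → d ∈ C.alive I.n → Disjoint (C.slot c) (C.slot d)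
  base_subset : ∀ l < I.n, C.slot l ⊆ C.ref l
  ref_subset : ∀ l < I.n, C.ref l ⊆ I.endowment l
  ref_eq : ∀ l < I.n, C.stage l ≤ 1 → C.ref l = I.endowment l
  chunk_subset : ∀ c ∈ C.chunks I.n, C.slot c ⊆ I.endowment (C.orig c)
  -- From stage 2 on the reference bundle gives up every chunk that is cut, so older chunks survive
  -- further cuts. At stage 1 it is still the whole endowment and contains the chunk.
  chunk_disjoint : ∀ c ∈ C.chunks I.n, 2 ≤ C.stage (C.orig c) →
    Disjoint (C.slot c) (C.ref (C.orig c))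
  stage_pos : ∀ c ∈ C.chunks I.n, 1 ≤ C.stage (C.orig c)
  -- Required for all pairs and not just for neighbours, so that it survives the deletion of slots
  -- in between.
  chain : ∀ c d, c ∈ C.alive I.n → d ∈ C.alive I.n → c < d → C.own c = C.own d →
    I.val (C.own c) (C.slot c) ≤ I.α * I.val (C.own c) (C.slot d)
  worth_zero : ∀ l < I.n, C.stage l = 0 →
    I.val l (I.endowment l) ≤ (1 + I.α) * I.val l (C.slot l)
  worth_one : ∀ l < I.n, C.stage l = 1 → 1 ≤ C.cutCount I.n l ∧
    I.α * I.val l (I.endowment l) ≤ (1 + I.α) * I.val l (C.slot l)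
  -- The exponent is one less than the number of chunks: the factor `α` between the base and the
  -- reference bundle pays for the remaining one.
  worth_two : ∀ l < I.n, 2 ≤ C.stage l → 1 ≤ C.cutCount I.n l ∧
    I.α * I.val l (C.ref l) ≤ I.val l (C.slot l) ∧
    I.α ^ (C.cutCount I.n l - 1) * I.val l (I.endowment l) ≤ (1 + I.α) * I.val l (C.ref l)
  -- For `α = 0` there is no chunk at all, which is what allows the powers of `α` to be cancelled in
  -- the end.
  cnt_eq : I.α = 0 → C.cnt = I.n

/-- The termination measure of the shrinking phase. -/
def potential {m : ℕ} (C : Config m) (n : ℕ) : ℕ :=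
  -- A cut may enlarge the live slots, but they are disjoint and contain at most `m` items in total;
  -- the weight `m + 1` makes a drop of the first sum prevail. The indicator pays for the first cut
  -- of an agent, which leaves the reference bundle unchanged.
  (m + 1) * (∑ l ∈ Finset.range n, ((C.ref l).card + if C.stage l = 0 then 1 else 0)) +
    ∑ c ∈ C.alive n, (C.slot c).card

/-- Agent `l` can use `S` instead of the base bundle without a further cut. -/
def Keep {I : Problem} (C : Config I.m) (l : ℕ) (S : Finset (Fin I.m)) : Prop :=
  (C.stage l = 0 → I.val l (C.ref l) ≤ (1 + I.α) * I.val l S) ∧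
  (C.stage l = 1 → I.α * I.val l (C.ref l) ≤ (1 + I.α) * I.val l S) ∧
  (2 ≤ C.stage l → I.α * I.val l (C.ref l) ≤ I.val l S)

/-- The base bundle of agent `l` is replaced by `S`. -/
def trim {m : ℕ} (C : Config m) (l : ℕ) (S : Finset (Fin m)) : Config m :=
  { C with slot := Function.update C.slot l S }

/-- The chunk in slot `s` is shrunk to `S` and moves to agent `k`. -/
def transfer {m : ℕ} (C : Config m) (n s k : ℕ) (S : Finset (Fin m)) : Config m :=
  { C with
    cnt := C.cnt + 1
    own := Function.update (Function.update C.own C.cnt k) s n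
    orig := Function.update C.orig C.cnt (C.orig s)
    slot := Function.update C.slot C.cnt S }

/-- All chunks that were cut from the initial bundle of agent `l` are discarded. -/
def discard {m : ℕ} (C : Config m) (n l : ℕ) : Config m :=
  { C with own := fun c => if n ≤ c ∧ c < C.cnt ∧ C.orig c = l then n else C.own c }

/-- The chunk `S` is cut from the base bundle of agent `l` and moves to agent `k`. -/
def cut {m : ℕ} (C : Config m) (l k : ℕ) (S : Finset (Fin m)) : Config m :=
  { cnt := C.cnt + 1
    own := Function.update C.own C.cnt k
    orig := Function.update C.orig C.cnt l
    slot := Function.update (Function.update C.slot C.cnt S) l (C.ref l \ S)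
    ref := if 1 ≤ C.stage l then Function.update C.ref l (C.ref l \ S) else C.ref
    stage := Function.update C.stage l (C.stage l + 1) }

end Config
-- The moves of the shrinking phase preserve the invariant
namespace Config

variable {I : Problem} {C : Config I.m}

theorem Inv.of_initial (hcnt : C.cnt = I.n) (hown : ∀ l < I.n, C.own l = l)
    (hstage : ∀ l < I.n, C.stage l = 0) (hslot : ∀ l < I.n, C.slot l = I.endowment l)
    (href : ∀ l < I.n, C.ref l = I.endowment l) : C.Inv I where
  le_cnt := hcnt.ge
  own_base := hown
  own_le c hc := by rw [hown c (hcnt ▸ hc)]; omega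
  orig_lt c h h' := by omega
  disjoint c d hcd hc hd := by
    rw [mem_alive, hcnt] at hc hd
    rw [hslot c hc.1, hslot d hd.1]
    exact I.disjoint_endowment hcd
  base_subset l hl := by rw [hslot l hl, href l hl]
  ref_subset l hl := by rw [href l hl]
  ref_eq l hl _ := href l hl
  chunk_subset c hc := by rw [mem_chunks] at hc; omega
  chunk_disjoint c hc := by rw [mem_chunks] at hc; omega
  stage_pos c hc := by rw [mem_chunks] at hc; omega
  chain c d hc hd hcd h := by
    rw [mem_alive, hcnt] at hc hd
    rw [hown c hc.1, hown d hd.1] at h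
    omega
  worth_zero l hl _ := by
    rw [hslot l hl]
    have := I.val_nonneg l (I.endowment l)
    have := I.α_nonneg
    nlinarith
  worth_one l hl h := by rw [hstage l hl] at h; omega
  worth_two l hl h := by rw [hstage l hl] at h; omega
  cnt_eq _ := hcnt

/-- The base slot of an agent is alive. -/
theorem Inv.base_mem_alive (h : C.Inv I) {l : ℕ} (hl : l < I.n) : l ∈ C.alive I.n := by
  rw [mem_alive, h.own_base l hl]
  exact ⟨hl.trans_le h.le_cnt, hl⟩

theorem IsTop.mem_alive {k s n : ℕ} (h : C.IsTop k s) (hk : k < n) : s ∈ C.alive n := by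
  rw [Config.mem_alive, h.own_eq]
  exact ⟨h.lt, hk⟩

/-- Along the chain of an agent the values increase, so the last slot is the best one, and a bundle
that beats it by the factor `1 / α` extends the chain. -/
theorem IsTop.le_val (h : C.Inv I) {k t : ℕ} (hk : k < I.n) (ht : C.IsTop k t) {c : ℕ}
    (hc : c < C.cnt) (hck : C.own c = k) : I.val k (C.slot c) ≤ I.val k (C.slot t) := by
  rcases (ht.le c hc hck).eq_or_lt with rfl | hlt
  · exact le_rfl
  · have := h.chain c t (by rw [Config.mem_alive, hck]; exact ⟨hc, hk⟩) (ht.mem_alive hk) hlt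
      (hck.trans ht.own_eq.symm)
    rw [hck] at this
    exact this.trans (I.α_mul_val_le k _)

theorem cutCount_congr {n l : ℕ} {D : Config I.m}
    (h : ∀ c, (c ∈ D.chunks n ∧ D.orig c = l) ↔ (c ∈ C.chunks n ∧ C.orig c = l)) :
    D.cutCount n l = C.cutCount n l := by
  unfold cutCount
  congr 1
  ext c
  simpa using h c

theorem alive_transfer {n s k : ℕ} {S : Finset (Fin I.m)} (hk : k < n) (hs : s < C.cnt) :
    (C.transfer n s k S).alive n = insert C.cnt ((C.alive n).erase s) := by
  ext c
  simp only [mem_alive, transfer, Function.update_apply, Finset.mem_insert, Finset.mem_erase]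
  split_ifs <;> omega

theorem chunks_transfer {n s k : ℕ} {S : Finset (Fin I.m)} (hk : k < n) (hs : s < C.cnt)
    (hn : n ≤ C.cnt) :
    (C.transfer n s k S).chunks n = insert C.cnt ((C.chunks n).erase s) := by
  ext c
  simp only [mem_chunks, transfer, Function.update_apply, Finset.mem_insert, Finset.mem_erase]
  split_ifs <;> omega

theorem alive_cut {n l k : ℕ} {S : Finset (Fin I.m)} (hk : k < n) :
    (C.cut l k S).alive n = insert C.cnt (C.alive n) := by
  ext c
  simp only [mem_alive, cut, Function.update_apply, Finset.mem_insert]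
  split_ifs <;> omega

theorem chunks_cut {n l k : ℕ} {S : Finset (Fin I.m)} (hk : k < n) (hn : n ≤ C.cnt) :
    (C.cut l k S).chunks n = insert C.cnt (C.chunks n) := by
  ext c
  simp only [mem_chunks, cut, Function.update_apply, Finset.mem_insert]
  split_ifs <;> omega

theorem alive_discard {n l : ℕ} :
    (C.discard n l).alive n = (C.alive n).filter fun c => ¬ (n ≤ c ∧ C.orig c = l) := by
  ext c
  simp only [mem_alive, discard, Finset.mem_filter]
  split_ifs <;> omega

theorem chunks_discard {n l : ℕ} :
    (C.discard n l).chunks n = (C.chunks n).filter fun c => C.orig c ≠ l := by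
  ext c
  simp only [mem_chunks, discard, Finset.mem_filter]
  split_ifs <;> omega

/-- The base is the lowest slot of its agent. It therefore occurs only on the smaller side of
`chain`, where shrinking does no harm, and the bounds on its worth are what `Keep` provides. -/
theorem Inv.trim (h : C.Inv I) {l : ℕ} (hl : l < I.n) (htop : C.IsTop l l)
    {S : Finset (Fin I.m)} (hS : S ⊆ C.slot l) (hkeep : C.Keep l S) : (C.trim l S).Inv I := by
  have hsub : ∀ c, (C.trim l S).slot c ⊆ C.slot c := by
    intro c
    by_cases hc : c = l
    · subst hc; simpa [Config.trim] using hS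
    · simp [Config.trim, hc]
  have hch : ∀ c ∈ C.chunks I.n, (C.trim l S).slot c = C.slot c := by
    intro c hc
    rw [mem_chunks] at hc
    simp [Config.trim, show c ≠ l by omega]
  refine ⟨h.le_cnt, h.own_base, h.own_le, h.orig_lt, ?_, ?_, h.ref_subset, h.ref_eq, ?_, ?_,
    h.stage_pos, ?_, ?_, ?_, ?_, h.cnt_eq⟩
  · exact fun c d hcd hc hd => (h.disjoint c d hcd hc hd).mono (hsub c) (hsub d)
  · exact fun i hi => (hsub i).trans (h.base_subset i hi)
  · exact fun c hc => (hsub c).trans (h.chunk_subset c hc)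
  · exact fun c hc h2 => (h.chunk_disjoint c hc h2).mono_left (hsub c)
  · intro c d hc hd hcd ho
    have hdl : d ≠ l := by
      rintro rfl
      have h1 := (mem_alive.1 hc)
      have : C.own c = d := ho.trans (h.own_base d hl)
      have := h.own_base c (by omega)
      omega
    have := h.chain c d hc hd hcd ho
    have h2 := I.val_mono (C.own c) (hsub c)
    have h3 : (C.trim l S).slot d = C.slot d := by simp [Config.trim, hdl]
    rw [h3]
    exact h2.trans this
  · intro i hi hst
    by_cases hil : i = l
    · subst hil
      have := hkeep.1 hst
      rw [h.ref_eq i hi (by change C.stage i = 0 at hst; omega)] at this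
      simpa [Config.trim] using this
    · simpa [Config.trim, hil] using h.worth_zero i hi hst
  · intro i hi hst
    refine ⟨(h.worth_one i hi hst).1, ?_⟩
    by_cases hil : i = l
    · subst hil
      have := hkeep.2.1 hst
      rw [h.ref_eq i hi (by change C.stage i = 1 at hst; omega)] at this
      simpa [Config.trim] using this
    · simpa [Config.trim, hil] using (h.worth_one i hi hst).2
  · intro i hi hst
    refine ⟨(h.worth_two i hi hst).1, ?_, (h.worth_two i hi hst).2.2⟩
    by_cases hil : i = l
    · subst hil
      simpa [Config.trim] using hkeep.2.2 hst
    · simpa [Config.trim, hil] using (h.worth_two i hi hst).2.1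

/-- A shrunk chunk keeps its origin, so the agent it was cut from is charged as before. The former
owner loses a link of the chain, and strong envy is what makes the chunk a valid new link for `k`.
-/
theorem Inv.transfer (h : C.Inv I) {s k t : ℕ} (hk : k < I.n) (hs : s ∈ C.chunks I.n)
    (ht : C.IsTop k t) {S : Finset (Fin I.m)} (hS : S ⊆ C.slot s)
    (hlt : I.val k (C.slot t) < I.α * I.val k S) : (C.transfer I.n s k S).Inv I := by
  have hs' := mem_chunks.1 hs
  have hn := h.le_cnt
  have hal := alive_transfer (C := C) (S := S) hk hs'.1.1
  have hch := chunks_transfer (C := C) (S := S) hk hs'.1.1 hn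
  have hslot : ∀ c, c ≠ C.cnt → (C.transfer I.n s k S).slot c = C.slot c := fun c hc => by
    simp [Config.transfer, hc]
  have hslot' : (C.transfer I.n s k S).slot C.cnt = S := by simp [Config.transfer]
  have horig : ∀ c, c ≠ C.cnt → (C.transfer I.n s k S).orig c = C.orig c := fun c hc => by
    simp [Config.transfer, hc]
  have horig' : (C.transfer I.n s k S).orig C.cnt = C.orig s := by simp [Config.transfer]
  have hown : ∀ c, c ≠ C.cnt → c ≠ s → (C.transfer I.n s k S).own c = C.own c :=
    fun c hc hc' => by simp [Config.transfer, hc, hc']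
  have hown' : (C.transfer I.n s k S).own C.cnt = k := by
    simp [Config.transfer, show C.cnt ≠ s by omega]
  -- The slot `s` leaves the count and the new slot enters it, with the same origin.
  have hcount : ∀ l, (C.transfer I.n s k S).cutCount I.n l = C.cutCount I.n l := by
    intro l
    unfold cutCount
    rw [hch, Finset.filter_insert, horig']
    have hrest : ((C.chunks I.n).erase s).filter (fun c => (C.transfer I.n s k S).orig c = l) =
        ((C.chunks I.n).filter fun c => C.orig c = l).erase s := by
      ext c
      simp only [Finset.mem_filter, Finset.mem_erase, mem_chunks]
      constructor
      · rintro ⟨⟨h1, h2⟩, h3⟩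
        rw [horig c (by omega)] at h3
        exact ⟨h1, h2, h3⟩
      · rintro ⟨h1, h2, h3⟩
        rw [horig c (by omega)]
        exact ⟨⟨h1, h2⟩, h3⟩
    rw [hrest]
    split_ifs with hl
    · rw [Finset.card_insert_of_notMem (by simp [mem_chunks]),
        Finset.card_erase_add_one (by simp [hs, hl])]
    · rw [Finset.erase_eq_of_notMem (by simp [hl])]
  have hchunk : ∀ c ∈ (C.transfer I.n s k S).chunks I.n, ∃ d ∈ C.chunks I.n,
      (C.transfer I.n s k S).slot c ⊆ C.slot d ∧
      (C.transfer I.n s k S).orig c = C.orig d := by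
    intro c hc
    rw [hch, Finset.mem_insert, Finset.mem_erase] at hc
    rcases hc with rfl | ⟨-, hc⟩
    · exact ⟨s, hs, by rw [hslot']; exact hS, horig'⟩
    · have : c ≠ C.cnt := by rw [mem_chunks] at hc; omega
      exact ⟨c, hc, by rw [hslot c this], horig c this⟩
  refine ⟨?_, ?_, ?_, ?_, ?_, ?_, h.ref_subset, h.ref_eq, ?_, ?_, ?_, ?_, ?_, ?_, ?_, ?_⟩
  · exact hn.trans (Nat.le_succ _)
  · intro l hl
    rw [hown l (by omega) (by omega), h.own_base l hl]
  · intro c hc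
    change c < C.cnt + 1 at hc
    by_cases hcs : c = s
    · simp [Config.transfer, hcs]
    · by_cases hcc : c = C.cnt
      · rw [hcc, hown']; exact hk.le
      · rw [hown c hcc hcs]; exact h.own_le c (by omega)
  · intro c hc hc'
    change c < C.cnt + 1 at hc'
    by_cases hcc : c = C.cnt
    · rw [hcc, horig']; exact h.orig_lt s hs'.2 hs'.1.1
    · rw [horig c hcc]; exact h.orig_lt c hc (by omega)
  · have aux : ∀ d ∈ (C.alive I.n).erase s, Disjoint S (C.slot d) := fun d hd => by
      rw [Finset.mem_erase] at hd
      exact (h.disjoint s d (Ne.symm hd.1) (mem_alive.2 hs'.1) hd.2).mono_left hS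
    have hne : ∀ d ∈ (C.alive I.n).erase s, d ≠ C.cnt := fun d hd => by
      rw [Finset.mem_erase, mem_alive] at hd; omega
    intro c d hcd hc hd
    rw [hal, Finset.mem_insert] at hc hd
    rcases hc with rfl | hc <;> rcases hd with rfl | hd
    · exact absurd rfl hcd
    · rw [hslot', hslot d (hne d hd)]; exact aux d hd
    · rw [hslot', hslot c (hne c hc)]; exact (aux c hc).symm
    · rw [hslot c (hne c hc), hslot d (hne d hd)]
      exact h.disjoint c d hcd (Finset.mem_of_mem_erase hc) (Finset.mem_of_mem_erase hd)
  · intro l hl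
    rw [hslot l (by omega)]
    exact h.base_subset l hl
  · intro c hc
    obtain ⟨d, hd, h1, h2⟩ := hchunk c hc
    rw [h2]
    exact h1.trans (h.chunk_subset d hd)
  · intro c hc hst
    obtain ⟨d, hd, h1, h2⟩ := hchunk c hc
    rw [h2] at hst ⊢
    exact (h.chunk_disjoint d hd hst).mono_left h1
  · intro c hc
    obtain ⟨d, hd, h1, h2⟩ := hchunk c hc
    rw [h2]
    exact h.stage_pos d hd
  · intro c d hc hd hcd ho
    rw [hal, Finset.mem_insert, Finset.mem_erase, mem_alive] at hc hd
    have hc1 : c ≠ C.cnt := by omega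
    have hc2 : c ≠ s ∧ c < C.cnt ∧ C.own c < I.n := by tauto
    rw [hown c hc1 hc2.1] at ho ⊢
    rw [hslot c hc1]
    rcases hd with rfl | hd
    · rw [hown'] at ho
      rw [hslot', ho]
      exact (ht.le_val h hk hc2.2.1 ho).trans hlt.le
    · rw [hown d (by omega) hd.1] at ho
      rw [hslot d (by omega)]
      exact h.chain c d (mem_alive.2 hc2.2) (mem_alive.2 hd.2) hcd ho
  · intro l hl hst
    rw [hslot l (by omega)]
    exact h.worth_zero l hl hst
  · intro l hl hst
    rw [hslot l (by omega), hcount]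
    exact h.worth_one l hl hst
  · intro l hl hst
    rw [hslot l (by omega), hcount]
    exact h.worth_two l hl hst
  -- For `α = 0` strong envy would mean a negative value.
  · intro h0
    rw [h0, zero_mul] at hlt
    exact absurd (I.val_nonneg k (C.slot t)) (not_le.2 hlt)

/-- A cut preserves the invariant. The chunks that are given up beforehand are described by the
new owners `own'`. -/
theorem Inv.cut_of_own (h : C.Inv I) {l k t : ℕ} (hl : l < I.n) (hk : k < I.n)
    (hll : C.IsTop l l) (ht : C.IsTop k t) {S : Finset (Fin I.m)} (hS : S ⊆ C.slot l)
    (hlt : I.val k (C.slot t) < I.α * I.val k S) (hkeep : ¬ C.Keep l S) {own' : ℕ → ℕ}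
    (hown : ∀ c, own' c = C.own c ∨ own' c = I.n) (hbase : ∀ i < I.n, own' i = C.own i)
    (hkick : C.stage l ≤ 1 → ∀ c ∈ ({ C with own := own' } : Config I.m).chunks I.n,
      C.orig c ≠ l)
    (hcount : ∀ i < I.n, i ≠ l →
      ({ C with own := own' } : Config I.m).cutCount I.n i = C.cutCount I.n i)
    (hcountl : 2 ≤ C.stage l →
      ({ C with own := own' } : Config I.m).cutCount I.n l = C.cutCount I.n l) :
    (({ C with own := own' } : Config I.m).cut l k S).Inv I := by
  set D : Config I.m := { C with own := own' } with hD
  have hn := h.le_cnt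
  -- By monotonicity and `α ≤ 1` nobody strongly envies a part of the own bundle.
  have hkl : k ≠ l := by
    rintro rfl
    have htk : t = k := le_antisymm (hll.le t ht.lt ht.own_eq) (ht.le k hll.lt hll.own_eq)
    rw [htk] at hlt
    have := I.val_mono k hS
    have := I.α_mul_val_le k S
    linarith
  have hDC : ∀ c, c ∈ D.alive I.n → c ∈ C.alive I.n ∧ own' c = C.own c := by
    intro c hc
    rw [mem_alive] at hc
    rcases hown c with h1 | h1
    · exact ⟨mem_alive.2 ⟨hc.1, h1 ▸ hc.2⟩, h1⟩
    · exact absurd hc.2 (by simp [hD, h1])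
  have hDch : ∀ c, c ∈ D.chunks I.n → c ∈ C.chunks I.n := by
    intro c hc
    have h1 := Finset.mem_filter.1 hc
    exact Finset.mem_filter.2 ⟨(hDC c h1.1).1, h1.2⟩
  have hDlt : ∀ c, c ∈ D.alive I.n → c < C.cnt := fun c hc => (mem_alive.1 hc).1
  have hal : (D.cut l k S).alive I.n = insert C.cnt (D.alive I.n) := alive_cut hk
  have hch : (D.cut l k S).chunks I.n = insert C.cnt (D.chunks I.n) := chunks_cut hk hn
  have hslot : ∀ c, c ≠ C.cnt → c ≠ l → (D.cut l k S).slot c = C.slot c := fun c hc hc' => by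
    simp [Config.cut, hD, hc, hc']
  have hslotc : (D.cut l k S).slot C.cnt = S := by
    simp [Config.cut, hD, show C.cnt ≠ l by omega]
  have hslotl : (D.cut l k S).slot l = C.ref l \ S := by simp [Config.cut, hD]
  have href : ∀ i, i ≠ l → (D.cut l k S).ref i = C.ref i := fun i hi => by
    simp only [Config.cut, hD]
    split_ifs
    · simp [hi]
    · rfl
  have hrefl : 1 ≤ C.stage l → (D.cut l k S).ref l = C.ref l \ S := fun h1 => by
    simp [Config.cut, hD, h1]
  have hrefl0 : C.stage l = 0 → (D.cut l k S).ref l = C.ref l := fun h1 => by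
    simp [Config.cut, hD, h1]
  have hrefsub : ∀ i, (D.cut l k S).ref i ⊆ C.ref i := fun i => by
    by_cases hi : i = l
    · subst hi
      rcases Nat.eq_zero_or_pos (C.stage i) with h0 | h1
      · rw [hrefl0 h0]
      · rw [hrefl h1]; exact Finset.sdiff_subset
    · rw [href i hi]
  have hstage : ∀ i, i ≠ l → (D.cut l k S).stage i = C.stage i := fun i hi => by
    simp [Config.cut, hD, hi]
  have hstagel : (D.cut l k S).stage l = C.stage l + 1 := by simp [Config.cut, hD]
  have horig : ∀ c, c ≠ C.cnt → (D.cut l k S).orig c = C.orig c := fun c hc => by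
    simp [Config.cut, hD, hc]
  have horigc : (D.cut l k S).orig C.cnt = l := by simp [Config.cut, hD]
  have hownc : (D.cut l k S).own C.cnt = k := by simp [Config.cut, hD]
  have hown2 : ∀ c, c ∈ D.alive I.n → (D.cut l k S).own c = C.own c := fun c hc => by
    have := (hDlt c hc).ne
    simp [Config.cut, hD, this, (hDC c hc).2]
  have hcnt : ∀ i, (D.cut l k S).cutCount I.n i = D.cutCount I.n i + if i = l then 1 else 0 := by
    intro i
    unfold cutCount
    have hrest : (D.chunks I.n).filter (fun c => (D.cut l k S).orig c = i) =
        (D.chunks I.n).filter fun c => D.orig c = i := by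
      refine Finset.filter_congr fun c hc => ?_
      rw [horig c (hDlt c (Finset.mem_filter.1 hc).1).ne]
    rw [hch, Finset.filter_insert, horigc, hrest]
    by_cases hi : i = l
    · rw [if_pos hi.symm, if_pos hi, Finset.card_insert_of_notMem]
      intro hmem
      have := hDlt _ (Finset.mem_filter.1 (Finset.mem_filter.1 hmem).1).1
      omega
    · rw [if_neg (Ne.symm hi), if_neg hi, add_zero]
  -- The new base is carved out of the reference bundle, not out of the old base, so all other live
  -- slots have to avoid the whole reference bundle. Other bases and chunks of other origin lie in
  -- other endowments; chunks from `l` have been discarded if the stage was at most 1, and otherwise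
  -- `chunk_disjoint` applies.
  have hfree : ∀ d ∈ D.alive I.n, d ≠ l → Disjoint (C.slot d) (C.ref l) := by
    intro d hd hdl
    by_cases hdn : d < I.n
    · exact (I.disjoint_endowment hdl).mono ((h.base_subset d hdn).trans (h.ref_subset d hdn))
        (h.ref_subset l hl)
    · have hdc : d ∈ D.chunks I.n := Finset.mem_filter.2 ⟨hd, not_lt.1 hdn⟩
      by_cases ho : C.orig d = l
      · rw [← ho]
        refine h.chunk_disjoint d (hDch d hdc) ?_
        by_contra hst
        exact hkick (by rw [← ho]; omega) d hdc ho
      · exact (I.disjoint_endowment ho).mono (h.chunk_subset d (hDch d hdc)) (h.ref_subset l hl)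
  have hSref : S ⊆ C.ref l := hS.trans (h.base_subset l hl)
  have hlD : l ∈ D.alive I.n := by
    rw [mem_alive]
    exact ⟨hll.lt, by simp [hD, hbase l hl, hll.own_eq, hl]⟩
  have hsplit := I.val_le_add_sdiff l S (C.ref l)
  have hα := I.α_nonneg
  have hα' := I.α_le
  have hX := I.val_nonneg l (I.endowment l)
  refine ⟨?_, ?_, ?_, ?_, ?_, ?_, ?_, ?_, ?_, ?_, ?_, ?_, ?_, ?_, ?_, ?_⟩
  · exact hn.trans (Nat.le_succ _)
  · intro i hi
    rw [hown2 i]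
    · exact h.own_base i hi
    · rw [mem_alive]
      exact ⟨hi.trans_le hn, by simp [hD, hbase i hi, h.own_base i hi, hi]⟩
  · intro c hc
    change c < C.cnt + 1 at hc
    by_cases hcc : c = C.cnt
    · rw [hcc, hownc]; exact hk.le
    · have : (D.cut l k S).own c = own' c := by simp [Config.cut, hD, hcc]
      rw [this]
      have := h.own_le c (by omega)
      rcases hown c with h1 | h1 <;> omega
  · intro c hc hc'
    change c < C.cnt + 1 at hc'
    by_cases hcc : c = C.cnt
    · rw [hcc, horigc]; exact hl
    · rw [horig c hcc]; exact h.orig_lt c hc (by omega)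
  · have auxS : ∀ d ∈ D.alive I.n, Disjoint S ((D.cut l k S).slot d) := fun d hd => by
      by_cases hdl : d = l
      · rw [hdl, hslotl]; exact Finset.disjoint_sdiff
      · rw [hslot d (hDlt d hd).ne hdl]
        exact (h.disjoint l d (Ne.symm hdl) (h.base_mem_alive hl) (hDC d hd).1).mono_left hS
    have auxl : ∀ d ∈ D.alive I.n, d ≠ l → Disjoint (C.ref l \ S) ((D.cut l k S).slot d) :=
      fun d hd hdl => by
        rw [hslot d (hDlt d hd).ne hdl]
        exact (hfree d hd hdl).symm.mono_left Finset.sdiff_subset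
    intro c d hcd hc hd
    rw [hal, Finset.mem_insert] at hc hd
    rcases hc with rfl | hc <;> rcases hd with rfl | hd
    · exact absurd rfl hcd
    · rw [hslotc]; exact auxS d hd
    · rw [hslotc]; exact (auxS c hc).symm
    · by_cases hcl : c = l
      · subst hcl
        rw [hslotl]; exact auxl d hd (Ne.symm hcd)
      · by_cases hdl : d = l
        · subst hdl
          rw [hslotl]; exact (auxl c hc hcd).symm
        · rw [hslot c (hDlt c hc).ne hcl, hslot d (hDlt d hd).ne hdl]
          exact h.disjoint c d hcd (hDC c hc).1 (hDC d hd).1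
  · intro i hi
    by_cases hil : i = l
    · subst hil
      rw [hslotl]
      rcases Nat.eq_zero_or_pos (C.stage i) with h0 | h1
      · rw [hrefl0 h0]; exact Finset.sdiff_subset
      · rw [hrefl h1]
    · rw [hslot i (by omega) hil, href i hil]; exact h.base_subset i hi
  · exact fun i hi => (hrefsub i).trans (h.ref_subset i hi)
  · intro i hi hst
    by_cases hil : i = l
    · subst hil
      rw [hstagel] at hst
      rw [hrefl0 (by omega)]
      exact h.ref_eq i hi (by omega)
    · rw [hstage i hil] at hst
      rw [href i hil]; exact h.ref_eq i hi hst
  · intro c hc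
    rw [hch, Finset.mem_insert] at hc
    rcases hc with rfl | hc
    · rw [hslotc, horigc]; exact hSref.trans (h.ref_subset l hl)
    · have hc1 := mem_chunks.1 (hDch c hc)
      rw [hslot c (by omega) (by omega), horig c (by omega)]
      exact h.chunk_subset c (hDch c hc)
  · intro c hc hst
    rw [hch, Finset.mem_insert] at hc
    rcases hc with rfl | hc
    · rw [horigc] at hst ⊢
      rw [hstagel] at hst
      rw [hslotc, hrefl (by omega)]
      exact Finset.disjoint_sdiff
    · have hc1 := mem_chunks.1 (hDch c hc)
      rw [horig c (by omega)] at hst ⊢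
      rw [hslot c (by omega) (by omega)]
      refine Disjoint.mono_right (hrefsub _) ?_
      by_cases ho : C.orig c = l
      · rw [ho]
        exact hfree c (Finset.mem_filter.1 hc).1 (by omega)
      · rw [hstage _ ho] at hst
        exact h.chunk_disjoint c (hDch c hc) hst
  · intro c hc
    rw [hch, Finset.mem_insert] at hc
    rcases hc with rfl | hc
    · rw [horigc, hstagel]; omega
    · have hc1 := mem_chunks.1 (hDch c hc)
      rw [horig c (by omega)]
      by_cases ho : C.orig c = l
      · rw [ho, hstagel]; omega
      · rw [hstage _ ho]; exact h.stage_pos c (hDch c hc)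
  · intro c d hc hd hcd ho
    rw [hal, Finset.mem_insert] at hc hd
    have hdle : d ≤ C.cnt := by
      rcases hd with rfl | hd
      · exact le_rfl
      · exact (hDlt d hd).le
    have hcD : c ∈ D.alive I.n := by
      rcases hc with rfl | hc
      · omega
      · exact hc
    have hcC := hDC c hcD
    rw [hown2 c hcD] at ho ⊢
    rcases hd with rfl | hd
    · rw [hownc] at ho
      have hcl : c ≠ l := by
        rintro rfl
        exact hkl (ho.symm.trans hll.own_eq)
      rw [hslotc, hslot c hcd.ne hcl, ho]
      exact (ht.le_val h hk (hDlt c hcD) ho).trans hlt.le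
    · rw [hown2 d hd] at ho
      have hdC := hDC d hd
      have hcl : c ≠ l := by
        rintro rfl
        have := hll.le d (hDlt d hd) (ho.symm.trans hll.own_eq)
        omega
      have hdl : d ≠ l := by
        rintro rfl
        have h1 := h.own_base c (by omega)
        have h2 := hll.own_eq
        omega
      rw [hslot c (hDlt c hcD).ne hcl, hslot d (hDlt d hd).ne hdl]
      exact h.chain c d hcC.1 hdC.1 hcd ho
  · intro i hi hst
    by_cases hil : i = l
    · subst hil; omega
    · rw [hstage i hil] at hst
      rw [hslot i (by omega) hil]; exact h.worth_zero i hi hst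
  · intro i hi hst
    by_cases hil : i = l
    · subst hil
      rw [hstagel] at hst
      have h0 : C.stage i = 0 := by omega
      rw [hcnt, if_pos rfl, hslotl]
      -- First cut: `S` is worth less than `1 / (1 + α)` of the endowment, so more than `α / (1 +
      -- α)` of it remains.
      have hbad : ¬ I.val i (C.ref i) ≤ (1 + I.α) * I.val i S := fun hc =>
        hkeep ⟨fun _ => hc, fun h1 => by omega, fun h1 => by omega⟩
      rw [h.ref_eq i hi (by omega)] at hsplit hbad ⊢
      exact ⟨by omega, by nlinarith⟩
    · rw [hstage i hil] at hst
      rw [hslot i (by omega) hil, hcnt, if_neg hil, add_zero, hcount i hi hil]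
      exact h.worth_one i hi hst
  · intro i hi hst
    by_cases hil : i = l
    · subst hil
      rw [hstagel] at hst
      rw [hcnt, if_pos rfl, hslotl, hrefl (by omega)]
      refine ⟨by omega, I.α_mul_val_le _ _, ?_⟩
      rw [Nat.add_sub_cancel]
      by_cases h1 : C.stage i = 1
      · have hbad : ¬ I.α * I.val i (C.ref i) ≤ (1 + I.α) * I.val i S := fun hc =>
          hkeep ⟨fun h0 => by omega, fun _ => hc, fun h1 => by omega⟩
        rw [h.ref_eq i hi (by omega)] at hsplit hbad ⊢
        have hp : I.α ^ D.cutCount I.n i ≤ 1 := pow_le_one₀ hα (by linarith)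
        have := mul_le_mul_of_nonneg_right hp hX
        nlinarith
      · have hbad : ¬ I.α * I.val i (C.ref i) ≤ I.val i S := fun hc =>
          hkeep ⟨fun h0 => by omega, fun h1 => by omega, fun _ => hc⟩
        obtain ⟨hc1, -, hw⟩ := h.worth_two i hi (by omega)
        rw [hcountl (by omega)]
        obtain ⟨p, hp⟩ : ∃ p, C.cutCount I.n i = p + 1 := ⟨_, (Nat.sub_add_cancel hc1).symm⟩
        rw [hp, Nat.add_sub_cancel] at hw
        rw [hp, pow_succ]
        have := mul_le_mul_of_nonneg_left hw hα
        have := I.val_nonneg i (C.ref i)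
        have : I.α * I.val i (C.ref i) ≤ I.val i (C.ref i \ S) := by nlinarith
        nlinarith
    · rw [hstage i hil] at hst
      rw [hslot i (by omega) hil, hcnt, if_neg hil, add_zero, hcount i hi hil, href i hil]
      exact h.worth_two i hi hst
  · intro h0
    rw [h0, zero_mul] at hlt
    exact absurd (I.val_nonneg k (C.slot t)) (not_le.2 hlt)

theorem Inv.cut (h : C.Inv I) {l k t : ℕ} (hl : l < I.n) (hk : k < I.n)
    (hll : C.IsTop l l) (ht : C.IsTop k t) {S : Finset (Fin I.m)} (hS : S ⊆ C.slot l)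
    (hlt : I.val k (C.slot t) < I.α * I.val k S) (hkeep : ¬ C.Keep l S) (hst : ¬ C.stage l ≤ 1) :
    (C.cut l k S).Inv I :=
  h.cut_of_own hl hk hll ht hS hlt hkeep (own' := C.own) (fun _ => .inl rfl) (fun _ _ => rfl)
    (fun h1 => absurd h1 hst) (fun _ _ _ => rfl) (fun _ => rfl)

/-- At stages 0 and 1 the reference bundle is the whole endowment, so the new base may overlap
chunks that were cut earlier, and these are given up. Their owners fall back on older slots, and `l`
is charged only for the new chunk. -/
theorem Inv.discard_cut (h : C.Inv I) {l k t : ℕ} (hl : l < I.n) (hk : k < I.n)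
    (hll : C.IsTop l l) (ht : C.IsTop k t) {S : Finset (Fin I.m)} (hS : S ⊆ C.slot l)
    (hlt : I.val k (C.slot t) < I.α * I.val k S) (hkeep : ¬ C.Keep l S) (hst : C.stage l ≤ 1) :
    ((C.discard I.n l).cut l k S).Inv I := by
  refine h.cut_of_own hl hk hll ht hS hlt hkeep
    (own' := fun c => if I.n ≤ c ∧ c < C.cnt ∧ C.orig c = l then I.n else C.own c) ?_ ?_ ?_ ?_ ?_
  · intro c
    by_cases hc : I.n ≤ c ∧ c < C.cnt ∧ C.orig c = l
    exacts [.inr (if_pos hc), .inl (if_neg hc)]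
  · intro i hi
    exact if_neg (by omega)
  · intro _ c hc
    change c ∈ (C.discard I.n l).chunks I.n at hc
    rw [chunks_discard] at hc
    exact (Finset.mem_filter.1 hc).2
  · intro i _ hil
    refine cutCount_congr (D := C.discard I.n l) fun c => ?_
    rw [chunks_discard, Finset.mem_filter]
    constructor
    · rintro ⟨h1, h2⟩
      exact ⟨h1.1, h2⟩
    · rintro ⟨h1, h2⟩
      exact ⟨⟨h1, by omega⟩, h2⟩
  · omega

/-! ### The termination measure -/

theorem Inv.sum_alive_le (h : C.Inv I) : ∑ c ∈ C.alive I.n, (C.slot c).card ≤ I.m := by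
  rw [← Finset.card_biUnion fun c hc d hd hcd => h.disjoint c d hcd hc hd]
  exact (Finset.card_le_univ _).trans (Fintype.card_fin _).le

theorem Inv.potential_le (h : C.Inv I) :
    C.potential I.n ≤ (I.m + 1) * (I.n * (I.m + 1)) + I.m := by
  refine add_le_add (Nat.mul_le_mul_left _ ?_) h.sum_alive_le
  refine (Finset.sum_le_card_nsmul _ _ (I.m + 1) fun l _ => ?_).trans (by simp)
  have : (C.ref l).card ≤ I.m := (Finset.card_le_univ _).trans (Fintype.card_fin _).le
  split_ifs <;> omega

theorem Inv.potential_trim (h : C.Inv I) {l : ℕ} (hl : l < I.n) {S : Finset (Fin I.m)}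
    (hS : S ⊂ C.slot l) : (C.trim l S).potential I.n < C.potential I.n := by
  refine Nat.add_lt_add_left ?_ _
  refine Finset.sum_lt_sum (fun c _ => ?_) ⟨l, h.base_mem_alive hl, ?_⟩
  · by_cases hc : c = l
    · subst hc; simpa [Config.trim] using Finset.card_le_card hS.1
    · simp [Config.trim, hc]
  · simpa [Config.trim] using Finset.card_lt_card hS

theorem potential_transfer {s k : ℕ} (hk : k < I.n) (hs : s ∈ C.alive I.n)
    {S : Finset (Fin I.m)} (hS : S ⊂ C.slot s) :
    (C.transfer I.n s k S).potential I.n < C.potential I.n := by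
  refine Nat.add_lt_add_left ?_ _
  rw [alive_transfer hk (mem_alive.1 hs).1, Finset.sum_insert (by simp [mem_alive]),
    ← Finset.add_sum_erase _ _ hs]
  refine Nat.add_lt_add_of_lt_of_le ?_ (Finset.sum_le_sum fun c hc => ?_)
  · simpa [Config.transfer] using Finset.card_lt_card hS
  · rw [Finset.mem_erase, mem_alive] at hc
    simp [Config.transfer, hc.2.1.ne]

theorem potential_cut {l k : ℕ} (hl : l < I.n) {S : Finset (Fin I.m)} (hS : S.Nonempty)
    (hSref : S ⊆ C.ref l) (hinv : (C.cut l k S).Inv I) :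
    (C.cut l k S).potential I.n < C.potential I.n := by
  have hsum : ∑ i ∈ Finset.range I.n, (((C.cut l k S).ref i).card +
        if (C.cut l k S).stage i = 0 then 1 else 0) <
      ∑ i ∈ Finset.range I.n, ((C.ref i).card + if C.stage i = 0 then 1 else 0) := by
    refine Finset.sum_lt_sum (fun i _ => ?_) ⟨l, Finset.mem_range.2 hl, ?_⟩
    · by_cases hi : i = l
      · subst hi
        simp only [Config.cut, Function.update_self, Nat.add_eq_zero_iff, one_ne_zero, and_false,
          if_false]
        refine Nat.add_le_add ?_ (Nat.zero_le _)
        split_ifs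
        · simpa using Finset.card_le_card Finset.sdiff_subset
        · exact le_rfl
      · simp only [Config.cut, Function.update_of_ne hi]
        split_ifs <;> simp [hi]
    · rcases Nat.eq_zero_or_pos (C.stage l) with h0 | h1
      · simp [Config.cut, h0]
      · have : (C.ref l \ S).card < (C.ref l).card :=
          Finset.card_lt_card (Finset.sdiff_ssubset hSref hS)
        have h1' : 1 ≤ C.stage l := h1
        have h2 : C.stage l ≠ 0 := by omega
        simpa [Config.cut, h1', h2] using this
  have h1 := hinv.sum_alive_le
  have h2 := Nat.mul_le_mul_left (I.m + 1) (Nat.succ_le_of_lt hsum)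
  unfold potential
  rw [Nat.mul_succ] at h2
  omega

theorem potential_discard_cut {l k : ℕ} (hl : l < I.n) {S : Finset (Fin I.m)} (hS : S.Nonempty)
    (hSref : S ⊆ C.ref l) (hinv : ((C.discard I.n l).cut l k S).Inv I) :
    ((C.discard I.n l).cut l k S).potential I.n < C.potential I.n := by
  refine (potential_cut (C := C.discard I.n l) hl hS hSref hinv).trans_le
    (Nat.add_le_add_left ?_ _)
  refine Finset.sum_le_sum_of_subset ?_
  rw [alive_discard]
  exact Finset.filter_subset _ _

/-! ### The value of the resulting allocation -/

/-- The three kinds of bounds in the invariant merge into one: apart from a single factor `1 + α`,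
every live chunk cut from agent `l` costs that agent at most one factor `α`. -/
theorem Inv.pow_mul_le (h : C.Inv I) {l : ℕ} (hl : l < I.n) :
    I.α ^ C.cutCount I.n l * I.val l (I.endowment l) ≤ (1 + I.α) * I.val l (C.slot l) := by
  have hα := I.α_nonneg
  have hα' := I.α_le
  have hX := I.val_nonneg l (I.endowment l)
  rcases Nat.lt_trichotomy (C.stage l) 1 with h0 | h1 | h2
  · have hp : I.α ^ C.cutCount I.n l ≤ 1 := pow_le_one₀ hα (by linarith)
    have := mul_le_mul_of_nonneg_right hp hX
    have := h.worth_zero l hl (by omega)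
    linarith
  · obtain ⟨hc, hw⟩ := h.worth_one l hl h1
    have hp : I.α ^ C.cutCount I.n l ≤ I.α := pow_le_of_le_one hα (by linarith) (by omega)
    have := mul_le_mul_of_nonneg_right hp hX
    linarith
  · obtain ⟨hc, hw, hw'⟩ := h.worth_two l hl h2
    obtain ⟨p, hp⟩ : ∃ p, C.cutCount I.n l = p + 1 := ⟨_, (Nat.sub_add_cancel hc).symm⟩
    rw [hp, Nat.add_sub_cancel] at hw'
    rw [hp, pow_succ]
    have := mul_le_mul_of_nonneg_left hw' hα
    nlinarith

/-- Each chunk in the chain of `k` multiplies the value by at least `1 / α`. The induction removes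
the latest chunk and continues with the slot before it. -/
theorem Inv.val_base_le (h : C.Inv I) {k : ℕ} (hk : k < I.n) (A : Finset ℕ)
    (hA : ∀ c ∈ A, c ∈ C.chunks I.n ∧ C.own c = k) {t : ℕ} (ht : t ∈ insert k A)
    (hmax : ∀ c ∈ A, c ≤ t) : I.val k (C.slot k) ≤ I.α ^ A.card * I.val k (C.slot t) := by
  induction A using Finset.induction_on_max generalizing t with
  | empty =>
    have : t = k := by simpa using ht
    simp [this]
  | insert a A ha ih =>
    have hna : a ∉ A := fun h' => lt_irrefl a (ha a h')
    have hak := hA a (Finset.mem_insert_self a A)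
    have hak' := mem_chunks.1 hak.1
    have hta : t = a := by
      have h1 := hmax a (Finset.mem_insert_self a A)
      rcases Finset.mem_insert.1 ht with rfl | ht
      · omega
      · rcases Finset.mem_insert.1 ht with rfl | ht
        · rfl
        · exact absurd (ha t ht) (by omega)
    subst hta
    have hA' : ∀ c ∈ A, c ∈ C.chunks I.n ∧ C.own c = k := fun c hc =>
      hA c (Finset.mem_insert_of_mem hc)
    obtain ⟨s, hs, hsmax⟩ : ∃ s ∈ insert k A, ∀ c ∈ A, c ≤ s := by
      refine ⟨(insert k A).max' (Finset.insert_nonempty k A), Finset.max'_mem _ _, fun c hc => ?_⟩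
      exact Finset.le_max' _ _ (Finset.mem_insert_of_mem hc)
    have h1 := ih hA' hs hsmax
    have hs' : s ∈ C.alive I.n ∧ s < t ∧ C.own s = k := by
      rcases Finset.mem_insert.1 hs with rfl | hs
      · exact ⟨h.base_mem_alive hk, by omega, h.own_base s hk⟩
      · exact ⟨(Finset.mem_filter.1 (hA' s hs).1).1, ha s hs, (hA' s hs).2⟩
    have h2 := h.chain s t hs'.1 (mem_alive.2 hak'.1) hs'.2.1 (hs'.2.2.trans hak.2.symm)
    rw [hs'.2.2] at h2
    rw [Finset.card_insert_of_notMem hna, pow_succ, mul_assoc]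
    exact h1.trans (mul_le_mul_of_nonneg_left h2 (pow_nonneg I.α_nonneg _))

/-- Multiplying losses and gains over all agents puts the same power of `α` on both sides. -/
theorem Inv.prod_le (h : C.Inv I) {top : ℕ → ℕ} (htop : ∀ k < I.n, C.IsTop k (top k)) :
    ∏ k ∈ Finset.range I.n, I.val k (I.endowment k) ≤
      (1 + I.α) ^ I.n * ∏ k ∈ Finset.range I.n, I.val k (C.slot (top k)) := by
  have hα := I.α_nonneg
  set s : ℕ → ℕ := fun k => ((C.chunks I.n).filter fun c => C.own c = k).card with hs
  have hown : ∀ k < I.n, I.val k (C.slot k) ≤ I.α ^ s k * I.val k (C.slot (top k)) := by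
    intro k hk
    refine h.val_base_le hk _ (fun c hc => by simpa using hc) ?_ ?_
    · have ht := htop k hk
      by_cases htn : I.n ≤ top k
      · refine Finset.mem_insert_of_mem ?_
        rw [Finset.mem_filter, mem_chunks, ht.own_eq]
        exact ⟨⟨⟨ht.lt, hk⟩, htn⟩, rfl⟩
      · have := h.own_base (top k) (by omega)
        rw [ht.own_eq] at this
        rw [← this]
        exact Finset.mem_insert_self _ _
    · intro c hc
      rw [Finset.mem_filter, mem_chunks] at hc
      exact (htop k hk).le c hc.1.1.1 hc.2
  have hkey : ∀ k < I.n, I.α ^ C.cutCount I.n k * I.val k (I.endowment k) ≤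
      (1 + I.α) * (I.α ^ s k * I.val k (C.slot (top k))) := fun k hk =>
    (h.pow_mul_le hk).trans (mul_le_mul_of_nonneg_left (hown k hk) (by linarith))
  have hprod := Finset.prod_le_prod (s := Finset.range I.n)
    (fun k _ => mul_nonneg (pow_nonneg hα _) (I.val_nonneg k _))
    (fun k hk => hkey k (Finset.mem_range.1 hk))
  -- Double counting: sorted by origin or by owner, the live chunks are the same set.
  have hp : ∑ k ∈ Finset.range I.n, C.cutCount I.n k = (C.chunks I.n).card := by
    refine (Finset.card_eq_sum_card_fiberwise fun c hc => ?_).symm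
    have hc' := mem_chunks.1 hc
    exact Finset.mem_coe.2 (Finset.mem_range.2 (h.orig_lt c hc'.2 hc'.1.1))
  have hsum : ∑ k ∈ Finset.range I.n, s k = (C.chunks I.n).card := by
    refine (Finset.card_eq_sum_card_fiberwise fun c hc => ?_).symm
    have hc' := mem_chunks.1 hc
    exact Finset.mem_coe.2 (Finset.mem_range.2 hc'.1.2)
  rw [Finset.prod_mul_distrib, Finset.prod_mul_distrib, Finset.prod_mul_distrib,
    Finset.prod_pow_eq_pow_sum, Finset.prod_pow_eq_pow_sum, hp, hsum, Finset.prod_const,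
    Finset.card_range] at hprod
  -- If `α = 0`, there are no chunks and the power is `0 ^ 0 = 1`.
  have hpos : 0 < I.α ^ (C.chunks I.n).card := by
    rcases hα.eq_or_lt with h0 | h0
    · have : C.chunks I.n = ∅ := by
        ext c
        simp only [mem_chunks, h.cnt_eq h0.symm, Finset.notMem_empty, iff_false]
        omega
      simp [this]
    · exact pow_pos h0 _
  refine le_of_mul_le_mul_left ?_ hpos
  linarith [hprod]

end Config

/-! ### Allocating the remaining items -/

/-- An allocation that is approximately envy-free up to any item and has large Nash welfare. -/
structure Problem.Sound (I : Problem) (Z : Fin I.n → Finset (Fin I.m)) : Prop where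
  isAllocation : IsAllocation Z
  isApproxEFX : IsApproxEFX I.v I.α Z
  prod_le : ∏ i, I.v i (I.X i) ≤ (1 + I.α) ^ I.n * ∏ i, I.v i (Z i)

namespace Problem

variable {I : Problem} {Z Z' : Fin I.n → Finset (Fin I.m)}

/-- The number of pairs of an agent and an item that is worth more than the agent's bundle. -/
noncomputable def wishCount (I : Problem) (Z : Fin I.n → Finset (Fin I.m)) : ℕ :=
  (Finset.univ.filter fun p : Fin I.n × Fin I.m => I.v p.1 (Z p.1) < I.v p.1 {p.2}).card

open Classical in
/-- The number of items that are not allocated. -/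
noncomputable def poolCount (I : Problem) (Z : Fin I.n → Finset (Fin I.m)) : ℕ :=
  (Finset.univ.filter fun g : Fin I.m => ∀ i, g ∉ Z i).card

/-- The number of pairs of an agent and an envied agent. -/
noncomputable def envyCount (I : Problem) (Z : Fin I.n → Finset (Fin I.m)) : ℕ :=
  ∑ i, (Finset.univ.filter fun j => I.v i (Z i) < I.v i (Z j)).card

/-- The termination measure of the completion phase, up to the position in the list of items. -/
noncomputable def rank (I : Problem) (Z : Fin I.n → Finset (Fin I.m)) : ℕ :=
  (I.wishCount Z * (I.m + 1) + I.poolCount Z) * (I.n * I.n + 1) + I.envyCount Z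

theorem wishCount_le (Z : Fin I.n → Finset (Fin I.m)) : I.wishCount Z ≤ I.n * I.m :=
  (Finset.card_le_univ _).trans (by simp)

theorem poolCount_le (Z : Fin I.n → Finset (Fin I.m)) : I.poolCount Z ≤ I.m :=
  (Finset.card_le_univ _).trans (by simp)

theorem envyCount_le (Z : Fin I.n → Finset (Fin I.m)) : I.envyCount Z ≤ I.n * I.n :=
  (Finset.sum_le_card_nsmul _ _ I.n fun _ _ => (Finset.card_le_univ _).trans (by simp)).trans
    (by simp)

theorem rank_le (Z : Fin I.n → Finset (Fin I.m)) :
    I.rank Z ≤ (I.n * I.m * (I.m + 1) + I.m) * (I.n * I.n + 1) + I.n * I.n :=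
  add_le_add (Nat.mul_le_mul_right _
    (add_le_add (Nat.mul_le_mul_right _ (wishCount_le Z)) (poolCount_le Z))) (envyCount_le Z)

/-- Lexicographic order encoded in one number: a lower digit bounded by `M` cannot make up for a
drop of the higher one. -/
theorem mul_succ_add_lt {a a' b b' M : ℕ} (ha : a' < a) (hb : b' ≤ M) :
    a' * (M + 1) + b' < a * (M + 1) + b := by
  have := Nat.mul_le_mul_right (M + 1) (Nat.succ_le_of_lt ha)
  rw [Nat.succ_mul] at this
  omega

theorem rank_lt_of_wishCount (h : I.wishCount Z' < I.wishCount Z) : I.rank Z' < I.rank Z :=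
  mul_succ_add_lt (mul_succ_add_lt h (poolCount_le Z')) (envyCount_le Z')

theorem rank_lt_of_poolCount (h : I.wishCount Z' ≤ I.wishCount Z)
    (h' : I.poolCount Z' < I.poolCount Z) : I.rank Z' < I.rank Z :=
  mul_succ_add_lt (add_lt_add_of_le_of_lt (Nat.mul_le_mul_right _ h) h') (envyCount_le Z')

theorem rank_lt_of_envyCount (h : I.wishCount Z' ≤ I.wishCount Z)
    (h' : I.poolCount Z' ≤ I.poolCount Z) (h'' : I.envyCount Z' < I.envyCount Z) :
    I.rank Z' < I.rank Z :=
  add_lt_add_of_le_of_lt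
    (Nat.mul_le_mul_right _ (add_le_add (Nat.mul_le_mul_right _ h) h')) h''

theorem wishCount_mono (h : ∀ i, I.v i (Z i) ≤ I.v i (Z' i)) :
    I.wishCount Z' ≤ I.wishCount Z :=
  Finset.card_le_card (Finset.monotone_filter_right _ fun p _ hp => (h p.1).trans_lt hp)

theorem Sound.prod_le_of_le (hZ : I.Sound Z) (h : ∀ i, I.v i (Z i) ≤ I.v i (Z' i)) :
    ∏ i, I.v i (I.X i) ≤ (1 + I.α) ^ I.n * ∏ i, I.v i (Z' i) :=
  hZ.prod_le.trans (mul_le_mul_of_nonneg_left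
    (Finset.prod_le_prod (fun i _ => (I.valuation i).nonneg _) fun i _ => h i)
    (pow_nonneg (by linarith [I.α_nonneg]) _))

theorem α_mul_le (i : Fin I.n) {S T : Finset (Fin I.m)} (h : I.v i S ≤ I.v i T) :
    I.α * I.v i S ≤ I.v i T := by
  have := I.α_le
  have := (I.valuation i).nonneg S
  nlinarith

section Take

variable {i : Fin I.n} {g : Fin I.m}

theorem le_update_singleton (hi : I.v i (Z i) < I.v i {g}) (k : Fin I.n) :
    I.v k (Z k) ≤ I.v k (Function.update Z i {g} k) := by
  by_cases hk : k = i
  · subst hk; simpa using hi.le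
  · simp [hk]

/-- Without its only item the new bundle is empty, so nobody strongly envies it; the other bundles
are unchanged and agent `i` gains. -/
theorem Sound.update_singleton (hZ : I.Sound Z) (hg : ∀ j, g ∉ Z j)
    (hi : I.v i (Z i) < I.v i {g}) : I.Sound (Function.update Z i {g}) where
  isAllocation := by
    intro j k hjk
    by_cases hj : j = i
    · subst hj
      simp [Ne.symm hjk, hg]
    · by_cases hk : k = i
      · subst hk
        simp [hj, hg]
      · simpa [hj, hk] using hZ.isAllocation j k hjk
  isApproxEFX := by
    intro j k h hh
    refine le_trans ?_ (le_update_singleton hi j)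
    by_cases hk : k = i
    · subst hk
      simp only [Function.update_self, Finset.mem_singleton] at hh
      simp only [Function.update_self, hh, sdiff_self]
      exact α_mul_le j ((I.valuation j).mono _ _ (Finset.empty_subset _))
    · rw [Function.update_of_ne hk] at hh ⊢
      exact hZ.isApproxEFX j k h hh
  prod_le := hZ.prod_le_of_le (le_update_singleton hi)

/-- As values only grow, no wish arises, and the wish of `i` for `g` disappears. The old bundle of
`i` returns to the pool, which is why wishes outrank the pool in `rank`. -/
theorem rank_update_singleton (hi : I.v i (Z i) < I.v i {g}) :
    I.rank (Function.update Z i {g}) < I.rank Z := by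
  refine rank_lt_of_wishCount (Finset.card_lt_card ?_)
  rw [Finset.ssubset_iff_of_subset
    (Finset.monotone_filter_right _ fun p _ hp => (le_update_singleton hi p.1).trans_lt hp)]
  exact ⟨(i, g), by simpa using hi, by simp⟩

end Take

section Add

variable {j : Fin I.n} {g : Fin I.m}

theorem le_update_union (i : Fin I.n) :
    I.v i (Z i) ≤ I.v i (Function.update Z j (Z j ∪ {g}) i) := by
  refine (I.valuation i).mono _ _ ?_
  by_cases hi : i = j
  · subst hi; simp
  · simp [hi]

/-- For every agent both the old bundle of `j` and the item `g` are worth at most the own bundle. By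
subadditivity their union is worth at most twice as much, and `α ≤ 1 / 2` absorbs the 2. -/
theorem Sound.update_union (hZ : I.Sound Z) (hg : ∀ j, g ∉ Z j)
    (hwish : ∀ i, I.v i {g} ≤ I.v i (Z i)) (hj : ∀ i, I.v i (Z j) ≤ I.v i (Z i)) :
    I.Sound (Function.update Z j (Z j ∪ {g})) where
  isAllocation := by
    intro i k hik
    by_cases hi : i = j
    · subst hi
      simpa [Ne.symm hik, Finset.disjoint_union_left, hg] using hZ.isAllocation i k hik
    · by_cases hk : k = j
      · subst hk
        simpa [hi, Finset.disjoint_union_right, hg] using hZ.isAllocation i k hik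
      · simpa [hi, hk] using hZ.isAllocation i k hik
  isApproxEFX := by
    intro i k h hh
    refine le_trans ?_ (le_update_union i)
    by_cases hk : k = j
    · subst hk
      rw [Function.update_self]
      have h1 := (I.valuation i).mono _ (Z k ∪ {g}) (Finset.sdiff_subset (t := {h}))
      have h2 := (I.valuation i).subadditive (Z k) {g}
      have h3 := hwish i
      have h4 := hj i
      have := I.α_le
      have := I.α_nonneg
      have := (I.valuation i).nonneg (Z i)
      nlinarith
    · rw [Function.update_of_ne hk] at hh ⊢
      exact hZ.isApproxEFX i k h hh
  prod_le := hZ.prod_le_of_le le_update_union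

theorem rank_update_union (hg : ∀ j, g ∉ Z j) :
    I.rank (Function.update Z j (Z j ∪ {g})) < I.rank Z := by
  classical
  refine rank_lt_of_poolCount (wishCount_mono le_update_union) (Finset.card_lt_card ?_)
  rw [Finset.ssubset_iff_of_subset]
  · exact ⟨g, by simpa using hg, by simpa using ⟨j, by simp⟩⟩
  · refine Finset.monotone_filter_right _ fun h _ hh i hi => hh i ?_
    by_cases hij : i = j
    · subst hij; simp [hi]
    · simpa [hij] using hi

end Add

theorem Sound.permute (hZ : I.Sound Z) (π : Equiv.Perm (Fin I.n)) (hπ : ∀ i, Z' i = Z (π i))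
    (hle : ∀ i, I.v i (Z i) ≤ I.v i (Z' i)) : I.Sound Z' where
  isAllocation i j hij := by
    rw [hπ, hπ]
    exact hZ.isAllocation _ _ (π.injective.ne hij)
  isApproxEFX i j g hg := by
    rw [hπ j] at hg ⊢
    exact (hZ.isApproxEFX i (π j) g hg).trans (hle i)
  prod_le := hZ.prod_le_of_le hle

/-- The pool stays the same. Each agent compares the same collection of bundles with an own value
that has not dropped, so envy cannot increase; and `x` no longer envies the bundle that `x` now
holds. -/
theorem rank_permute (π : Equiv.Perm (Fin I.n)) (hπ : ∀ i, Z' i = Z (π i))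
    (hle : ∀ i, I.v i (Z i) ≤ I.v i (Z' i)) {x : Fin I.n} (hx : I.v x (Z x) < I.v x (Z' x)) :
    I.rank Z' < I.rank Z := by
  classical
  refine rank_lt_of_envyCount (wishCount_mono hle) ?_ ?_
  · refine Finset.card_le_card (Finset.monotone_filter_right _ fun g _ hg i hi => ?_)
    exact hg (π.symm i) (by rw [hπ]; simpa using hi)
  · have hcard : ∀ i, (Finset.univ.filter fun j => I.v i (Z' i) < I.v i (Z' j)).card =
        (Finset.univ.filter fun j => I.v i (Z' i) < I.v i (Z j)).card := by
      intro i
      refine Finset.card_bij (fun j _ => π j) ?_ (fun a _ b _ h => π.injective h) ?_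
      · intro j hj
        simpa [← hπ j] using hj
      · intro j hj
        exact ⟨π.symm j, by simpa [hπ (π.symm j)] using hj, by simp⟩
    refine Finset.sum_lt_sum (fun i _ => ?_) ⟨x, Finset.mem_univ x, ?_⟩
    · rw [hcard]
      exact Finset.card_le_card (Finset.monotone_filter_right _ fun j _ hj => (hle i).trans_lt hj)
    · rw [hcard]
      refine Finset.card_lt_card ?_
      rw [Finset.ssubset_iff_of_subset
        (Finset.monotone_filter_right _ fun j _ hj => (hle x).trans_lt hj)]
      exact ⟨π x, by simpa [← hπ x] using hx, by simp [← hπ x]⟩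

end Problem

/-! ### Envy cycles -/

theorem iterate_lt {f : ℕ → ℕ} {n : ℕ} (hf : ∀ j < n, f j < n) {x : ℕ} (hx : x < n) (t : ℕ) :
    f^[t] x < n := by
  induction t with
  | zero => exact hx
  | succ t ih => rw [Function.iterate_succ_apply']; exact hf _ ih

/-- Two of the iterates at times `0, …, n` coincide by the pigeonhole principle, so after `n` steps
the walk is on a cycle of length at most `n`. -/
theorem exists_iterate_eq_self {f : ℕ → ℕ} {n : ℕ} (hn : 0 < n) (hf : ∀ j < n, f j < n) :
    ∃ d, 0 < d ∧ d ≤ n ∧ f^[d] (f^[n] 0) = f^[n] 0 := by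
  obtain ⟨a, b, hab, h⟩ := Fintype.exists_ne_map_eq_of_card_lt
    (fun a : Fin (n + 1) => (⟨f^[a] 0, iterate_lt hf hn a⟩ : Fin n)) (by simp)
  simp only [Fin.mk.injEq] at h
  wlog hlt : a < b generalizing a b
  · exact this b a hab.symm h.symm (lt_of_le_of_ne (not_lt.1 hlt) hab.symm)
  have hlt' : (a : ℕ) < b := hlt
  refine ⟨b - a, by omega, by omega, ?_⟩
  have h1 : f^[n] 0 = f^[n - b] (f^[b] 0) := by
    rw [← Function.iterate_add_apply]; congr 1; omega
  have h2 : f^[b - a] (f^[n] 0) = f^[n - b] (f^[b] (f^[b - a] 0)) := by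
    rw [← Function.iterate_add_apply, ← Function.iterate_add_apply, ← Function.iterate_add_apply]
    congr 1; omega
  have h3 : f^[b] (f^[b - a] 0) = f^[b - a] (f^[a] 0) := by
    rw [h, ← Function.iterate_add_apply, ← Function.iterate_add_apply, add_comm]
  have h4 : f^[b - a] (f^[a] 0) = f^[b] 0 := by
    rw [← Function.iterate_add_apply]; congr 1; omega
  rw [h2, h3, h4, ← h1]

/-- The bundles `H` are being moved along the cycle of `f` through agent `x`; the bundles `K`
are reached when agent `j` is the next to receive a bundle, which agent `x` holds meanwhile. -/
structure Rotating (I : Problem) (f : ℕ → ℕ) (x : ℕ) (H K : ℕ → Finset (Fin I.m)) (j t : ℕ) :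
    Prop where
  lt_period : t < Function.minimalPeriod f x
  eq_iterate : j = f^[t + 1] x
  exists_perm : ∃ π : Equiv.Perm (Fin I.n), ∀ i : Fin I.n, K i = H (π i)
  -- Agent `x` is excluded: `x` holds a bundle in transit, perhaps a bad one, and is served only
  -- when the cycle closes.
  le_val : ∀ i < I.n, i ≠ x → I.val i (H i) ≤ I.val i (K i)
  hand : K x = H (f^[t] x)
  rest : ∀ s, t < s → s < Function.minimalPeriod f x → K (f^[s] x) = H (f^[s] x)

namespace Rotating

variable {I : Problem} {f : ℕ → ℕ} {x j t : ℕ} {H K : ℕ → Finset (Fin I.m)}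

theorem start (hx : x ∈ Function.periodicPts f) : Rotating I f x H H (f x) 0 where
  lt_period := Function.minimalPeriod_pos_of_mem_periodicPts hx
  eq_iterate := rfl
  exists_perm := ⟨1, fun _ => rfl⟩
  le_val _ _ _ := le_rfl
  hand := rfl
  rest _ _ _ := rfl

/-- Swapping the bundles of `x` and `j` gives `j` the bundle of the predecessor on the cycle, which
`j` envies, and leaves the old bundle of `j` with `x` for the next agent. -/
theorem step (h : Rotating I f x H K j t) (hf : ∀ j < I.n, f j < I.n) (hx : x < I.n)
    (henvy : ∀ j < I.n, I.val (f j) (H (f j)) < I.val (f j) (H j)) (hj : j ≠ x) :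
    Rotating I f x H (Function.update (Function.update K x (K j)) j (K x)) (f j) (t + 1) := by
  have hjn : j < I.n := h.eq_iterate ▸ iterate_lt hf hx _
  -- After a full period `j` would be `x` again.
  have hlt : t + 1 < Function.minimalPeriod f x := by
    refine lt_of_le_of_ne h.lt_period fun heq => hj ?_
    rw [h.eq_iterate, heq]
    exact Function.isPeriodicPt_minimalPeriod f x
  have hjK : K j = H j := by
    have := h.rest (t + 1) (Nat.lt_succ_self t) hlt
    rwa [← h.eq_iterate] at this
  refine ⟨hlt, ?_, ?_, ?_, ?_, ?_⟩
  · rw [Function.iterate_succ_apply', ← h.eq_iterate]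
  · obtain ⟨π, hπ⟩ := h.exists_perm
    refine ⟨(Equiv.swap ⟨x, hx⟩ ⟨j, hjn⟩).trans π, fun i => ?_⟩
    rw [Equiv.trans_apply, ← hπ]
    by_cases hij : (i : ℕ) = j
    · have : i = ⟨j, hjn⟩ := Fin.ext hij
      simp [this]
    · by_cases hix : (i : ℕ) = x
      · have : i = ⟨x, hx⟩ := Fin.ext hix
        simp [this, Ne.symm hj]
      · rw [Equiv.swap_apply_of_ne_of_ne (fun h => hix (by simp [h])) (fun h => hij (by simp [h]))]
        simp [hij, hix]
  · intro i hi hix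
    by_cases hij : i = j
    · subst hij
      rw [Function.update_self, h.hand]
      have hlt' := iterate_lt hf hx t
      have := henvy _ hlt'
      rw [← Function.iterate_succ_apply' f, ← h.eq_iterate] at this
      exact this.le
    · simpa [hij, hix] using h.le_val i hi hix
  · rw [Function.update_of_ne (Ne.symm hj), Function.update_self, hjK, h.eq_iterate]
  · intro s hs hsp
    have hinj := Function.iterate_injOn_Iio_minimalPeriod (f := f) (x := x)
    have hsj : f^[s] x ≠ j := fun heq => by
      rw [h.eq_iterate] at heq
      have := hinj hsp hlt heq
      omega
    have hsx : f^[s] x ≠ x := fun heq => by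
      have := hinj hsp (show (0 : ℕ) < _ by omega) heq
      omega
    rw [Function.update_of_ne hsj, Function.update_of_ne hsx]
    exact h.rest s (by omega) hsp

/-- When the cycle closes, `x` holds the bundle of its own predecessor, which `x` envies. -/
theorem lt_val (h : Rotating I f x H K j t) (hf : ∀ j < I.n, f j < I.n) (hx : x < I.n)
    (henvy : ∀ j < I.n, I.val (f j) (H (f j)) < I.val (f j) (H j)) (hj : j = x) :
    I.val x (H x) < I.val x (K x) := by
  rw [h.hand]
  have := henvy _ (iterate_lt hf hx t)
  rwa [← Function.iterate_succ_apply' f, ← h.eq_iterate, hj] at this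

end Rotating


/-! ### Memory layout -/

/-- The address of entry `c` of array `r < 8` in the memory for numbers. -/
def arrAddr (r c : ℕ) : ℕ := 16 + r + 8 * c

/-- The address of slot `c` in the memory for bundles. -/
def slotAddr (n c : ℕ) : ℕ := n + 1 + 2 * c

/-- The address of the reference bundle of agent `l` in the memory for bundles. -/
def refAddr (n l : ℕ) : ℕ := n + 2 + 2 * l

namespace State

variable {m : ℕ}

def setNum (σ : State m) (a x : ℕ) : State m := ⟨Function.update σ.num a x, σ.bundle⟩

def setBundle (σ : State m) (a : ℕ) (S : Finset (Fin m)) : State m :=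
  ⟨σ.num, Function.update σ.bundle a S⟩

/-- The stride 8 and the offset 16 keep the arrays apart from each other and from the variables
below 16. -/
def arr (σ : State m) (r : ℕ) : ℕ → ℕ := fun c => σ.num (arrAddr r c)

/-- Cells below `n` hold the current bundles and cell `n` is scratch; above it slots and reference
bundles alternate. -/
def slot (σ : State m) (n : ℕ) : ℕ → Finset (Fin m) := fun c => σ.bundle (slotAddr n c)

def ref (σ : State m) (n : ℕ) : ℕ → Finset (Fin m) := fun c => σ.bundle (refAddr n c)

variable (σ : State m) {a b x r s c k n : ℕ} {S : Finset (Fin m)}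

@[simp] theorem num_setNum : (σ.setNum a x).num a = x := Function.update_self ..

@[simp] theorem num_setNum_ne (h : b ≠ a) : (σ.setNum a x).num b = σ.num b := Function.update_of_ne h ..

@[simp] theorem num_setNum_arr (h : b < 16) : (σ.setNum (arrAddr r c) x).num b = σ.num b :=
  σ.num_setNum_ne (by unfold arrAddr; omega)

@[simp] theorem arr_setNum (h : a < 16) : (σ.setNum a x).arr r = σ.arr r :=
  funext fun _ => σ.num_setNum_ne (by unfold arrAddr; omega)

@[simp] theorem arr_setNum_arr : (σ.setNum (arrAddr r c) x).arr r = Function.update (σ.arr r) c x := by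
  funext d
  by_cases h : d = c
  · subst h; simp [arr, setNum]
  · rw [Function.update_of_ne h]
    exact σ.num_setNum_ne (by unfold arrAddr; omega)

@[simp] theorem arr_setNum_arr_ne (h : s ≠ r) (hr : r < 8) (hs : s < 8) :
    (σ.setNum (arrAddr r c) x).arr s = σ.arr s :=
  funext fun _ => σ.num_setNum_ne (by unfold arrAddr; omega)

@[simp] theorem bundle_setNum : (σ.setNum a x).bundle = σ.bundle := rfl

@[simp] theorem slot_setNum : (σ.setNum a x).slot n = σ.slot n := rfl

@[simp] theorem ref_setNum : (σ.setNum a x).ref n = σ.ref n := rfl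

@[simp] theorem num_setBundle : (σ.setBundle a S).num = σ.num := rfl

@[simp] theorem arr_setBundle : (σ.setBundle a S).arr r = σ.arr r := rfl

@[simp] theorem bundle_setBundle : (σ.setBundle a S).bundle a = S := Function.update_self ..

@[simp] theorem bundle_setBundle_ne (h : b ≠ a) : (σ.setBundle a S).bundle b = σ.bundle b :=
  Function.update_of_ne h ..

@[simp] theorem bundle_setBundle_slot (h : k ≤ n) :
    (σ.setBundle (slotAddr n c) S).bundle k = σ.bundle k :=
  σ.bundle_setBundle_ne (by unfold slotAddr; omega)

@[simp] theorem bundle_setBundle_ref (h : k ≤ n) :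
    (σ.setBundle (refAddr n c) S).bundle k = σ.bundle k :=
  σ.bundle_setBundle_ne (by unfold refAddr; omega)

@[simp] theorem slot_setBundle (h : k ≤ n) : (σ.setBundle k S).slot n = σ.slot n :=
  funext fun _ => σ.bundle_setBundle_ne (by unfold slotAddr; omega)

@[simp] theorem slot_setBundle_slot :
    (σ.setBundle (slotAddr n c) S).slot n = Function.update (σ.slot n) c S := by
  funext d
  by_cases h : d = c
  · subst h; simp [slot, setBundle]
  · rw [Function.update_of_ne h]
    exact σ.bundle_setBundle_ne (by unfold slotAddr; omega)

@[simp] theorem slot_setBundle_ref : (σ.setBundle (refAddr n c) S).slot n = σ.slot n :=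
  funext fun _ => σ.bundle_setBundle_ne (by unfold slotAddr refAddr; omega)

@[simp] theorem ref_setBundle (h : k ≤ n) : (σ.setBundle k S).ref n = σ.ref n :=
  funext fun _ => σ.bundle_setBundle_ne (by unfold refAddr; omega)

@[simp] theorem ref_setBundle_ref :
    (σ.setBundle (refAddr n c) S).ref n = Function.update (σ.ref n) c S := by
  funext d
  by_cases h : d = c
  · subst h; simp [ref, setBundle]
  · rw [Function.update_of_ne h]
    exact σ.bundle_setBundle_ne (by unfold refAddr; omega)

@[simp] theorem ref_setBundle_slot : (σ.setBundle (slotAddr n c) S).ref n = σ.ref n :=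
  funext fun _ => σ.bundle_setBundle_ne (by unfold slotAddr refAddr; omega)

end State

/-- The bundle of the single item with number `g`. -/
def item (m g : ℕ) : Finset (Fin m) := Finset.univ.filter fun h => (h : ℕ) = g

@[simp] theorem item_val {m : ℕ} (g : Fin m) : item m g = {g} := by
  ext h
  simp [item, Fin.ext_iff]

/-! ### Evaluation of expressions and tests in terms of variables, arrays and slots -/

namespace NatExp

/-- A variable for a number, kept at a fixed address below 16. -/
def reg (a : ℕ) : NatExp := .load (.const a)

def double (e : NatExp) : NatExp := .add e e

/-- The machine cannot multiply, so the factor 8 is made by doubling three times. -/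
def arrA (r : ℕ) (e : NatExp) : NatExp := .add (.const (16 + r)) e.double.double.double

def get (r : ℕ) (e : NatExp) : NatExp := .load (arrA r e)

def slotA (e : NatExp) : NatExp := .add (.add .agents (.const 1)) e.double

def refA (e : NatExp) : NatExp := .add (.add .agents (.const 2)) e.double

variable {m : ℕ} (n : ℕ) (σ : State m) (a r k : ℕ) (e e' : NatExp)

@[simp] theorem eval_const : (NatExp.const k).eval n σ = k := rfl
@[simp] theorem eval_agents : NatExp.agents.eval n σ = n := rfl
@[simp] theorem eval_items : NatExp.items.eval n σ = m := rfl
@[simp] theorem eval_add : (NatExp.add e e').eval n σ = e.eval n σ + e'.eval n σ := rfl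
@[simp] theorem eval_reg : (reg a).eval n σ = σ.num a := rfl

@[simp] theorem eval_arrA : (arrA r e).eval n σ = arrAddr r (e.eval n σ) := by
  simp only [arrA, double, eval, arrAddr]
  omega

@[simp] theorem eval_get : (get r e).eval n σ = σ.arr r (e.eval n σ) :=
  congrArg σ.num (eval_arrA n σ r e)

@[simp] theorem eval_slotA : (slotA e).eval n σ = slotAddr n (e.eval n σ) := by
  simp only [slotA, double, eval, slotAddr]
  omega

@[simp] theorem eval_refA : (refA e).eval n σ = refAddr n (e.eval n σ) := by
  simp only [refA, double, eval, refAddr]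
  omega

end NatExp

namespace BundleExp

def slot (e : NatExp) : BundleExp := .load e.slotA

def ref (e : NatExp) : BundleExp := .load e.refA

variable {m : ℕ} (n : ℕ) (σ : State m) (e : NatExp) (A B : BundleExp)

@[simp] theorem eval_empty : BundleExp.empty.eval n σ = ∅ := rfl
@[simp] theorem eval_single : (BundleExp.single e).eval n σ = item m (e.eval n σ) := rfl
@[simp] theorem eval_load : (BundleExp.load e).eval n σ = σ.bundle (e.eval n σ) := rfl
@[simp] theorem eval_union : (BundleExp.union A B).eval n σ = A.eval n σ ∪ B.eval n σ := rfl
@[simp] theorem eval_diff : (BundleExp.diff A B).eval n σ = A.eval n σ \ B.eval n σ := rfl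

@[simp] theorem eval_slot : (slot e).eval n σ = σ.slot n (e.eval n σ) :=
  congrArg σ.bundle (NatExp.eval_slotA n σ e)

@[simp] theorem eval_ref : (ref e).eval n σ = σ.ref n (e.eval n σ) :=
  congrArg σ.bundle (NatExp.eval_refA n σ e)

end BundleExp

@[simp] theorem RealExp.eval_value (I : Problem) (σ : State I.m) (e : NatExp) (S : BundleExp) :
    (RealExp.value e S).eval I.α I.v σ = I.val (e.eval I.n σ) (S.eval I.n σ) := rfl

namespace RealExp

variable (I : Problem) (σ : State I.m)

@[simp] theorem eval_const (k : ℕ) : (const k).eval I.α I.v σ = k := rfl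
@[simp] theorem eval_alpha : alpha.eval I.α I.v σ = I.α := rfl

@[simp] theorem eval_add (a b : RealExp) :
    (add a b).eval I.α I.v σ = a.eval I.α I.v σ + b.eval I.α I.v σ := rfl

@[simp] theorem eval_mul (a b : RealExp) :
    (mul a b).eval I.α I.v σ = a.eval I.α I.v σ * b.eval I.α I.v σ := rfl

end RealExp

namespace Test

/-- The test `a < b`. -/
def natLT (a b : NatExp) : Test := .not (.natLE b a)

variable (I : Problem) (σ : State I.m)

@[simp] theorem holds_natLE (a b : NatExp) :
    (natLE a b).Holds I.α I.v σ ↔ a.eval I.n σ ≤ b.eval I.n σ := Iff.rfl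

@[simp] theorem holds_natLT (a b : NatExp) :
    (natLT a b).Holds I.α I.v σ ↔ a.eval I.n σ < b.eval I.n σ := not_le

@[simp] theorem holds_mem (e : NatExp) (S : BundleExp) :
    (mem e S).Holds I.α I.v σ ↔ ∃ g ∈ S.eval I.n σ, (g : ℕ) = e.eval I.n σ := Iff.rfl

@[simp] theorem holds_realLE (a b : RealExp) :
    (realLE a b).Holds I.α I.v σ ↔ a.eval I.α I.v σ ≤ b.eval I.α I.v σ := Iff.rfl

@[simp] theorem holds_not (c : Test) : (Test.not c).Holds I.α I.v σ ↔ ¬ c.Holds I.α I.v σ := Iff.rfl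

@[simp] theorem holds_and (c d : Test) :
    (Test.and c d).Holds I.α I.v σ ↔ c.Holds I.α I.v σ ∧ d.Holds I.α I.v σ := Iff.rfl

end Test

namespace Program

/-- Increments a variable. -/
def incr (a : ℕ) : Program := .setNat (.const a) (.add (.reg a) (.const 1))

/-- Assigns to a variable. -/
def assign (a : ℕ) (e : NatExp) : Program := .setNat (.const a) e

/-- Does nothing relevant. -/
def skip : Program := assign 15 (.const 0)

section

variable {m n : ℕ} (α : ℝ) (v : Fin n → Finset (Fin m) → ℝ) (σ : State m)

@[simp] theorem denote_setNat (a e : NatExp) :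
    (setNat a e).denote α v σ = σ.setNum (a.eval n σ) (e.eval n σ) := rfl

@[simp] theorem denote_setBundle (a : NatExp) (S : BundleExp) :
    (setBundle a S).denote α v σ = σ.setBundle (a.eval n σ) (S.eval n σ) := rfl

@[simp] theorem denote_seq (P Q : Program) :
    (seq P Q).denote α v σ = Q.denote α v (P.denote α v σ) := rfl

open Classical in
@[simp] theorem denote_branch (c : Test) (P Q : Program) :
    (branch c P Q).denote α v σ =
      if c.Holds α v σ then P.denote α v σ else Q.denote α v σ := rfl

@[simp] theorem denote_incr (a : ℕ) :
    (incr a).denote α v σ = σ.setNum a (σ.num a + 1) := rfl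

@[simp] theorem denote_assign (a : ℕ) (e : NatExp) :
    (assign a e).denote α v σ = σ.setNum a (e.eval n σ) := rfl

@[simp] theorem denote_skip : skip.denote α v σ = σ.setNum 15 0 := rfl

end

end Program

/-! ### The program of the shrinking phase -/

namespace Program

/-- Copies the initial bundles into the base slots. -/
def setup : Program :=
  .seq (.loop (.natLT (.reg 4) .agents)
    (.seq (.setBundle (.slotA (.reg 4)) (.load (.reg 4)))
      (.seq (.setBundle (.refA (.reg 4)) (.load (.reg 4)))
        (.seq (.setNat (.arrA 0 (.reg 4)) (.reg 4)) (incr 4)))))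
    (assign 0 .agents)

/-- Computes the last slot and the current bundle of every agent. -/
def refresh : Program :=
  .seq (assign 4 (.const 0))
    (.loop (.natLT (.reg 4) (.reg 0))
      -- Later slots overwrite earlier ones, so the last slot of each agent remains. Discarded slots
      -- have owner `n` and end up in the scratch cell.
      (.seq (.setBundle (.get 0 (.reg 4)) (.slot (.reg 4)))
        (.seq (.setNat (.arrA 3 (.get 0 (.reg 4))) (.reg 4)) (incr 4))))

/-- The current bundle of agent `l` without item `g`. -/
def shrunk : BundleExp := .diff (.load (.reg 2)) (.single (.reg 3))

/-- Agent `k` strongly envies agent `l` because of item `g`. -/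
def envyTest : Test :=
  .and (.mem (.reg 3) (.load (.reg 2)))
    (.not (.realLE (.mul .alpha (.value (.reg 1) shrunk)) (.value (.reg 1) (.load (.reg 1)))))

/-- The implication between two tests. -/
def impTest (c d : Test) : Test := .not (.and c (.not d))

/-- Agent `l` can use the shrunk bundle without a further cut. -/
def keepTest : Test :=
  .and (impTest (.natLE (.get 2 (.reg 2)) (.const 0))
      (.realLE (.value (.reg 2) (.ref (.reg 2)))
        (.mul (.add (.const 1) .alpha) (.value (.reg 2) shrunk))))
    (.and (impTest (.and (.natLE (.get 2 (.reg 2)) (.const 1)) (.natLE (.const 1) (.get 2 (.reg 2))))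
      (.realLE (.mul .alpha (.value (.reg 2) (.ref (.reg 2))))
        (.mul (.add (.const 1) .alpha) (.value (.reg 2) shrunk))))
      (impTest (.natLE (.const 2) (.get 2 (.reg 2)))
        (.realLE (.mul .alpha (.value (.reg 2) (.ref (.reg 2)))) (.value (.reg 2) shrunk))))

def trim : Program := .setBundle (.slotA (.reg 2)) shrunk

def transfer : Program :=
  .seq (.setBundle (.slotA (.reg 0)) shrunk)
    (.seq (.setNat (.arrA 0 (.reg 0)) (.reg 1))
      (.seq (.setNat (.arrA 1 (.reg 0)) (.get 1 (.get 3 (.reg 2))))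
        (.seq (.setNat (.arrA 0 (.get 3 (.reg 2))) .agents) (incr 0))))

def discard : Program :=
  -- Starting at `n` spares the base slots, whose origin entries have no meaning.
  .seq (assign 4 .agents)
    (.loop (.natLT (.reg 4) (.reg 0))
      (.seq (.branch (.and (.natLE (.get 1 (.reg 4)) (.reg 2)) (.natLE (.reg 2) (.get 1 (.reg 4))))
          (.setNat (.arrA 0 (.reg 4)) .agents) skip)
        (incr 4)))

def cut : Program :=
  .seq (.setBundle (.slotA (.reg 0)) shrunk)
    (.seq (.setNat (.arrA 0 (.reg 0)) (.reg 1))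
      (.seq (.setNat (.arrA 1 (.reg 0)) (.reg 2))
        (.seq (.setBundle (.slotA (.reg 2)) (.diff (.ref (.reg 2)) shrunk))
          (.seq (.branch (.natLE (.const 1) (.get 2 (.reg 2)))
              -- Slot `l` has just received the reference bundle without the chunk, so copying it is
              -- the required update.
              (.setBundle (.refA (.reg 2)) (.slot (.reg 2))) skip)
            (.seq (.setNat (.arrA 2 (.reg 2)) (.add (.get 2 (.reg 2)) (.const 1))) (incr 0))))))

/-- Resolves the strong envy of agent `k` towards agent `l`. -/
def resolve : Program :=
  .branch (.natLE .agents (.get 3 (.reg 2))) transfer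
    (.branch keepTest trim
      (.branch (.natLE (.get 2 (.reg 2)) (.const 1)) (.seq discard cut) cut))

/-- Resets the search for strong envy. -/
def restart : Program :=
  .seq (assign 1 (.const 0)) (.seq (assign 2 (.const 0)) (assign 3 (.const 0)))

/-- Moves on to the next triple of two agents and an item. -/
def advance : Program :=
  .seq (incr 3)
    (.branch (.natLE .items (.reg 3))
      (.seq (assign 3 (.const 0))
        (.seq (incr 2)
          (.branch (.natLE .agents (.reg 2)) (.seq (assign 2 (.const 0)) (incr 1)) skip)))
      skip)

def shrinkLoop : Program :=
  .loop (.natLT (.reg 1) .agents)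
    (.branch envyTest (.seq resolve (.seq refresh restart)) advance)

/-- The shrinking phase. -/
def shrink : Program := .seq setup (.seq refresh (.seq restart shrinkLoop))

end Program

/-! ### Correctness and running time of the shrinking program -/

open Program

/-- The configuration that is stored in memory. -/
def conf (I : Problem) (σ : State I.m) : Config I.m where
  cnt := σ.num 0
  own := σ.arr 0
  orig := σ.arr 1
  stage := σ.arr 2
  slot := σ.slot I.n
  ref := σ.ref I.n

/-- A bound for the number of slots that are ever used. -/
def slotBound (I : Problem) : ℕ := I.n + ((I.m + 1) * (I.n * (I.m + 1)) + I.m)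

/-- The stored configuration satisfies the invariant, and few slots have been used. -/
structure Ready (I : Problem) (σ : State I.m) : Prop where
  inv : (conf I σ).Inv I
  -- The number of slots is charged to the potential; this bounds the loops that run over all slots.
  bound : σ.num 0 + (conf I σ).potential I.n ≤ slotBound I

/-- The last slots and the current bundles are up to date. -/
def Current (I : Problem) (σ : State I.m) : Prop :=
  ∀ k < I.n, (conf I σ).IsTop k (σ.arr 3 k) ∧ σ.bundle k = σ.slot I.n (σ.arr 3 k)

/-- A polynomial bound for `slotBound`. -/
noncomputable def slotPoly : Polynomial ℕ :=
  .X + ((.X + 1) * (.X * (.X + 1)) + .X)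

theorem slotBound_le (I : Problem) : slotBound I ≤ slotPoly.eval (I.n + I.m) := by
  simp only [slotBound, slotPoly, Polynomial.eval_add, Polynomial.eval_mul, Polynomial.eval_X,
    Polynomial.eval_one]
  gcongr <;> omega

theorem setup_spec : Spec setup (fun I σ => σ = inputState I.X) (fun I _ τ => Ready I τ) := by
  refine Spec.seq (pre₂ := fun _ _ => True) (post₁ := fun I _ τ => τ.num 4 = I.n ∧
      (∀ l < I.n, τ.arr 0 l = l ∧ τ.arr 2 l = 0 ∧ τ.slot I.n l = I.endowment l ∧
        τ.ref I.n l = I.endowment l))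
    (Spec.mono (Spec.loop_loopFree (by simp [LoopFree, incr])
      (inv := fun I σ τ => τ.num 4 ≤ I.n ∧ (∀ l < I.n, τ.bundle l = I.endowment l) ∧
        (∀ l, τ.arr 2 l = 0) ∧ ∀ l < τ.num 4, τ.arr 0 l = l ∧ τ.slot I.n l = I.endowment l ∧
        τ.ref I.n l = I.endowment l)
      (pre := fun I σ => σ = inputState I.X)
      (fun I τ => I.n - τ.num 4) .X ?_ ?_ ?_) (fun _ _ h => h) ?_)
    (Spec.loopFree (post := fun I σ τ => τ = σ.setNum 0 I.n) (by simp [LoopFree, assign]) ?_)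
    (fun _ _ _ _ _ => trivial) ?_
  · rintro I σ rfl
    refine ⟨Nat.zero_le _, fun l hl => rfl, fun l => rfl, fun l hl => ?_⟩
    exact absurd hl (Nat.not_lt_zero l)
  · intro I σ τ _
    simp
    omega
  · rintro I σ τ ⟨h1, h2, h3, h4⟩ hlt
    simp at hlt
    simp (disch := omega)
    refine ⟨⟨hlt, fun l hl => ?_, h3, fun l hl => ?_⟩, by omega⟩
    · simpa (disch := omega) using h2 l hl
    rcases hl.lt_or_eq with hl | rfl
    · simpa (disch := omega) using h4 l hl
    · simp [h2 _ hlt]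
  · rintro I σ τ - ⟨⟨h1, h2, h3, h4⟩, hlt⟩
    simp at hlt
    have : τ.num 4 = I.n := le_antisymm h1 hlt
    exact ⟨this, fun l hl => ⟨(h4 l (by omega)).1, h3 l, (h4 l (by omega)).2⟩⟩
  · intro I σ _
    simp
  · rintro I σ τ ρ - ⟨h1, h2⟩ rfl
    have hinv : (conf I (τ.setNum 0 I.n)).Inv I := by
      refine Config.Inv.of_initial ?_ ?_ ?_ ?_ ?_
      · simp [conf]
      all_goals intro l hl
      all_goals simp (disch := omega) [conf, h2 l hl]
    refine ⟨hinv, ?_⟩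
    have := hinv.potential_le
    simp only [State.num_setNum, slotBound]
    omega

/-- The parts of the memory that `refresh` does not change. -/
structure SameConf (I : Problem) (σ τ : State I.m) : Prop where
  conf_eq : conf I τ = conf I σ
  num_eq : ∀ a < 4, τ.num a = σ.num a

theorem refresh_spec :
    Spec refresh Ready (fun I σ τ => SameConf I σ τ ∧ Current I τ) := by
  refine Spec.seq (pre₂ := fun I σ => Ready I σ ∧ σ.num 4 = 0) (post₁ := fun I σ τ => τ = σ.setNum 4 0)
    (Spec.loopFree (by simp [LoopFree, assign]) ?_)
    (Spec.loop_loopFree (by simp [LoopFree, incr])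
      (inv := fun I σ τ => Ready I σ ∧ SameConf I σ τ ∧ τ.num 4 ≤ τ.num 0 ∧
        ∀ k < I.n, ∀ d < τ.num 4, τ.arr 0 d = k → τ.arr 3 k < τ.num 4 ∧ τ.arr 0 (τ.arr 3 k) = k ∧
          d ≤ τ.arr 3 k ∧ τ.bundle k = τ.slot I.n (τ.arr 3 k))
      (fun I τ => τ.num 0 - τ.num 4) slotPoly ?_ ?_ ?_) ?_ ?_
  · intro I σ _
    simp
  · intro I σ ⟨h, h4⟩
    refine ⟨h, ⟨rfl, fun _ _ => rfl⟩, by omega, fun k hk d hd => by omega⟩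
  · rintro I σ τ ⟨h1, h2, -⟩
    have := h1.bound
    have := h2.num_eq 0 (by omega)
    have := slotBound_le I
    omega
  · rintro I σ τ ⟨h1, ⟨h2, h2'⟩, h3, h4⟩ hlt
    simp at hlt
    have hle : τ.arr 0 (τ.num 4) ≤ I.n := by
      have := h1.inv.own_le (τ.num 4) (by rw [← h2]; exact hlt)
      rw [← h2] at this
      exact this
    simp (disch := omega)
    refine ⟨⟨h1, ⟨?_, ?_⟩, hlt, ?_⟩, by omega⟩
    · rw [← h2]
      simp (disch := omega) [conf]
    · intro a ha
      rw [← h2' a ha]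
      simp (disch := omega)
    · intro k hk d hd hdk
      by_cases hk' : k = τ.arr 0 (τ.num 4)
      · subst hk'
        simp
        omega
      · have hd' : d < τ.num 4 := by
          rcases hd.lt_or_eq with hd | rfl
          · exact hd
          · exact absurd hdk.symm hk'
        obtain ⟨g1, g2, g3, g4⟩ := h4 k hk d hd' hdk
        simp (disch := omega)
        exact ⟨by omega, g2, g3, g4⟩
  · rintro I σ τ h rfl
    refine ⟨⟨?_, ?_⟩, by simp⟩
    · have := h.inv
      simpa (disch := omega) [conf] using this
    · have := h.bound
      simpa (disch := omega) [conf] using this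
  · rintro I σ τ ρ h rfl ⟨⟨-, ⟨h2, h2'⟩, h3, h4⟩, hlt⟩
    simp at hlt
    have hconf : conf I ρ = conf I σ := by rw [h2]; simp (disch := omega) [conf]
    refine ⟨⟨hconf, fun a ha => ?_⟩, ?_⟩
    · rw [h2' a ha]
      simp (disch := omega)
    · have hinv := h.inv
      rw [← hconf] at hinv
      intro k hk
      have hcnt : ρ.num 4 = ρ.num 0 := le_antisymm h3 hlt
      have hkc : k < ρ.num 0 := hk.trans_le hinv.le_cnt
      obtain ⟨g1, g2, g3, g4⟩ := h4 k hk k (by omega) (hinv.own_base k hk)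
      refine ⟨⟨g1.trans_le h3, g2, fun c hc hck => ?_⟩, g4⟩
      exact (h4 k hk c (lt_of_lt_of_eq hc hcnt.symm) hck).2.2.1


/-- The scanned agents `k`, `l` and item `g`, with strong envy of `k` towards `l`. -/
structure Envy (I : Problem) (σ : State I.m) : Prop where
  ready : Ready I σ
  current : Current I σ
  lt_k : σ.num 1 < I.n
  lt_l : σ.num 2 < I.n
  mem : ∃ g ∈ σ.bundle (σ.num 2), (g : ℕ) = σ.num 3
  lt_val : I.val (σ.num 1) (σ.bundle (σ.num 1)) <
    I.α * I.val (σ.num 1) (σ.bundle (σ.num 2) \ item I.m (σ.num 3))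

theorem discard_spec : Spec discard (fun I σ => Ready I σ ∧ σ.num 2 < I.n)
    (fun I σ τ => conf I τ = (conf I σ).discard I.n (σ.num 2) ∧
      (∀ a < 4, τ.num a = σ.num a) ∧ τ.bundle = σ.bundle) := by
  refine Spec.seq (pre₂ := fun I σ => Ready I σ ∧ σ.num 4 = I.n)
    (post₁ := fun I σ τ => τ = σ.setNum 4 I.n)
    (Spec.loopFree (by simp [LoopFree, assign]) ?_)
    (Spec.loop_loopFree (by simp [LoopFree, incr, skip, assign])
      (inv := fun I σ τ => Ready I σ ∧ I.n ≤ τ.num 4 ∧ τ.num 4 ≤ τ.num 0 ∧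
        (∀ a < 4, τ.num a = σ.num a) ∧ τ.bundle = σ.bundle ∧ τ.arr 1 = σ.arr 1 ∧
        τ.arr 2 = σ.arr 2 ∧ ∀ c, τ.arr 0 c =
          if I.n ≤ c ∧ c < τ.num 4 ∧ σ.arr 1 c = σ.num 2 then I.n else σ.arr 0 c)
      (fun I τ => τ.num 0 - τ.num 4) slotPoly ?_ ?_ ?_) ?_ ?_
  · intro I σ _
    simp
  · intro I σ ⟨h, h4⟩
    have := h.inv.le_cnt
    refine ⟨h, h4.ge, h4.trans_le this, fun _ _ => rfl, rfl, rfl, rfl, fun c => ?_⟩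
    rw [if_neg (by omega)]
  · rintro I σ τ ⟨h1, -, -, h2, -⟩
    have := h1.bound
    have := h2 0 (by omega)
    have := slotBound_le I
    omega
  · rintro I σ τ ⟨h1, hn, h2, h3, h4, h5, h6, h7⟩ hlt
    simp at hlt
    have h32 := h3 2 (by omega)
    by_cases hc : τ.arr 1 (τ.num 4) = τ.num 2
    · simp (disch := omega) [hc]
      refine ⟨⟨h1, by omega, hlt, ?_, h4, h5, h6, fun c => ?_⟩, by omega⟩
      · intro a ha
        rw [← h3 a ha]
        simp (disch := omega)
      · by_cases hcc : c = τ.num 4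
        · subst hcc
          rw [Function.update_self, if_pos ⟨hn, by omega, by rw [← h5, hc, h32]⟩]
        · rw [Function.update_of_ne hcc, h7]
          exact if_congr (by omega) rfl rfl
    · have hc' : ¬ (τ.arr 1 (τ.num 4) ≤ τ.num 2 ∧ τ.num 2 ≤ τ.arr 1 (τ.num 4)) := by omega
      simp (disch := omega) [hc']
      refine ⟨⟨h1, by omega, hlt, ?_, h4, h5, h6, fun c => ?_⟩, by omega⟩
      · intro a ha
        rw [← h3 a ha]
        simp (disch := omega)
      · rw [h7]
        refine if_congr ?_ rfl rfl
        by_cases hcc : c = τ.num 4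
        · subst hcc
          rw [← h5, ← h32]
          simp [hc]
        · omega
  · rintro I σ τ ⟨h, -⟩ rfl
    refine ⟨⟨?_, ?_⟩, by simp⟩
    · simpa (disch := omega) [conf] using h.inv
    · simpa (disch := omega) [conf] using h.bound
  · rintro I σ τ ρ ⟨h, -⟩ rfl ⟨⟨-, hn, h2, h3, h4, h5, h6, h7⟩, hlt⟩
    simp at hlt
    refine ⟨?_, fun a ha => ?_, h4⟩
    · have h30 := h3 0 (by omega)
      simp (disch := omega) at h30 h5 h6 h7
      simp only [conf, Config.discard, Config.mk.injEq]
      refine ⟨h30, ?_, h5, h6, ?_, ?_⟩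
      · funext c
        rw [h7]
        exact if_congr (by omega) rfl rfl
      · exact funext fun c => congrFun h4 _
      · exact funext fun c => congrFun h4 _
    · rw [h3 a ha]
      simp (disch := omega)

theorem denote_trim (I : Problem) (σ : State I.m) :
    conf I (trim.denote I.α I.v σ) =
      (conf I σ).trim (σ.num 2) (σ.bundle (σ.num 2) \ item I.m (σ.num 3)) ∧
    (trim.denote I.α I.v σ).num 0 = σ.num 0 := by
  simp [Program.trim, shrunk, conf, Config.trim]

theorem denote_transfer (I : Problem) (σ : State I.m) (_ : σ.num 2 < I.n)
    (_ : σ.arr 3 (σ.num 2) < σ.num 0) :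
    conf I (transfer.denote I.α I.v σ) =
      (conf I σ).transfer I.n (σ.arr 3 (σ.num 2)) (σ.num 1)
        (σ.bundle (σ.num 2) \ item I.m (σ.num 3)) ∧
    (transfer.denote I.α I.v σ).num 0 = σ.num 0 + 1 := by
  simp (disch := omega) [Program.transfer, shrunk, conf, Config.transfer]

theorem denote_cut (I : Problem) (σ : State I.m) (_ : σ.num 2 < I.n) :
    conf I (cut.denote I.α I.v σ) =
      (conf I σ).cut (σ.num 2) (σ.num 1) (σ.bundle (σ.num 2) \ item I.m (σ.num 3)) ∧
    (cut.denote I.α I.v σ).num 0 = σ.num 0 + 1 := by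
  by_cases h : 1 ≤ σ.arr 2 (σ.num 2)
  · simp (disch := omega) [Program.cut, shrunk, conf, Config.cut, h]
  · simp (disch := omega) [Program.cut, shrunk, conf, Config.cut, h]

theorem holds_keepTest (I : Problem) (σ : State I.m) :
    keepTest.Holds I.α I.v σ ↔
      (conf I σ).Keep (σ.num 2) (σ.bundle (σ.num 2) \ item I.m (σ.num 3)) := by
  have h1 : ∀ a : ℕ, (a ≤ 1 ∧ 1 ≤ a) ↔ a = 1 := fun a => by omega
  simp [keepTest, impTest, shrunk, Config.Keep, conf, -not_and, h1]
  simp only [not_and, not_lt]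

theorem holds_envyTest (I : Problem) (σ : State I.m) :
    envyTest.Holds I.α I.v σ ↔ (∃ g ∈ σ.bundle (σ.num 2), (g : ℕ) = σ.num 3) ∧
      I.val (σ.num 1) (σ.bundle (σ.num 1)) <
        I.α * I.val (σ.num 1) (σ.bundle (σ.num 2) \ item I.m (σ.num 3)) := by
  simp [envyTest, shrunk]


theorem Envy.sdiff_ssubset {I : Problem} {σ : State I.m} (h : Envy I σ) :
    σ.bundle (σ.num 2) \ item I.m (σ.num 3) ⊂ σ.bundle (σ.num 2) := by
  obtain ⟨g, hg, hg3⟩ := h.mem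
  rw [← hg3, item_val]
  exact Finset.sdiff_ssubset (by simpa using hg) (by simp)

/-- By monotonicity an empty rest is worth no more than the envier's own bundle. Nonempty chunks
make the reference bundle shrink strictly at later cuts. -/
theorem Envy.sdiff_nonempty {I : Problem} {σ : State I.m} (h : Envy I σ) :
    (σ.bundle (σ.num 2) \ item I.m (σ.num 3)).Nonempty := by
  rw [Finset.nonempty_iff_ne_empty]
  intro he
  have h1 := h.lt_val
  have h2 := I.val_mono (σ.num 1) (Finset.empty_subset (σ.bundle (σ.num 1)))
  have h3 := I.α_mul_val_le (σ.num 1) ∅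
  rw [he] at h1
  linarith

theorem Envy.base_eq {I : Problem} {σ : State I.m} (h : Envy I σ)
    (hs : ¬ I.n ≤ σ.arr 3 (σ.num 2)) : σ.arr 3 (σ.num 2) = σ.num 2 :=
  (h.ready.inv.own_base _ (not_le.1 hs)).symm.trans (h.current _ h.lt_l).1.own_eq

/-- A move opens at most one slot and lowers the potential by at least 1, so the sum of the two
never grows. -/
theorem Ready.of_conf {I : Problem} {σ τ : State I.m} (h : Ready I σ) {D : Config I.m}
    (hD : conf I τ = D) (hinv : D.Inv I) (hlt : D.potential I.n < (conf I σ).potential I.n)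
    (h0 : τ.num 0 ≤ σ.num 0 + 1) :
    Ready I τ ∧ (conf I τ).potential I.n < (conf I σ).potential I.n := by
  subst hD
  have := h.bound
  exact ⟨⟨hinv, by omega⟩, hlt⟩

/-- Slots below `n` are bases and the others are chunks, so the number of the last slot of `l`
decides between a transfer and a change of the base. -/
theorem resolve_spec : Spec resolve Envy (fun I σ τ =>
    Ready I τ ∧ (conf I τ).potential I.n < (conf I σ).potential I.n) := by
  refine Spec.branch (Spec.loopFree (by simp [LoopFree, Program.transfer, incr]) ?_)
    (Spec.branch (Spec.loopFree (by simp [LoopFree, Program.trim]) ?_)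
      (Spec.branch (Spec.seq (pre₂ := fun I σ => σ.num 2 < I.n) (post₂ := fun I σ τ =>
            conf I τ = (conf I σ).cut (σ.num 2) (σ.num 1)
              (σ.bundle (σ.num 2) \ item I.m (σ.num 3)) ∧ τ.num 0 = σ.num 0 + 1)
          (discard_spec.mono (fun I σ h => ⟨h.1.1.1.ready, h.1.1.1.lt_l⟩) (fun _ _ _ _ h => h))
          (Spec.loopFree (by simp [LoopFree, Program.cut, incr, skip, assign])
            (fun I σ h => denote_cut I σ h)) ?_ ?_)
        (Spec.loopFree (by simp [LoopFree, Program.cut, incr, skip, assign]) ?_)))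
  · rintro I σ ⟨h, hs⟩
    simp at hs
    obtain ⟨htop, hslot⟩ := h.current _ h.lt_l
    obtain ⟨htop', hslot'⟩ := h.current _ h.lt_k
    obtain ⟨h1, h2⟩ := denote_transfer I σ h.lt_l htop.lt
    have hch : σ.arr 3 (σ.num 2) ∈ (conf I σ).chunks I.n :=
      Finset.mem_filter.2 ⟨htop.mem_alive h.lt_l, hs⟩
    have hsub := h.sdiff_ssubset
    nth_rewrite 2 [hslot] at hsub
    refine h.ready.of_conf h1 (h.ready.inv.transfer h.lt_k hch htop' hsub.1 ?_)
      (Config.potential_transfer h.lt_k (htop.mem_alive h.lt_l) hsub) h2.le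
    change I.val _ (σ.slot _ _) < _
    rw [← hslot']
    exact h.lt_val
  · rintro I σ ⟨⟨h, hs⟩, hkeep⟩
    simp at hs
    rw [holds_keepTest] at hkeep
    obtain ⟨htop, hslot⟩ := h.current _ h.lt_l
    rw [h.base_eq (not_le.2 hs)] at htop hslot
    obtain ⟨h1, h2⟩ := denote_trim I σ
    have hsub := h.sdiff_ssubset
    nth_rewrite 2 [hslot] at hsub
    exact h.ready.of_conf h1 (h.ready.inv.trim h.lt_l htop hsub.1 hkeep)
      (h.ready.inv.potential_trim h.lt_l hsub) (h2.le.trans (Nat.le_succ _))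
  · rintro I σ τ ⟨⟨⟨h, -⟩, -⟩, -⟩ ⟨-, h1, -⟩
    rw [h1 2 (by omega)]
    exact h.lt_l
  · rintro I σ τ ρ ⟨⟨⟨h, hs⟩, hkeep⟩, hst⟩ ⟨h1, h2, h3⟩ ⟨h4, h5⟩
    simp at hs hst
    rw [holds_keepTest] at hkeep
    obtain ⟨htop, hslot⟩ := h.current _ h.lt_l
    obtain ⟨htop', hslot'⟩ := h.current _ h.lt_k
    rw [h.base_eq (not_le.2 hs)] at htop hslot
    have hsub := h.sdiff_ssubset
    nth_rewrite 2 [hslot] at hsub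
    -- Discarding changes neither the scanned triple nor the current bundles, so the cut afterwards
    -- uses the same set `S`.
    rw [h1, h2 1 (by omega), h2 2 (by omega), h2 3 (by omega), h3] at h4
    have hlt := h.lt_val
    nth_rewrite 1 [hslot'] at hlt
    have hinv := h.ready.inv.discard_cut h.lt_l h.lt_k htop htop' hsub.1 hlt hkeep hst
    refine h.ready.of_conf h4 hinv (Config.potential_discard_cut h.lt_l h.sdiff_nonempty
      (hsub.1.trans (h.ready.inv.base_subset _ h.lt_l)) hinv) ?_
    rw [h5, h2 0 (by omega)]
  · rintro I σ ⟨⟨⟨h, hs⟩, hkeep⟩, hst⟩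
    simp at hs hst
    rw [holds_keepTest] at hkeep
    obtain ⟨htop, hslot⟩ := h.current _ h.lt_l
    obtain ⟨htop', hslot'⟩ := h.current _ h.lt_k
    rw [h.base_eq (not_le.2 hs)] at htop hslot
    have hsub := h.sdiff_ssubset
    nth_rewrite 2 [hslot] at hsub
    have hlt := h.lt_val
    nth_rewrite 1 [hslot'] at hlt
    obtain ⟨h4, h5⟩ := denote_cut I σ h.lt_l
    have hinv := h.ready.inv.cut h.lt_l h.lt_k htop htop' hsub.1 hlt hkeep hst.not_ge
    exact h.ready.of_conf h4 hinv (Config.potential_cut h.lt_l h.sdiff_nonempty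
      (hsub.1.trans (h.ready.inv.base_subset _ h.lt_l)) hinv) h5.le

/-- No strong envy has been found among the triples of agents and items before the current one. -/
structure Scanning (I : Problem) (σ : State I.m) : Prop where
  ready : Ready I σ
  current : Current I σ
  lt_l : σ.num 1 < I.n → σ.num 2 < I.n
  scanned : ∀ k < I.n, ∀ l < I.n, ∀ g ∈ σ.bundle l,
    k < σ.num 1 ∨ k = σ.num 1 ∧ (l < σ.num 2 ∨ l = σ.num 2 ∧ (g : ℕ) < σ.num 3) →
    I.α * I.val k (σ.bundle l \ {g}) ≤ I.val k (σ.bundle k)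

/-- The termination measure of the shrinking phase. -/
def shrinkMeasure (I : Problem) (σ : State I.m) : ℕ :=
  (((conf I σ).potential I.n * (I.n + 1) + (I.n - σ.num 1)) * (I.n + 1) + (I.n - σ.num 2)) *
    (I.m + 1) + (I.m - σ.num 3)

/-- The triple just tested is the only one that the lexicographic scan adds. -/
theorem advance_step {I : Problem} {σ : State I.m} (h : Scanning I σ) (hk : σ.num 1 < I.n)
    (hno : ¬ envyTest.Holds I.α I.v σ) :
    Scanning I (advance.denote I.α I.v σ) ∧
      shrinkMeasure I (advance.denote I.α I.v σ) < shrinkMeasure I σ := by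
  rw [holds_envyTest] at hno
  have hl := h.lt_l hk
  have hnow : ∀ g ∈ σ.bundle (σ.num 2), (g : ℕ) = σ.num 3 →
      I.α * I.val (σ.num 1) (σ.bundle (σ.num 2) \ {g}) ≤
        I.val (σ.num 1) (σ.bundle (σ.num 1)) := by
    intro g hg hg3
    by_contra hc
    exact hno ⟨⟨g, hg, hg3⟩, by rw [← hg3, item_val]; exact not_le.1 hc⟩
  set ρ := advance.denote I.α I.v σ with hρ
  have hconf : conf I ρ = conf I σ := by
    by_cases h1 : I.m ≤ σ.num 3 + 1 <;> by_cases h2 : I.n ≤ σ.num 2 + 1 <;>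
      simp (disch := omega) [hρ, advance, skip, conf, h1, h2]
  have hb : ρ.bundle = σ.bundle := by
    by_cases h1 : I.m ≤ σ.num 3 + 1 <;> by_cases h2 : I.n ≤ σ.num 2 + 1 <;>
      simp (disch := omega) [hρ, advance, skip, h1, h2]
  have h3 : ρ.arr 3 = σ.arr 3 := by
    by_cases h1 : I.m ≤ σ.num 3 + 1 <;> by_cases h2 : I.n ≤ σ.num 2 + 1 <;>
      simp (disch := omega) [hρ, advance, skip, h1, h2]
  have h0 : ρ.num 0 = σ.num 0 := congrArg Config.cnt hconf
  have hready : Ready I ρ := ⟨hconf ▸ h.ready.inv, by rw [hconf, h0]; exact h.ready.bound⟩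
  have hcurrent : Current I ρ := by
    intro k hk
    have hs : ρ.slot I.n = σ.slot I.n := congrArg Config.slot hconf
    rw [hconf, hb, h3, hs]
    exact h.current k hk
  by_cases h1 : I.m ≤ σ.num 3 + 1
  · by_cases h2 : I.n ≤ σ.num 2 + 1
    · have e1 : ρ.num 1 = σ.num 1 + 1 := by
        simp (disch := omega) [hρ, advance, skip, h1, h2]
      have e2 : ρ.num 2 = 0 := by simp (disch := omega) [hρ, advance, skip, h1, h2]
      have e3 : ρ.num 3 = 0 := by simp (disch := omega) [hρ, advance, skip, h1, h2]
      refine ⟨⟨hready, hcurrent, by omega, ?_⟩, ?_⟩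
      · intro k hk l hl g hg hlt
        rw [hb] at hg ⊢
        rw [e1, e2, e3] at hlt
        by_cases hc : k = σ.num 1 ∧ l = σ.num 2 ∧ (g : ℕ) = σ.num 3
        · obtain ⟨rfl, rfl, hg3⟩ := hc
          exact hnow g hg hg3
        · exact h.scanned k hk l hl g hg (by omega)
      · unfold shrinkMeasure
        rw [hconf]
        exact Problem.mul_succ_add_lt (Problem.mul_succ_add_lt (by omega) (by omega)) (by omega)
    · have e1 : ρ.num 1 = σ.num 1 := by
        simp (disch := omega) [hρ, advance, skip, h1, h2]
      have e2 : ρ.num 2 = σ.num 2 + 1 := by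
        simp (disch := omega) [hρ, advance, skip, h1, h2]
      have e3 : ρ.num 3 = 0 := by simp (disch := omega) [hρ, advance, skip, h1, h2]
      refine ⟨⟨hready, hcurrent, by omega, ?_⟩, ?_⟩
      · intro k hk l hl g hg hlt
        rw [hb] at hg ⊢
        rw [e1, e2, e3] at hlt
        by_cases hc : k = σ.num 1 ∧ l = σ.num 2 ∧ (g : ℕ) = σ.num 3
        · obtain ⟨rfl, rfl, hg3⟩ := hc
          exact hnow g hg hg3
        · exact h.scanned k hk l hl g hg (by omega)
      · unfold shrinkMeasure
        rw [hconf, e1]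
        exact Problem.mul_succ_add_lt (by omega) (by omega)
  · have e1 : ρ.num 1 = σ.num 1 := by simp (disch := omega) [hρ, advance, skip, h1]
    have e2 : ρ.num 2 = σ.num 2 := by simp (disch := omega) [hρ, advance, skip, h1]
    have e3 : ρ.num 3 = σ.num 3 + 1 := by simp (disch := omega) [hρ, advance, skip, h1]
    refine ⟨⟨hready, hcurrent, by omega, ?_⟩, ?_⟩
    · intro k hk l hl g hg hlt
      rw [hb] at hg ⊢
      rw [e1, e2, e3] at hlt
      by_cases hc : k = σ.num 1 ∧ l = σ.num 2 ∧ (g : ℕ) = σ.num 3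
      · obtain ⟨rfl, rfl, hg3⟩ := hc
        exact hnow g hg hg3
      · exact h.scanned k hk l hl g hg (by omega)
    · unfold shrinkMeasure
      rw [hconf, e1, e2]
      omega

theorem restart_spec : Spec restart (fun I σ => Ready I σ ∧ Current I σ) (fun I σ τ =>
    Scanning I τ ∧ conf I τ = conf I σ) := by
  refine Spec.loopFree (by simp [LoopFree, restart, assign]) ?_
  rintro I σ ⟨h, h'⟩
  have hconf : conf I (restart.denote I.α I.v σ) = conf I σ := by
    simp (disch := omega) [restart, conf]
  refine ⟨⟨⟨hconf ▸ h.inv, ?_⟩, ?_, ?_, ?_⟩, hconf⟩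
  · rw [hconf]
    simpa (disch := omega) [restart] using h.bound
  · intro k hk
    rw [hconf]
    simpa (disch := omega) [restart] using h' k hk
  · simp (disch := omega) [restart]
  · intro k hk l hl g hg hlt
    simp (disch := omega) [restart] at hlt

theorem refresh_restart_spec : Spec (.seq refresh restart) Ready (fun I σ τ =>
    Scanning I τ ∧ conf I τ = conf I σ) := by
  refine refresh_spec.seq restart_spec ?_ ?_
  · rintro I σ τ h ⟨⟨h1, h2⟩, h3⟩
    refine ⟨⟨h1 ▸ h.inv, ?_⟩, h3⟩
    rw [h1, h2 0 (by omega)]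
    exact h.bound
  · rintro I σ τ ρ - ⟨⟨h1, -⟩, -⟩ ⟨h2, h3⟩
    exact ⟨h2, h3.trans h1⟩

/-- A polynomial bound for `shrinkMeasure`. -/
noncomputable def shrinkPoly : Polynomial ℕ :=
  ((slotPoly * (.X + 1) + .X) * (.X + 1) + .X) * (.X + 1) + .X

theorem shrinkMeasure_le {I : Problem} {σ : State I.m} (h : Ready I σ) :
    shrinkMeasure I σ ≤ shrinkPoly.eval (I.n + I.m) := by
  have h1 : (conf I σ).potential I.n ≤ slotPoly.eval (I.n + I.m) :=
    ((Nat.le_add_left _ _).trans h.bound).trans (slotBound_le I)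
  simp only [shrinkMeasure, shrinkPoly, Polynomial.eval_add, Polynomial.eval_mul,
    Polynomial.eval_X, Polynomial.eval_one]
  gcongr <;> omega

/-- A resolved envy restarts the scan, but the potential is the leading digit of the measure and its
drop outweighs the restart. -/
theorem shrinkLoop_spec : Spec shrinkLoop Scanning
    (fun I _ τ => Scanning I τ ∧ I.n ≤ τ.num 1) := by
  refine Spec.mono (Spec.loop (inv := fun I _ τ => Scanning I τ) (pre := Scanning) shrinkMeasure
    shrinkPoly (fun I σ h => h) (fun I σ τ h => shrinkMeasure_le h.ready)
    (Spec.branch (Spec.seq (pre₂ := Ready) (resolve_spec.mono ?_ fun _ _ _ _ h => h)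
      refresh_restart_spec ?_ ?_)
      (Spec.loopFree (by simp [LoopFree, advance, incr, assign, skip]) ?_)))
    (fun _ _ h => h) ?_
  · rintro I σ ⟨⟨⟨σ', h⟩, hk⟩, he⟩
    simp at hk
    rw [holds_envyTest] at he
    exact ⟨h.ready, h.current, hk, h.lt_l hk, he.1, he.2⟩
  · exact fun I σ τ _ h => h.1
  · rintro I σ τ ρ - ⟨h1, h2⟩ ⟨h3, h4⟩
    refine ⟨fun _ _ => h3, ?_⟩
    unfold shrinkMeasure
    rw [h4]
    exact Problem.mul_succ_add_lt (Problem.mul_succ_add_lt (Problem.mul_succ_add_lt h2 (by omega))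
      (by omega)) (by omega)
  · rintro I σ ⟨⟨⟨σ', h⟩, hk⟩, he⟩
    simp at hk
    have := advance_step h hk he
    exact ⟨fun _ _ => this.1, this.2⟩
  · rintro I σ τ - ⟨h, hk⟩
    simp at hk
    exact ⟨h, hk⟩

theorem Scanning.sound {I : Problem} {σ : State I.m} (h : Scanning I σ) (hk : I.n ≤ σ.num 1) :
    I.Sound (outputOf I.n σ) where
  isAllocation i j hij := by
    obtain ⟨h1, h2⟩ := h.current i i.2
    obtain ⟨h3, h4⟩ := h.current j j.2
    change Disjoint (σ.bundle i) (σ.bundle j)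
    rw [h2, h4]
    refine h.ready.inv.disjoint _ _ (fun he => hij ?_) (h1.mem_alive i.2) (h3.mem_alive j.2)
    rw [Fin.ext_iff, ← h1.own_eq, he, h3.own_eq]
  isApproxEFX i j g hg := by
    rw [← I.val_fin, ← I.val_fin]
    exact h.scanned i i.2 j j.2 g hg (.inl (i.2.trans_le hk))
  prod_le := by
    have := h.ready.inv.prod_le fun k hk => (h.current k hk).1
    rw [Finset.prod_range, Finset.prod_range] at this
    convert this using 3 with i _ i
    · rw [I.val_fin, I.endowment_fin]
    · rw [I.val_fin]
      exact congrArg _ (h.current i i.2).2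

theorem shrink_spec : Spec shrink (fun I σ => σ = inputState I.X)
    (fun I _ τ => I.Sound (outputOf I.n τ)) := by
  refine setup_spec.seq (refresh_spec.seq (restart_spec.seq shrinkLoop_spec
    (post := fun I σ τ => I.Sound (outputOf I.n τ)) ?_ ?_)
    (post := fun I σ τ => I.Sound (outputOf I.n τ)) ?_ ?_) ?_ ?_
  · exact fun I σ τ _ h => h.1
  · exact fun I σ τ ρ _ _ h => h.1.sound h.2
  · rintro I σ τ h ⟨⟨h1, h2⟩, h3⟩
    refine ⟨⟨h1 ▸ h.inv, ?_⟩, h3⟩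
    rw [h1, h2 0 (by omega)]
    exact h.bound
  · exact fun I σ τ ρ _ _ h => h
  · exact fun I σ τ _ h => h
  · exact fun I σ τ ρ _ _ h => h


/-! ### The program of the completion phase -/

namespace Program

/-- Runs `P` for all values `0, …, n - 1` of variable 4. -/
def scan (P : Program) : Program :=
  .seq (assign 4 (.const 0)) (.loop (.natLT (.reg 4) .agents) (.seq P (incr 4)))

/-- Collects all allocated items. -/
def collect : Program :=
  .seq (.setBundle .agents .empty)
    (scan (.setBundle .agents (.union (.load .agents) (.load (.reg 4)))))

/-- Looks for an agent who prefers the current item to the current bundle. -/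
def findWish : Program :=
  .seq (assign 5 .agents)
    (scan (.branch (.realLE (.value (.reg 4) (.single (.reg 3))) (.value (.reg 4) (.load (.reg 4))))
      skip (assign 5 (.reg 4))))

/-- Clears entry `k` of array 4 before the first agent is checked. -/
def resetEntry : Program :=
  .branch (.natLE (.reg 2) (.const 0)) (.setNat (.arrA 4 (.reg 1)) .agents) skip

/-- Puts agent `l` into entry `k` of array 4 if `l` envies `k`. -/
def checkEntry : Program :=
  .branch (.realLE (.value (.reg 2) (.load (.reg 1))) (.value (.reg 2) (.load (.reg 2))))
    skip (.setNat (.arrA 4 (.reg 1)) (.reg 2))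

/-- Moves on to the next pair of agents. -/
def nextPair : Program :=
  .seq (incr 2)
    (.branch (.natLE .agents (.reg 2)) (.seq (assign 2 (.const 0)) (incr 1)) skip)

/-- Computes for every agent another agent who envies the first one. -/
def findEnvy : Program :=
  .seq (assign 1 (.const 0)) (.seq (assign 2 (.const 0))
    (.loop (.natLT (.reg 1) .agents) (.seq resetEntry (.seq checkEntry nextPair))))

/-- Looks for an agent whom nobody envies. -/
def findSource : Program :=
  .seq (assign 5 .agents)
    (scan (.branch (.natLE .agents (.get 4 (.reg 4))) (assign 5 (.reg 4)) skip))

/-- Walks along the envy graph until an envy cycle is reached. -/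
def walk : Program :=
  .seq (assign 6 (.const 0)) (scan (assign 6 (.get 4 (.reg 6))))

/-- Moves the bundles along an envy cycle. -/
def rotate : Program :=
  .seq (assign 7 (.get 4 (.reg 6)))
    (.loop (.not (.and (.natLE (.reg 7) (.reg 6)) (.natLE (.reg 6) (.reg 7))))
      (.seq (.setBundle .agents (.load (.reg 6)))
        (.seq (.setBundle (.reg 6) (.load (.reg 7)))
          (.seq (.setBundle (.reg 7) (.load .agents)) (assign 7 (.get 4 (.reg 7)))))))

/-- Allocates the current item, or increases the values of some agents. -/
def improve : Program :=
  .seq findWish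
    (.branch (.natLT (.reg 5) .agents)
      (.seq (.setBundle (.reg 5) (.single (.reg 3))) (assign 3 (.const 0)))
      (.seq findEnvy (.seq findSource
        (.branch (.natLT (.reg 5) .agents)
          (.setBundle (.reg 5) (.union (.load (.reg 5)) (.single (.reg 3))))
          (.seq walk rotate)))))

/-- The completion phase. -/
def complete : Program :=
  .seq (assign 3 (.const 0))
    (.loop (.natLT (.reg 3) .items)
      (.seq collect (.branch (.mem (.reg 3) (.load .agents)) (incr 3) improve)))

end Program

/-! ### Correctness and running time of the completion program -/

open Program

theorem Spec.scan {P : Program} (hP : P.LoopFree)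
    {inv : ∀ I : Problem, State I.m → ℕ → State I.m → Prop}
    {pre : ∀ I : Problem, State I.m → Prop} (hinit : ∀ I σ, pre I σ → inv I σ 0 (σ.setNum 4 0))
    (hstep : ∀ I σ τ, inv I σ (τ.num 4) τ → τ.num 4 < I.n →
      (P.denote I.α I.v τ).num 4 = τ.num 4 ∧
        inv I σ (τ.num 4 + 1) ((P.denote I.α I.v τ).setNum 4 (τ.num 4 + 1))) :
    Spec (scan P) pre (fun I σ τ => inv I σ I.n τ) := by
  refine Spec.seq (pre₂ := fun I τ => ∃ σ, τ = σ.setNum 4 0 ∧ inv I σ 0 τ)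
    (post₁ := fun I σ τ => τ = σ.setNum 4 0) (Spec.loopFree (by simp [LoopFree, assign]) ?_)
    (Spec.loop_loopFree (by simp [LoopFree, incr, hP])
      -- The loop starts after variable 4 has been reset and cannot refer to the state before. The
      -- invariant is therefore kept for every earlier state `ρ` that fits, of which there is at
      -- least one.
      (inv := fun I σ τ => τ.num 4 ≤ I.n ∧ (∃ ρ, inv I ρ 0 σ) ∧ ∀ ρ, inv I ρ 0 σ → inv I ρ (τ.num 4) τ)
      (fun I τ => I.n - τ.num 4) .X ?_ ?_ ?_) ?_ ?_
  · intro I σ _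
    simp
  · rintro I σ ⟨ρ, rfl, h⟩
    exact ⟨by simp, ⟨ρ, h⟩, fun ρ' h' => by simpa using h'⟩
  · intro I σ τ _
    simp
    omega
  · rintro I σ τ ⟨h1, ⟨ρ, hρ⟩, h2⟩ hlt
    simp at hlt
    have h3 := (hstep I ρ τ (h2 ρ hρ) hlt).1
    simp only [denote_seq, denote_incr, State.num_setNum, h3]
    exact ⟨⟨hlt, ⟨ρ, hρ⟩, fun ρ' hρ' => (hstep I ρ' τ (h2 ρ' hρ') hlt).2⟩, by omega⟩
  · rintro I σ τ h rfl
    exact ⟨σ, rfl, hinit I σ h⟩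
  · rintro I σ τ ρ h rfl ⟨⟨h1, -, h2⟩, h3⟩
    simp at h3
    have := h2 σ (hinit I σ h)
    rwa [le_antisymm h1 h3] at this

/-- The invariant of the completion phase. -/
structure Completing (I : Problem) (σ : State I.m) : Prop where
  sound : I.Sound (outputOf I.n σ)
  allocated : ∀ g : Fin I.m, (g : ℕ) < σ.num 3 → ∃ i, g ∈ outputOf I.n σ i

/-- The termination measure of the completion phase. -/
noncomputable def completeMeasure (I : Problem) (σ : State I.m) : ℕ :=
  I.rank (outputOf I.n σ) * (I.m + 1) + (I.m - σ.num 3)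

/-- The current bundles and the current item agree. -/
structure SameHold (I : Problem) (σ τ : State I.m) : Prop where
  bundle_eq : ∀ k < I.n, τ.bundle k = σ.bundle k
  num_eq : τ.num 3 = σ.num 3

theorem SameHold.outputOf_eq {I : Problem} {σ τ : State I.m} (h : SameHold I σ τ) :
    outputOf I.n τ = outputOf I.n σ :=
  funext fun i => h.bundle_eq i i.2

theorem SameHold.completing {I : Problem} {σ τ : State I.m} (h : SameHold I σ τ)
    (hσ : Completing I σ) : Completing I τ := by
  refine ⟨?_, ?_⟩ <;> rw [h.outputOf_eq]
  · exact hσ.sound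
  · rw [h.num_eq]; exact hσ.allocated

theorem SameHold.measure_eq {I : Problem} {σ τ : State I.m} (h : SameHold I σ τ) :
    completeMeasure I τ = completeMeasure I σ := by
  rw [completeMeasure, h.outputOf_eq, h.num_eq, completeMeasure]

/-- The invariant is kept, and the measure decreases. -/
def Progress (I : Problem) (σ τ : State I.m) : Prop :=
  Completing I τ ∧ completeMeasure I τ < completeMeasure I σ

/-- Searching changes neither the holdings nor the current item, hence not the measure; only the
last piece has to make progress. -/
theorem Spec.seq_progress {P Q : Program} {pre pre₂ : ∀ I : Problem, State I.m → Prop}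
    (hP : Spec P pre fun I σ τ => SameHold I σ τ ∧ pre₂ I τ) (hQ : Spec Q pre₂ Progress) :
    Spec (.seq P Q) pre Progress :=
  hP.seq hQ (fun _ _ _ _ h => h.2) fun _ _ _ _ _ h h' => ⟨h'.1, h.1.measure_eq ▸ h'.2⟩

/-- The current item is not allocated. -/
structure Pending (I : Problem) (σ : State I.m) : Prop extends Completing I σ where
  exists_item : ∃ g : Fin I.m, (g : ℕ) = σ.num 3 ∧ ∀ i, g ∉ outputOf I.n σ i

theorem SameHold.pending {I : Problem} {σ τ : State I.m} (h : SameHold I σ τ)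
    (hσ : Pending I σ) : Pending I τ := by
  refine ⟨h.completing hσ.toCompleting, ?_⟩
  rw [h.outputOf_eq, h.num_eq]
  exact hσ.exists_item

/-- No agent prefers the current item to the current bundle. -/
def NoWish (I : Problem) (σ : State I.m) : Prop :=
  ∀ i < I.n, I.val i (item I.m (σ.num 3)) ≤ I.val i (σ.bundle i)

theorem SameHold.noWish {I : Problem} {σ τ : State I.m} (h : SameHold I σ τ)
    (hσ : NoWish I σ) : NoWish I τ := by
  intro i hi
  rw [h.num_eq, h.bundle_eq i hi]
  exact hσ i hi

/-- Entry `a` says who among the agents before `b` envies agent `j`, if there is anybody. -/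
def EnvyEntry (I : Problem) (σ : State I.m) (j b a : ℕ) : Prop :=
  (a = I.n ∧ ∀ i < b, I.val i (σ.bundle j) ≤ I.val i (σ.bundle i)) ∨
    (a < I.n ∧ I.val a (σ.bundle a) < I.val a (σ.bundle j))

theorem collect_spec : Spec collect Completing (fun I σ τ => SameHold I σ τ ∧ Completing I τ ∧
    ∀ g, g ∈ τ.bundle I.n ↔ ∃ i, g ∈ outputOf I.n τ i) := by
  refine Spec.mono (Spec.seq (pre := fun _ _ => True)
    (pre₂ := fun I τ => τ.bundle I.n = ∅)
    (Spec.loopFree (post := fun I σ τ => τ = σ.setBundle I.n ∅) (by simp [LoopFree]) ?_)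
    (Spec.scan (by simp [LoopFree]) (inv := fun I σ c τ => SameHold I σ τ ∧
      ∀ g, g ∈ τ.bundle I.n ↔ ∃ i < c, g ∈ σ.bundle i) ?_ ?_)
    (post := fun I σ τ => SameHold I σ τ ∧ ∀ g, g ∈ τ.bundle I.n ↔ ∃ i < I.n, g ∈ σ.bundle i)
    ?_ ?_) (fun _ _ _ => trivial) ?_
  · intro I σ _
    simp
  · intro I σ h
    refine ⟨⟨fun k hk => rfl, by simp⟩, fun g => ?_⟩
    simp [h]
  · rintro I σ τ ⟨⟨h1, h2⟩, h3⟩ hlt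
    refine ⟨by simp, ⟨fun k hk => ?_, ?_⟩, fun g => ?_⟩
    · simpa (disch := omega) using h1 k hk
    · simpa using h2
    · simp only [denote_setBundle, NatExp.eval_agents, BundleExp.eval_union, BundleExp.eval_load,
        NatExp.eval_reg, State.bundle_setNum, State.bundle_setBundle, Finset.mem_union, h3,
        h1 _ hlt, Nat.lt_succ_iff_lt_or_eq]
      constructor
      · rintro (⟨i, hi, hg⟩ | hg)
        exacts [⟨i, .inl hi, hg⟩, ⟨_, .inr rfl, hg⟩]
      · rintro ⟨i, hi | rfl, hg⟩
        exacts [.inl ⟨i, hi, hg⟩, .inr hg]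
  · rintro I σ τ - rfl
    simp
  · rintro I σ τ ρ - rfl ⟨⟨h1, h2⟩, h3⟩
    have hb : ∀ k < I.n, (σ.setBundle I.n ∅).bundle k = σ.bundle k := fun k hk => by
      simp (disch := omega)
    refine ⟨⟨fun k hk => (h1 k hk).trans (hb k hk), h2⟩, fun g => ?_⟩
    rw [h3]
    exact exists_congr fun i => and_congr_right fun hi => by rw [hb i hi]
  · rintro I σ τ h ⟨h1, h2⟩
    refine ⟨h1, h1.completing h, fun g => ?_⟩
    rw [h2, h1.outputOf_eq]
    exact ⟨fun ⟨i, hi, hg⟩ => ⟨⟨i, hi⟩, hg⟩, fun ⟨i, hg⟩ => ⟨i, i.2, hg⟩⟩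

theorem findWish_spec : Spec findWish Pending (fun I σ τ => SameHold I σ τ ∧ Pending I τ ∧
    (τ.num 5 < I.n → I.val (τ.num 5) (τ.bundle (τ.num 5)) <
      I.val (τ.num 5) (item I.m (τ.num 3))) ∧ (I.n ≤ τ.num 5 → NoWish I τ)) := by
  refine Spec.mono (Spec.seq (pre := fun _ _ => True)
    (pre₂ := fun I τ => τ.num 5 = I.n)
    (Spec.loopFree (post := fun I σ τ => τ = σ.setNum 5 I.n) (by simp [LoopFree, assign]) ?_)
    (Spec.scan (by simp [LoopFree, skip, assign]) (inv := fun I σ c τ => SameHold I σ τ ∧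
      (τ.num 5 < I.n → I.val (τ.num 5) (τ.bundle (τ.num 5)) <
        I.val (τ.num 5) (item I.m (τ.num 3))) ∧
      (I.n ≤ τ.num 5 → ∀ i < c, I.val i (item I.m (τ.num 3)) ≤ I.val i (τ.bundle i))) ?_ ?_)
    (post := fun I σ τ => SameHold I σ τ ∧ (τ.num 5 < I.n →
      I.val (τ.num 5) (τ.bundle (τ.num 5)) < I.val (τ.num 5) (item I.m (τ.num 3))) ∧
      (I.n ≤ τ.num 5 → NoWish I τ))
    ?_ ?_) (fun _ _ _ => trivial) ?_
  · intro I σ _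
    simp
  · intro I σ h
    refine ⟨⟨fun k hk => rfl, by simp⟩, ?_, ?_⟩
    · simp [h]
    · simp
  · rintro I σ τ ⟨⟨h1, h2⟩, h3, h4⟩ hlt
    by_cases hc : I.val (τ.num 4) (item I.m (τ.num 3)) ≤ I.val (τ.num 4) (τ.bundle (τ.num 4))
    · refine ⟨by simp [hc], ⟨fun k hk => ?_, ?_⟩, ?_, ?_⟩
      · simpa [hc] using h1 k hk
      · simpa [hc] using h2
      · simpa [hc] using h3
      · simp only [denote_branch, Test.holds_realLE, RealExp.eval_value, NatExp.eval_reg,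
          BundleExp.eval_single, BundleExp.eval_load, hc, if_true, denote_skip]
        simp (disch := omega)
        intro h5 i hi
        rcases hi.lt_or_eq with hi | rfl
        exacts [h4 h5 i hi, hc]
    · refine ⟨by simp [hc], ⟨fun k hk => ?_, ?_⟩, ?_, ?_⟩
      · simpa [hc] using h1 k hk
      · simpa [hc] using h2
      · simpa [hc] using fun _ => not_le.1 hc
      · simp [hc, hlt]
  · rintro I σ τ - rfl
    simp
  · rintro I σ τ ρ - rfl ⟨⟨h1, h2⟩, h3⟩
    exact ⟨⟨h1, h2⟩, h3⟩
  · rintro I σ τ h ⟨h1, h2⟩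
    exact ⟨h1, h1.pending h, h2⟩


theorem EnvyEntry.extend {I : Problem} {σ : State I.m} {j b a : ℕ} (h : EnvyEntry I σ j b a)
    (hb : I.val b (σ.bundle j) ≤ I.val b (σ.bundle b)) : EnvyEntry I σ j (b + 1) a := by
  rcases h with ⟨h1, h2⟩ | h
  · refine .inl ⟨h1, fun i hi => ?_⟩
    rcases Nat.lt_succ_iff_lt_or_eq.1 hi with hi | rfl
    exacts [h2 i hi, hb]
  · exact .inr h

theorem denote_resetEntry (I : Problem) (σ : State I.m) :
    ∃ a, (resetEntry.denote I.α I.v σ).arr 4 = Function.update (σ.arr 4) (σ.num 1) a ∧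
      (σ.num 2 = 0 → a = I.n) ∧ (0 < σ.num 2 → a = σ.arr 4 (σ.num 1)) ∧
      (resetEntry.denote I.α I.v σ).bundle = σ.bundle ∧
      ∀ b < 4, (resetEntry.denote I.α I.v σ).num b = σ.num b := by
  by_cases h : σ.num 2 = 0
  · refine ⟨I.n, ?_, fun _ => rfl, by omega, ?_, fun b hb => ?_⟩ <;>
      simp (disch := omega) [resetEntry, h]
  · refine ⟨σ.arr 4 (σ.num 1), ?_, by omega, fun _ => rfl, ?_, fun b hb => ?_⟩ <;>
      simp (disch := omega) [resetEntry, skip, h]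

theorem denote_checkEntry (I : Problem) (σ : State I.m) :
    ∃ a, (checkEntry.denote I.α I.v σ).arr 4 = Function.update (σ.arr 4) (σ.num 1) a ∧
      (I.val (σ.num 2) (σ.bundle (σ.num 1)) ≤ I.val (σ.num 2) (σ.bundle (σ.num 2)) →
        a = σ.arr 4 (σ.num 1)) ∧
      (¬ I.val (σ.num 2) (σ.bundle (σ.num 1)) ≤ I.val (σ.num 2) (σ.bundle (σ.num 2)) →
        a = σ.num 2) ∧
      (checkEntry.denote I.α I.v σ).bundle = σ.bundle ∧
      ∀ b < 4, (checkEntry.denote I.α I.v σ).num b = σ.num b := by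
  by_cases h : I.val (σ.num 2) (σ.bundle (σ.num 1)) ≤ I.val (σ.num 2) (σ.bundle (σ.num 2))
  · refine ⟨σ.arr 4 (σ.num 1), ?_, fun _ => rfl, fun h' => absurd h h', ?_, fun b hb => ?_⟩ <;>
      simp (disch := omega) [checkEntry, skip, h]
  · refine ⟨σ.num 2, ?_, fun h' => absurd h' h, fun _ => rfl, ?_, fun b hb => ?_⟩ <;>
      simp (disch := omega) [checkEntry, h]

theorem denote_nextPair (I : Problem) (σ : State I.m) :
    (nextPair.denote I.α I.v σ).bundle = σ.bundle ∧
      (nextPair.denote I.α I.v σ).arr 4 = σ.arr 4 ∧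
      (nextPair.denote I.α I.v σ).num 3 = σ.num 3 ∧
      (I.n ≤ σ.num 2 + 1 → (nextPair.denote I.α I.v σ).num 1 = σ.num 1 + 1 ∧
        (nextPair.denote I.α I.v σ).num 2 = 0) ∧
      (σ.num 2 + 1 < I.n → (nextPair.denote I.α I.v σ).num 1 = σ.num 1 ∧
        (nextPair.denote I.α I.v σ).num 2 = σ.num 2 + 1) := by
  by_cases h : I.n ≤ σ.num 2 + 1
  · refine ⟨?_, ?_, ?_, fun _ => ⟨?_, ?_⟩, fun h' => by omega⟩ <;>
      simp (disch := omega) [nextPair, h]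
  · refine ⟨?_, ?_, ?_, fun h' => by omega, fun h' => ⟨?_, ?_⟩⟩ <;>
      simp (disch := omega) [nextPair, skip, h]

theorem findEnvy_spec : Spec findEnvy (fun I σ => Pending I σ ∧ NoWish I σ) (fun I σ τ =>
    SameHold I σ τ ∧ (Pending I τ ∧ NoWish I τ) ∧
      ∀ j < I.n, EnvyEntry I τ j I.n (τ.arr 4 j)) := by
  refine Spec.mono (Spec.seq (pre := fun _ _ => True) (pre₂ := fun I σ => σ.num 1 = 0)
    (Spec.loopFree (post := fun I σ τ => τ = σ.setNum 1 0) (by simp [LoopFree, assign]) ?_)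
    (Spec.seq (pre₂ := fun I τ => τ.num 1 = 0 ∧ τ.num 2 = 0)
      (post₁ := fun I σ τ => τ = σ.setNum 2 0)
      (post := fun I σ τ => SameHold I σ τ ∧
        ∀ j < I.n, EnvyEntry I τ j I.n (τ.arr 4 j))
      (Spec.loopFree (by simp [LoopFree, assign]) ?_)
      (Spec.loop_loopFree
        (by simp [LoopFree, resetEntry, checkEntry, nextPair, incr, skip, assign])
        (inv := fun I σ τ => τ.bundle = σ.bundle ∧ τ.num 3 = σ.num 3 ∧
          (τ.num 1 < I.n → τ.num 2 < I.n) ∧ τ.num 1 ≤ I.n ∧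
          (∀ j < τ.num 1, EnvyEntry I σ j I.n (τ.arr 4 j)) ∧
          -- Before agent 0 is checked the entry may be left over from an earlier search, so nothing
          -- is claimed about it.
          (0 < τ.num 2 → EnvyEntry I σ (τ.num 1) (τ.num 2) (τ.arr 4 (τ.num 1))))
        (fun I τ => (I.n - τ.num 1) * (I.n + 1) + (I.n - τ.num 2)) (.X * (.X + 1) + .X)
        ?_ ?_ ?_) ?_ ?_)
    (post := fun I σ τ => SameHold I σ τ ∧ ∀ j < I.n, EnvyEntry I τ j I.n (τ.arr 4 j))
    ?_ ?_) (fun _ _ _ => trivial) ?_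
  · intro I σ _
    simp
  · intro I σ _
    simp (disch := omega)
  · rintro I σ ⟨h1, h2⟩
    have := I.n_pos
    exact ⟨rfl, rfl, fun h => by omega, by omega, fun j hj => by omega,
      fun h => by omega⟩
  · intro I σ τ _
    simp only [Polynomial.eval_add, Polynomial.eval_mul, Polynomial.eval_X, Polynomial.eval_one]
    gcongr <;> omega
  · rintro I σ τ ⟨h1, h2, h3, h4, h5, h6⟩ hlt
    simp at hlt
    have hl := h3 hlt
    simp only [denote_seq]
    obtain ⟨a, a1, a2, a3, a4, a5⟩ := denote_resetEntry I τ
    set τ₁ := resetEntry.denote I.α I.v τ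
    obtain ⟨e, e1, e2, e3, e4, e5⟩ := denote_checkEntry I τ₁
    set τ₂ := checkEntry.denote I.α I.v τ₁
    obtain ⟨g1, g2, g3, g4, g5⟩ := denote_nextPair I τ₂
    set ρ := nextPair.denote I.α I.v τ₂
    rw [a5 1 (by omega), a5 2 (by omega), a4, h1] at e2 e3
    rw [a1, Function.update_self] at e2
    rw [a1, a5 1 (by omega), Function.update_idem] at e1
    rw [e5 1 (by omega), e5 2 (by omega), a5 1 (by omega), a5 2 (by omega)] at g4 g5
    have ha : EnvyEntry I σ (τ.num 1) (τ.num 2) a := by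
      rcases Nat.eq_zero_or_pos (τ.num 2) with h0 | h0
      · exact .inl ⟨a2 h0, by omega⟩
      · exact a3 h0 ▸ h6 h0
    have he : EnvyEntry I σ (τ.num 1) (τ.num 2 + 1) e := by
      by_cases hc : I.val (τ.num 2) (σ.bundle (τ.num 1)) ≤ I.val (τ.num 2) (σ.bundle (τ.num 2))
      · exact e2 hc ▸ ha.extend hc
      · rw [e3 hc]
        exact .inr ⟨hl, not_le.1 hc⟩
    have hold : ∀ j < τ.num 1, EnvyEntry I σ j I.n (ρ.arr 4 j) := fun j hj => by
      rw [g2, e1, Function.update_of_ne hj.ne]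
      exact h5 j hj
    have hnew : ρ.arr 4 (τ.num 1) = e := by rw [g2, e1, Function.update_self]
    refine ⟨⟨g1.trans (e4.trans (a4.trans h1)),
      g3.trans ((e5 3 (by omega)).trans ((a5 3 (by omega)).trans h2)), ?_⟩, ?_⟩
    · by_cases hc : I.n ≤ τ.num 2 + 1
      · obtain ⟨k1, k2⟩ := g4 hc
        refine ⟨by omega, by omega, fun j hj => ?_, by omega⟩
        rw [k1] at hj
        rcases Nat.lt_succ_iff_lt_or_eq.1 hj with hj | rfl
        · exact hold j hj
        · rw [hnew]
          exact le_antisymm hc hl ▸ he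
      · obtain ⟨k1, k2⟩ := g5 (not_le.1 hc)
        refine ⟨by omega, by omega, fun j hj => hold j (by omega), fun _ => ?_⟩
        rw [k1, k2, hnew]
        exact he
    · by_cases hc : I.n ≤ τ.num 2 + 1
      · obtain ⟨k1, k2⟩ := g4 hc
        rw [k1, k2]
        exact Problem.mul_succ_add_lt (by omega) (by omega)
      · obtain ⟨k1, k2⟩ := g5 (not_le.1 hc)
        rw [k1, k2]
        omega
  · rintro I σ τ h rfl
    exact ⟨by simpa (disch := omega) using h, by simp⟩
  · rintro I σ τ ρ - rfl ⟨⟨h1, h2, -, h3, h4, -⟩, hlt⟩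
    simp at hlt
    refine ⟨⟨fun k _ => congrFun h1 k, ?_⟩, fun j hj => ?_⟩
    · simpa using h2
    · have := h4 j (by omega)
      unfold EnvyEntry at this ⊢
      rwa [h1]
  · rintro I σ τ - rfl
    simp
  · rintro I σ τ ρ - rfl ⟨⟨h1, h2⟩, h3⟩
    exact ⟨⟨h1, h2⟩, h3⟩
  · rintro I σ τ ⟨h, hw⟩ ⟨h1, h2⟩
    exact ⟨h1, ⟨h1.pending h, h1.noWish hw⟩, h2⟩

theorem findSource_spec : Spec findSource
    (fun I σ => (Pending I σ ∧ NoWish I σ) ∧ ∀ j < I.n, EnvyEntry I σ j I.n (σ.arr 4 j))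
    (fun I σ τ => SameHold I σ τ ∧ (Pending I τ ∧ NoWish I τ) ∧
      (τ.num 5 < I.n → ∀ i < I.n, I.val i (τ.bundle (τ.num 5)) ≤ I.val i (τ.bundle i)) ∧
      (I.n ≤ τ.num 5 → ∀ j < I.n, τ.arr 4 j < I.n ∧
        I.val (τ.arr 4 j) (τ.bundle (τ.arr 4 j)) < I.val (τ.arr 4 j) (τ.bundle j))) := by
  refine Spec.mono (Spec.seq (pre := fun _ _ => True)
    (pre₂ := fun I τ => τ.num 5 = I.n)
    (Spec.loopFree (post := fun I σ τ => τ = σ.setNum 5 I.n) (by simp [LoopFree, assign]) ?_)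
    (Spec.scan (by simp [LoopFree, skip, assign]) (inv := fun I σ c τ => SameHold I σ τ ∧
      τ.arr 4 = σ.arr 4 ∧ (τ.num 5 < I.n → I.n ≤ σ.arr 4 (τ.num 5)) ∧
      (I.n ≤ τ.num 5 → ∀ i < c, σ.arr 4 i < I.n)) ?_ ?_)
    (post := fun I σ τ => SameHold I σ τ ∧ τ.arr 4 = σ.arr 4 ∧
      (τ.num 5 < I.n → I.n ≤ σ.arr 4 (τ.num 5)) ∧
      (I.n ≤ τ.num 5 → ∀ i < I.n, σ.arr 4 i < I.n))
    ?_ ?_) (fun _ _ _ => trivial) ?_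
  · intro I σ _
    simp
  · intro I σ h
    refine ⟨⟨fun k hk => rfl, by simp⟩, ?_, ?_, ?_⟩
    · simp
    · simp [h]
    · simp
  · rintro I σ τ ⟨⟨h1, h2⟩, h3, h4, h5⟩ hlt
    by_cases hc : I.n ≤ τ.arr 4 (τ.num 4)
    · refine ⟨by simp [hc], ⟨fun k hk => ?_, ?_⟩, ?_, ?_, ?_⟩
      · simpa [hc] using h1 k hk
      · simpa [hc] using h2
      · simpa [hc] using h3
      · simp [← h3, hc]
      · simp [hc, hlt]
    · refine ⟨by simp [hc], ⟨fun k hk => ?_, ?_⟩, ?_, ?_, ?_⟩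
      · simpa [hc] using h1 k hk
      · simpa [hc] using h2
      · simpa [hc] using h3
      · simpa [hc] using h4
      · simp only [denote_branch, Test.holds_natLE, NatExp.eval_agents, NatExp.eval_get,
          NatExp.eval_reg, hc, if_false, denote_skip]
        simp (disch := omega)
        intro h6 i hi
        rcases hi.lt_or_eq with hi | rfl
        exacts [h5 h6 i hi, by rw [← h3]; exact not_le.1 hc]
  · rintro I σ τ - rfl
    simp
  · rintro I σ τ ρ - rfl ⟨⟨h1, h2⟩, h3, h4, h5⟩
    refine ⟨⟨h1, h2⟩, ?_, ?_, ?_⟩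
    · simpa using h3
    · simpa using h4
    · simpa using h5
  · rintro I σ τ ⟨⟨h, hw⟩, he⟩ ⟨h1, h2, h3, h4⟩
    refine ⟨h1, ⟨h1.pending h, h1.noWish hw⟩, ?_, ?_⟩
    · intro h5 i hi
      rw [h1.bundle_eq _ h5, h1.bundle_eq _ hi]
      rcases he _ h5 with h6 | h6
      · exact h6.2 i hi
      · exact absurd h6.1 (not_lt.2 (h3 h5))
    · intro h5 j hj
      have h6 := h4 h5 j hj
      rw [h2, h1.bundle_eq _ h6, h1.bundle_eq _ hj]
      rcases he _ hj with h7 | h7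
      · omega
      · exact h7

/-- Everybody is envied, by the agents in array 4. -/
structure Cyclic (I : Problem) (σ : State I.m) : Prop extends Pending I σ where
  lt : ∀ j < I.n, σ.arr 4 j < I.n
  lt_val : ∀ j < I.n,
    I.val (σ.arr 4 j) (σ.bundle (σ.arr 4 j)) < I.val (σ.arr 4 j) (σ.bundle j)

theorem Cyclic.congr {I : Problem} {σ τ : State I.m} (hσ : Cyclic I σ) (h : SameHold I σ τ)
    (harr : τ.arr 4 = σ.arr 4) : Cyclic I τ := by
  refine ⟨h.pending hσ.toPending, ?_, ?_⟩
  · rw [harr]; exact hσ.lt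
  · intro j hj
    rw [harr, h.bundle_eq _ (hσ.lt j hj), h.bundle_eq _ hj]
    exact hσ.lt_val j hj

theorem walk_spec : Spec walk Cyclic (fun I σ τ => SameHold I σ τ ∧ Cyclic I τ ∧
    τ.num 6 = (τ.arr 4)^[I.n] 0) := by
  refine Spec.mono (Spec.seq (pre := fun _ _ => True)
    (pre₂ := fun I τ => τ.num 6 = 0)
    (Spec.loopFree (post := fun I σ τ => τ = σ.setNum 6 0) (by simp [LoopFree, assign]) ?_)
    (Spec.scan (by simp [LoopFree, assign]) (inv := fun I σ c τ => SameHold I σ τ ∧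
      τ.arr 4 = σ.arr 4 ∧ τ.num 6 = (τ.arr 4)^[c] 0) ?_ ?_)
    (post := fun I σ τ => SameHold I σ τ ∧ τ.arr 4 = σ.arr 4 ∧ τ.num 6 = (τ.arr 4)^[I.n] 0)
    ?_ ?_) (fun _ _ _ => trivial) ?_
  · intro I σ _
    simp
  · intro I σ h
    refine ⟨⟨fun k hk => rfl, by simp⟩, ?_, ?_⟩
    · simp
    · simp [h]
  · rintro I σ τ ⟨⟨h1, h2⟩, h3, h4⟩ hlt
    refine ⟨by simp, ⟨fun k hk => ?_, ?_⟩, ?_, ?_⟩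
    · simpa using h1 k hk
    · simpa using h2
    · simpa using h3
    · simp (disch := omega) only [denote_assign, State.num_setNum, State.num_setNum_ne,
        State.arr_setNum, NatExp.eval_get, NatExp.eval_reg, Function.iterate_succ_apply', h4]
  · rintro I σ τ - rfl
    simp
  · rintro I σ τ ρ - rfl ⟨⟨h1, h2⟩, h3, h4⟩
    exact ⟨⟨h1, h2⟩, by simpa using h3, h4⟩
  · rintro I σ τ h ⟨h1, h2, h3⟩
    exact ⟨h1, h.congr h1 h2, h3⟩

/-- The number of steps of `f` from `j` to `x`. -/
noncomputable def hitTime (f : ℕ → ℕ) (x j : ℕ) : ℕ := sInf {s | f^[s] j = x}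

/-- A termination measure has to be a function of the memory, and the step count `t` of `Rotating`
is not stored. The hitting time takes its place; the hypothesis `h` rules out the infimum of the
empty set. -/
theorem hitTime_apply_lt {f : ℕ → ℕ} {x j s : ℕ} (h : f^[s] j = x) (hj : j ≠ x) :
    hitTime f x (f j) < hitTime f x j := by
  have hmem : f^[hitTime f x j] j = x := Nat.sInf_mem (s := {s | f^[s] j = x}) ⟨s, h⟩
  obtain ⟨d, hd⟩ : ∃ d, hitTime f x j = d + 1 :=
    Nat.exists_eq_succ_of_ne_zero fun h0 => hj (by rw [h0] at hmem; exact hmem)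
  rw [hd] at hmem ⊢
  exact Nat.lt_succ_of_le (Nat.sInf_le (s := {s | f^[s] (f j) = x}) hmem)

theorem Rotating.iterate_eq {I : Problem} {f : ℕ → ℕ} {x j t : ℕ} {H K : ℕ → Finset (Fin I.m)}
    (h : Rotating I f x H K j t) : f^[Function.minimalPeriod f x - (t + 1)] j = x := by
  have := h.lt_period
  rw [h.eq_iterate, ← Function.iterate_add_apply, Nat.sub_add_cancel (by omega)]
  exact Function.isPeriodicPt_minimalPeriod f x

/-- Only the agents' cells matter, so the scratch cell `n` used for swapping may change. -/
theorem Rotating.congr {I : Problem} {f : ℕ → ℕ} {x j t : ℕ} {H K K' : ℕ → Finset (Fin I.m)}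
    (h : Rotating I f x H K j t) (hf : ∀ j < I.n, f j < I.n) (hx : x < I.n)
    (hK : ∀ i < I.n, K' i = K i) : Rotating I f x H K' j t where
  lt_period := h.lt_period
  eq_iterate := h.eq_iterate
  exists_perm := h.exists_perm.imp fun _ hπ i => (hK i i.2).trans (hπ i)
  le_val i hi hix := by rw [hK i hi]; exact h.le_val i hi hix
  hand := (hK x hx).trans h.hand
  rest s hs hsp := (hK _ (iterate_lt hf hx s)).trans (h.rest s hs hsp)

theorem rotate_spec : Spec rotate (fun I σ => Cyclic I σ ∧ σ.num 6 = (σ.arr 4)^[I.n] 0)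
    Progress := by
  have hloop := Spec.loop_loopFree
    (c := .not (.and (.natLE (.reg 7) (.reg 6)) (.natLE (.reg 6) (.reg 7))))
    (P := .seq (.setBundle .agents (.load (.reg 6)))
        (.seq (.setBundle (.reg 6) (.load (.reg 7)))
          (.seq (.setBundle (.reg 7) (.load .agents)) (assign 7 (.get 4 (.reg 7))))))
    (by simp [LoopFree, assign])
    (pre := fun I σ => (Cyclic I σ ∧ σ.num 6 = (σ.arr 4)^[I.n] 0) ∧
      σ.num 7 = σ.arr 4 (σ.num 6))
    (inv := fun I σ τ => (Cyclic I σ ∧ σ.num 6 = (σ.arr 4)^[I.n] 0) ∧ τ.num 3 = σ.num 3 ∧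
      τ.num 6 = σ.num 6 ∧ τ.arr 4 = σ.arr 4 ∧
      ∃ t, Rotating I (σ.arr 4) (σ.num 6) σ.bundle τ.bundle (τ.num 7) t)
    (fun I τ => hitTime (τ.arr 4) (τ.num 6) (τ.num 7)) .X ?_ ?_ ?_
  · refine Spec.seq (post₁ := fun I σ τ => τ = σ.setNum 7 (σ.arr 4 (σ.num 6)))
      (Spec.loopFree (by simp [LoopFree, assign]) ?_) hloop ?_ ?_
    · intro I σ _
      simp
    · rintro I σ τ ⟨h1, h2⟩ rfl
      refine ⟨⟨h1.congr ⟨fun _ _ => rfl, by simp⟩ (by simp), ?_⟩, ?_⟩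
      · simpa (disch := omega) using h2
      · simp (disch := omega)
    · rintro I σ τ ρ - rfl ⟨⟨⟨h, h1⟩, h2, h3, h4, t, h5⟩, h6⟩
      have h6 : ρ.num 7 = ρ.num 6 := by
        simp at h6
        omega
      set σ₁ := σ.setNum 7 (σ.arr 4 (σ.num 6))
      have hx : σ₁.num 6 < I.n := by
        rw [h1]
        exact iterate_lt h.lt I.n_pos _
      have hlt := h5.lt_val h.lt hx h.lt_val (h6.trans h3)
      obtain ⟨π, hπ⟩ := h5.exists_perm
      have hle : ∀ i, I.v i (outputOf I.n σ₁ i) ≤ I.v i (outputOf I.n ρ i) := by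
        intro i
        rw [← I.val_fin, ← I.val_fin]
        by_cases hi : (i : ℕ) = σ₁.num 6
        · change I.val i (σ₁.bundle i) ≤ I.val i (ρ.bundle i)
          rw [hi]
          exact hlt.le
        · exact h5.le_val i i.2 hi
      refine ⟨⟨h.sound.permute π hπ hle, fun g hg => ?_⟩, ?_⟩
      · rw [h2] at hg
        obtain ⟨i, hi⟩ := h.allocated g hg
        refine ⟨π.symm i, ?_⟩
        have := hπ (π.symm i)
        rw [Equiv.apply_symm_apply] at this
        change g ∈ ρ.bundle _
        rw [this]
        exact hi
      · have hrank : I.rank (outputOf I.n ρ) < I.rank (outputOf I.n σ) := by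
          refine Problem.rank_permute (Z := outputOf I.n σ₁) π hπ hle (x := ⟨σ₁.num 6, hx⟩) ?_
          rw [← I.val_fin, ← I.val_fin]
          exact hlt
        exact Problem.mul_succ_add_lt hrank (by omega)
  · rintro I σ ⟨⟨h, h1⟩, h2⟩
    refine ⟨⟨h, h1⟩, rfl, rfl, rfl, 0, ?_⟩
    rw [h2]
    obtain ⟨d, hd, -, hd'⟩ := exists_iterate_eq_self I.n_pos h.lt
    exact Rotating.start ⟨d, hd, by rw [h1]; exact hd'⟩
  · rintro I σ τ ⟨⟨h, h1⟩, -, h3, h4, t, h5⟩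
    obtain ⟨d, hd, hdn, hd'⟩ := exists_iterate_eq_self I.n_pos h.lt
    rw [← h1] at hd'
    -- The cycle has at most `n` agents, so the rotation ends within `n` steps.
    have hp : Function.minimalPeriod (σ.arr 4) (σ.num 6) ≤ d :=
      Function.IsPeriodicPt.minimalPeriod_le hd hd'
    have : hitTime (τ.arr 4) (τ.num 6) (τ.num 7) ≤
        Function.minimalPeriod (σ.arr 4) (σ.num 6) - (t + 1) := by
      rw [h3, h4]
      exact Nat.sInf_le (s := {s | (σ.arr 4)^[s] (τ.num 7) = σ.num 6}) h5.iterate_eq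
    simp only [Polynomial.eval_X]
    omega
  · rintro I σ τ ⟨⟨h, h1⟩, h2, h3, h4, t, h5⟩ hlt
    have hlt : τ.num 7 ≠ τ.num 6 := by
      simp at hlt
      omega
    have hx : σ.num 6 < I.n := by
      rw [h1]
      exact iterate_lt h.lt I.n_pos _
    have hj : τ.num 7 < I.n := h5.eq_iterate ▸ iterate_lt h.lt hx _
    have hstep := h5.step h.lt hx h.lt_val (h3 ▸ hlt)
    refine ⟨⟨⟨h, h1⟩, ?_, ?_, ?_, t + 1, ?_⟩, ?_⟩
    · simpa (disch := omega) using h2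
    · simpa (disch := omega) using h3
    · simpa (disch := omega) using h4
    · have hj' : σ.arr 4 (τ.num 7) = τ.arr 4 (τ.num 7) := by rw [h4]
      rw [hj', ← h3] at hstep
      rw [← h3] at hx ⊢
      simp (disch := omega)
      refine hstep.congr h.lt hx fun i hi => ?_
      by_cases hij : i = τ.num 7
      · subst hij
        simp (disch := omega)
      · by_cases hix : i = τ.num 6
        · subst hix
          simp (disch := omega)
        · simp (disch := omega)
    · have hit : (τ.arr 4)^[Function.minimalPeriod (σ.arr 4) (σ.num 6) - (t + 1)] (τ.num 7) =
          τ.num 6 := by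
        rw [h3, h4]
        exact h5.iterate_eq
      simpa (disch := omega) using hitTime_apply_lt hit hlt

theorem Pending.item_eq_singleton {I : Problem} {σ : State I.m} (h : Pending I σ) :
    ∃ g : Fin I.m, (g : ℕ) = σ.num 3 ∧ item I.m (σ.num 3) = {g} ∧
      ∀ i, g ∉ outputOf I.n σ i := by
  obtain ⟨g, hg, hg'⟩ := h.exists_item
  exact ⟨g, hg, by rw [← hg, item_val], hg'⟩

theorem outputOf_setBundle {I : Problem} (σ : State I.m) {w : ℕ} (hw : w < I.n)
    (S : Finset (Fin I.m)) :
    outputOf I.n (σ.setBundle w S) = Function.update (outputOf I.n σ) ⟨w, hw⟩ S := by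
  funext i
  by_cases hi : i = ⟨w, hw⟩
  · subst hi
    simp [outputOf]
  · have : (i : ℕ) ≠ w := fun h => hi (Fin.ext h)
    simp [outputOf, hi, this]

/-- Every unallocated item leads to one of three moves: a wish is granted, an agent whom nobody
envies takes the item, or an envy cycle is rotated. Each of them lowers `rank`. -/
theorem improve_spec : Spec improve Pending Progress := by
  refine Spec.seq_progress (findWish_spec.mono (fun _ _ h => h) fun I σ τ _ h => h)
    (Spec.branch (Spec.loopFree (by simp [LoopFree, assign]) ?_)
      (Spec.seq_progress (findEnvy_spec.mono ?_ fun I σ τ _ h => h)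
        (Spec.seq_progress (findSource_spec.mono (fun _ _ h => h) fun I σ τ _ h => h)
          (Spec.branch (Spec.loopFree (by simp [LoopFree]) ?_)
            (Spec.seq_progress (walk_spec.mono ?_ fun I σ τ _ h => h) rotate_spec)))))
  · rintro I σ ⟨⟨h, h1, -⟩, hw⟩
    simp at hw
    obtain ⟨g, hg, hg1, hg2⟩ := Pending.item_eq_singleton h
    have hlt := h1 hw
    rw [hg1] at hlt
    have hlt' : I.v ⟨σ.num 5, hw⟩ (outputOf I.n σ ⟨σ.num 5, hw⟩) < I.v ⟨σ.num 5, hw⟩ {g} := by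
      rw [← I.val_fin, ← I.val_fin]
      exact hlt
    have hout : outputOf I.n ((σ.setBundle (σ.num 5) {g}).setNum 3 0) =
        Function.update (outputOf I.n σ) ⟨σ.num 5, hw⟩ {g} := outputOf_setBundle σ hw {g}
    simp only [denote_seq, denote_setBundle, denote_assign, NatExp.eval_reg,
      BundleExp.eval_single, NatExp.eval_const, hg1]
    refine ⟨⟨?_, ?_⟩, ?_⟩
    · rw [hout]
      exact h.sound.update_singleton hg2 hlt'
    · simp
    · unfold completeMeasure
      rw [hout]
      -- The old bundle was released, so the search for items starts again from 0; the drop of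
      -- `rank` outweighs this.
      exact Problem.mul_succ_add_lt (Problem.rank_update_singleton hlt') (by omega)
  · rintro I σ ⟨⟨h, -, h1⟩, hw⟩
    simp at hw
    exact ⟨h, h1 hw⟩
  · rintro I σ ⟨⟨⟨h, hwish⟩, h1, -⟩, hw⟩
    simp at hw
    obtain ⟨g, hg, hg1, hg2⟩ := Pending.item_eq_singleton h
    have hout := outputOf_setBundle σ hw (outputOf I.n σ ⟨σ.num 5, hw⟩ ∪ {g})
    simp only [denote_setBundle, NatExp.eval_reg, BundleExp.eval_single, BundleExp.eval_union,
      BundleExp.eval_load, hg1]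
    change Progress I σ (σ.setBundle (σ.num 5) (outputOf I.n σ ⟨σ.num 5, hw⟩ ∪ {g}))
    refine ⟨⟨?_, ?_⟩, ?_⟩
    · rw [hout]
      refine h.sound.update_union hg2 (fun i => ?_) fun i => ?_
      · rw [← I.val_fin, ← I.val_fin, ← hg1]
        exact hwish i i.2
      · rw [← I.val_fin, ← I.val_fin]
        exact h1 hw i i.2
    · intro g' hg'
      obtain ⟨i, hi⟩ := h.allocated g' hg'
      refine ⟨i, ?_⟩
      rw [hout]
      by_cases hiw : i = ⟨σ.num 5, hw⟩
      · subst hiw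
        simp [hi]
      · simpa [hiw] using hi
    · unfold completeMeasure
      rw [hout]
      exact Problem.mul_succ_add_lt (Problem.rank_update_union hg2) (by omega)
  · rintro I σ ⟨⟨⟨h, -⟩, -, h1⟩, hw⟩
    simp at hw
    exact ⟨h, fun j hj => (h1 hw j hj).1, fun j hj => (h1 hw j hj).2⟩

/-- A polynomial bound for `completeMeasure`. -/
noncomputable def completePoly : Polynomial ℕ :=
  ((.X * .X * (.X + 1) + .X) * (.X * .X + 1) + .X * .X) * (.X + 1) + .X

theorem completeMeasure_le (I : Problem) (σ : State I.m) :
    completeMeasure I σ ≤ completePoly.eval (I.n + I.m) := by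
  have h1 := Problem.rank_le (outputOf I.n σ)
  simp only [completeMeasure, completePoly, Polynomial.eval_add, Polynomial.eval_mul,
    Polynomial.eval_X, Polynomial.eval_one]
  refine add_le_add (Nat.mul_le_mul (h1.trans ?_) (by omega)) (by omega)
  gcongr <;> omega

/-- All items before the current index are allocated. Only granting a wish releases items, and it
resets the index, so the allocation is complete once the index reaches `m`. -/
theorem complete_spec : Spec complete (fun I σ => I.Sound (outputOf I.n σ)) (fun I _ τ =>
    I.Sound (outputOf I.n τ) ∧ IsComplete (outputOf I.n τ)) := by
  refine Spec.seq (pre₂ := Completing) (Spec.loopFree (post := fun I σ τ => τ = σ.setNum 3 0)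
      (by simp [LoopFree, assign]) ?_)
    (Spec.loop (inv := fun I _ τ => Completing I τ) completeMeasure completePoly
      (fun I σ h => h) (fun I σ τ _ => completeMeasure_le I τ)
      (Spec.mono (Spec.seq_progress (pre := fun I σ => Completing I σ ∧ σ.num 3 < I.m)
        (pre₂ := fun I τ => (Completing I τ ∧
          ∀ g, g ∈ τ.bundle I.n ↔ ∃ i, g ∈ outputOf I.n τ i) ∧ τ.num 3 < I.m)
        (collect_spec.mono (fun I σ h => h.1) ?_)
        (Spec.branch (Spec.loopFree (by simp [LoopFree, incr]) ?_)
          (improve_spec.mono ?_ fun _ _ _ _ h => h))) ?_ ?_)) ?_ ?_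
  · intro I σ _
    simp
  · rintro I σ τ ⟨h, h1⟩ ⟨h2, h3⟩
    exact ⟨h2, h3, h2.num_eq ▸ h1⟩
  · rintro I σ ⟨⟨⟨h, h1⟩, h2⟩, h3⟩
    simp only [Test.holds_mem, BundleExp.eval_load, NatExp.eval_agents, NatExp.eval_reg] at h3
    obtain ⟨g, hg, hg3⟩ := h3
    rw [h1] at hg
    simp only [denote_incr]
    refine ⟨⟨h.sound, fun g' hg' => ?_⟩, ?_⟩
    · simp only [State.num_setNum, Nat.lt_succ_iff_lt_or_eq] at hg'
      rcases hg' with hg' | hg'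
      · exact h.allocated g' hg'
      · rw [Fin.ext (hg'.trans hg3.symm)]
        exact hg
    · unfold completeMeasure
      refine Nat.add_lt_add_left ?_ _
      simp only [State.num_setNum]
      omega
  · rintro I σ ⟨⟨⟨h, h1⟩, h2⟩, h3⟩
    simp only [Test.holds_mem, BundleExp.eval_load, NatExp.eval_agents, NatExp.eval_reg] at h3
    refine ⟨h, ⟨σ.num 3, h2⟩, rfl, fun i hi => h3 ⟨_, (h1 _).2 ⟨i, hi⟩, rfl⟩⟩
  · rintro I σ ⟨⟨-, h⟩, hlt⟩
    simp at hlt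
    exact ⟨h, hlt⟩
  · exact fun I σ τ _ h => ⟨fun _ _ => h.1, h.2⟩
  · rintro I σ τ h rfl
    exact ⟨h, by simp⟩
  · rintro I σ τ ρ - - ⟨h, hlt⟩
    simp at hlt
    exact ⟨h.sound, fun g => h.allocated g (g.2.trans_le hlt)⟩

end FairDivision

/-! ### From the product bound to Nash welfare -/

theorem mainTheorem8 :
    ∃ (P : FairDivision.Program) (p : Polynomial ℕ),
      ∀ (n m : ℕ), 1 ≤ n →
      ∀ (v : Fin n → Finset (Fin m) → ℝ),
        (∀ i, FairDivision.IsSubadditiveValuation (v i)) →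
      ∀ (α β : ℝ), 0 ≤ α → α ≤ 1 / 2 → 0 ≤ β → β ≤ 1 →
      ∀ (X : Fin n → Finset (Fin m)),
        FairDivision.IsAllocation X → FairDivision.IsApproxMNW v β X →
      ∃ (t : ℕ) (τ : FairDivision.State m),
        FairDivision.Exec α v P (FairDivision.inputState X) t τ ∧
        t ≤ p.eval (n + m) ∧
        FairDivision.IsAllocation (FairDivision.outputOf n τ) ∧
        FairDivision.IsComplete (FairDivision.outputOf n τ) ∧
        FairDivision.IsApproxEFX v α (FairDivision.outputOf n τ) ∧
        FairDivision.IsApproxMNW v (β / (α + 1)) (FairDivision.outputOf n τ) := by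
  obtain ⟨p, hp⟩ := FairDivision.Spec.seq FairDivision.shrink_spec FairDivision.complete_spec
    (fun _ _ _ _ h => h)
    (post := fun I _ τ => I.Sound (FairDivision.outputOf I.n τ) ∧
      FairDivision.IsComplete (FairDivision.outputOf I.n τ))
    (fun _ _ _ _ _ _ h => h)
  refine ⟨.seq FairDivision.Program.shrink FairDivision.Program.complete, p,
    fun n m hn v hv α β hα hα' hβ hβ' X hX hXβ => ?_⟩
  obtain ⟨t, τ, he, ht, ⟨h1, h2, h3⟩, h4⟩ := hp ⟨n, m, hn, v, hv, α, hα, hα', X, hX⟩ _ rfl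
  refine ⟨t, τ, he, ht, h1, h4, h2, fun Y hY => ?_⟩
  have hn0 : (n : ℝ) ≠ 0 := by exact_mod_cast (by omega : n ≠ 0)
  have hα1 : 0 < 1 + α := by linarith
  have hZ : FairDivision.nashWelfare v X ≤
      (1 + α) * FairDivision.nashWelfare v (FairDivision.outputOf n τ) := by
    unfold FairDivision.nashWelfare
    rw [Real.finsetProd_rpow _ _ fun i _ => (hv i).nonneg _,
      Real.finsetProd_rpow _ _ fun i _ => (hv i).nonneg _]
    -- The n-th root of `(1 + α) ^ n` is the single factor `1 + α` that is lost.
    have h5 := Real.rpow_le_rpow (Finset.prod_nonneg fun i _ => (hv i).nonneg _) h3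
      (z := 1 / (n : ℝ)) (by positivity)
    rw [Real.mul_rpow (by positivity) (Finset.prod_nonneg fun i _ => (hv i).nonneg _),
      ← Real.rpow_natCast, ← Real.rpow_mul hα1.le, mul_one_div_cancel hn0, Real.rpow_one] at h5
    exact h5
  rw [div_mul_eq_mul_div, div_le_iff₀ (by linarith)]
  linarith [hXβ Y hY]
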